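/- **Theorem (error estimates for the TPFA and fitted TPFA $\theta$-schemes).** *Continuous problem.* Let $X=x_{\max}>0$, $T>0$, $\Omega=(0,X)$. Let $r,\sigma$ be Lipschitz continuous on $[0,T]$ with $0\le r(t)\le\bar r$ and $0<\underline\sigma\le\sigma(t)\le\bar\sigma$; put $\beta=\sup_{[0,T]}\sigma^2$ and $$a=\tfrac12\sigma^2,\qquad b=r-\sigma^2,\qquad c_0=2r+\beta-\sigma^2 .$$ $H^1_{0,\omega}(\Omega)$ is the space of all $v\in L^2(\Omega)$ with a weak derivative $v'$ such that $xv'\in L^2(\Omega)$ and with $v=0$ at $x=0$ and $x=X$ (for the continuous representative on $[0,X]$). A function $u\in L^2(0,T;H^1_{0,\omega}(\Omega))$ is a weak solution with source $f$ and initial value $u_0$ if $u(\cdot,0)=u_0$ and, for every $v\in H^1_{0,\omega}(\Omega)$, $$\frac{d}{dt}(u(t),v)+\big(a x^2u'+b\,x\,u,\,v'\big)+(c_0u,v)=(f(t),v)\quad\text{in the sense of distributions on }(0,T),$$ where $(\cdot,\cdot)$ is the inner product of $L^2(\Omega)$. The flux is $F(u)=-a x^2u'-b\,x\,u$. *Meshes.*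 Let $0=x_0<x_1<\dots<x_N<x_{N+1}=X$, $h=\max_{0\le i\le N}(x_{i+1}-x_i)$, $x_{i+1/2}=\frac12(x_i+x_{i+1})$ for $0\le i\le N$, $x_{-1/2}=0$, $x_{N+3/2}=X$, and $l_i=x_{i+1/2}-x_{i-1/2}$ for $0\le i\le N+1$. The mesh is locally quasi-uniform with constant $c>0$ if $l_{i+1}/c\le l_i\le c\,l_{i+1}$ for $0\le i\le N$. Let $0=t_0<\dots<t_M=T$ ($M\ge1$), $\Delta t_m=t_{m+1}-t_m$, $\Delta t=\max_m\Delta t_m$, and $t_{m+\theta}=\theta t_{m+1}+(1-\theta)t_m$. *Schemes.* With $$k_i=\frac{\sigma^2(t)}6\,\frac{x_{i+1/2}^3-x_{i-1/2}^3}{x_{i+1/2}-x_{i-1/2}},\qquad T_i=\frac{k_i}{l_i},\qquad \tau_{i+1/2}=\frac{2T_iT_{i+1}}{T_i+T_{i+1}},$$ the TPFA flux of nodal values $w=(w_0,\dots,w_{N+1})$ at time $t$ is $$F_{i+1/2}(w)=-\tau_{i+1/2}(w_{i+1}-w_i)-x_{i+1/2}\,B_{i+1/2}(w),\qquad 0\le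 i\le N,$$ where $b^+=\max(b,0)$, $b^-=\min(b,0)$ and $B_{i+1/2}$ is one of $$\text{(U)}\quad B_{i+1/2}(w)=b^+w_{i+1}+b^-w_i\ \text{ (upwind value)},\qquad \text{(R)}\quad B_{i+1/2}(w)=b^+w_i+b^-w_{i+1}\ \text{ (reversed value)}.$$ The fitted TPFA flux is the same for $i\ge1$, with $F_{1/2}(w)=-\frac14x_1(a+b)w_1$. For nodal values with $w_0=w_{N+1}=0=v_0=v_{N+1}$ put $$a_h(w,v;t)=\sum_{i=1}^N\big(F_{i+1/2}(w)-F_{i-1/2}(w)\big)v_i+c_0(t)\sum_{i=1}^Nl_iw_iv_i .$$ A discrete solution is a sequence $\zeta_h^0,\dots,\zeta_h^M$ of nodal values, zero at $x_0$ and $x_{N+1}$, with $\zeta^0_{h,i}=u_0(x_i)$ for $1\le i\le N$ and, for $0\le m<M$ and all $v$ with $v_0=v_{N+1}=0$, $$\sum_{i=1}^N l_i\frac{\zeta^{m+1}_{h,i}-\zeta^m_{h,i}}{\Delta t_m}v_i+a_h\big(\theta\zeta_h^{m+1}+(1-\theta)\zeta_h^m,v;t_{m+\theta}\big)=\sum_{i=1}^N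 l_i\big(\theta f(x_i,t_{m+1})+(1-\theta)f(x_i,t_m)\big)v_i .$$ Put $\|w\|_{0,h}^2=\sum_{i=1}^Nl_iw_i^2$. *Claim.* Let $\theta\in[\frac12,1]$ and $c>0$. There is $\delta>0$, depending only on $X,T,r,\sigma,\theta,c$, such that the following holds. Let $f\in C([0,T];H^1(\Omega))$ be continuous on $[0,X]\times[0,T]$ and let $u$ be a weak solution with source $f$ and initial value $u_0$ such that $$u\in H^1(0,T;H^1(\Omega))\cap H^2(0,T;L^2(\Omega)),\qquad F(u)\in C([0,T];H^1(\Omega))$$ ($u$ denotes the representative that is continuous on $[0,X]\times[0,T]$). Then there is a constant $C>0$, independent of $h,\Delta t,M,N$ and of the meshes, such that for every space mesh that is locally quasi-uniform with constant $c$, every time mesh, and every discrete solution $\zeta_h$ of the TPFA or the fitted TPFA scheme, with the upwind value (U), or with the reversed value (R) and $\Delta t\le\delta$, $$\|u(t_m)-\zeta_h^m\|_{0,h}\le C\,(h+\Delta t)\qquad\text{for all } 0\le m\le M .$$ -/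

import Mathlib

open Set Filter Topology MeasureTheory
open scoped ContDiff

noncomputable section

namespace BlackScholes

/-! ### Sobolev spaces on `Ω = (0, X)` -/

/-- `φ ∈ C_c^∞(a, b)`. -/
def IsTest (a b : ℝ) (φ : ℝ → ℝ) : Prop :=
  ContDiff ℝ ∞ φ ∧ HasCompactSupport φ ∧ tsupport φ ⊆ Ioo a b

/-- Lebesgue measure on `Ω = (0, X)`. -/
abbrev dom (X : ℝ) : Measure ℝ := volume.restrict (Ioo 0 X)

/-- `L²(Ω)`. -/
abbrev L2 (X : ℝ) : Type := Lp ℝ 2 (dom X)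

/-- `g` is the weak derivative of `v` on `Ω`. -/
def HasWeakDeriv (X : ℝ) (v g : ℝ → ℝ) : Prop :=
  LocallyIntegrableOn v (Ioo 0 X) ∧ LocallyIntegrableOn g (Ioo 0 X) ∧
    ∀ φ, IsTest 0 X φ →
      ∫ x in Ioo 0 X, v x * deriv φ x = -∫ x in Ioo 0 X, g x * φ x

theorem L2.integrable {X : ℝ} (v : L2 X) : Integrable v (dom X) :=
  (Lp.memLp v).integrable (by norm_num)

theorem L2.locallyIntegrableOn {X : ℝ} (v : L2 X) : LocallyIntegrableOn v (Ioo 0 X) :=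
  IntegrableOn.locallyIntegrableOn (L2.integrable v)

theorem L2.integrable_mul {X : ℝ} (v : L2 X) {ψ : ℝ → ℝ} (hc : Continuous ψ)
    (hs : HasCompactSupport ψ) : Integrable (fun x => v x * ψ x) (dom X) := by
  obtain ⟨C, hC⟩ := hs.exists_bound_of_continuous hc
  exact (L2.integrable v).mul_bdd hc.aestronglyMeasurable (Eventually.of_forall hC)

/-- `H¹(Ω)` as the Hilbert space of pairs `(v, v')` in `L²(Ω) × L²(Ω)`, with norm
`(‖v‖² + ‖v'‖²)^{1/2}`. -/
def H1 (X : ℝ) : Submodule ℝ (WithLp 2 (L2 X × L2 X)) where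
  carrier := {p | HasWeakDeriv X p.fst p.snd}
  zero_mem' := by
    refine ⟨L2.locallyIntegrableOn _, L2.locallyIntegrableOn _, fun φ _ => ?_⟩
    have h : ∀ ψ : ℝ → ℝ, ∫ x in Ioo 0 X, (0 : L2 X) x * ψ x = 0 := fun ψ => by
      refine integral_eq_zero_of_ae ?_
      filter_upwards [Lp.coeFn_zero ℝ 2 (dom X)] with x hx
      have hx' : (0 : L2 X) x = 0 := hx
      simp only [hx', zero_mul, Pi.zero_apply]
    simp only [WithLp.zero_fst, WithLp.zero_snd]
    rw [h, h, neg_zero]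
  add_mem' := by
    rintro p q ⟨_, _, hp⟩ ⟨_, _, hq⟩
    refine ⟨L2.locallyIntegrableOn _, L2.locallyIntegrableOn _, fun φ hφ => ?_⟩
    have hc' : Continuous (deriv φ) := hφ.1.continuous_deriv (by simp)
    have h : ∀ (v w : L2 X) (ψ : ℝ → ℝ), Continuous ψ → HasCompactSupport ψ →
        ∫ x in Ioo 0 X, (v + w : L2 X) x * ψ x
          = (∫ x in Ioo 0 X, v x * ψ x) + ∫ x in Ioo 0 X, w x * ψ x := by
      intro v w ψ h1 h2
      rw [← integral_add (L2.integrable_mul v h1 h2) (L2.integrable_mul w h1 h2)]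
      refine integral_congr_ae ?_
      filter_upwards [Lp.coeFn_add v w] with x hx
      rw [hx, Pi.add_apply, add_mul]
    simp only [WithLp.add_fst, WithLp.add_snd]
    rw [h _ _ _ hc' hφ.2.1.deriv, h _ _ _ hφ.1.continuous hφ.2.1, hp φ hφ, hq φ hφ]
    ring
  smul_mem' := by
    rintro k p ⟨_, _, hp⟩
    refine ⟨L2.locallyIntegrableOn _, L2.locallyIntegrableOn _, fun φ hφ => ?_⟩
    have h : ∀ (v : L2 X) (ψ : ℝ → ℝ),
        ∫ x in Ioo 0 X, (k • v : L2 X) x * ψ x = k * ∫ x in Ioo 0 X, v x * ψ x := by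
      intro v ψ
      rw [← integral_const_mul]
      refine integral_congr_ae ?_
      filter_upwards [Lp.coeFn_smul k v] with x hx
      rw [hx, Pi.smul_apply, smul_eq_mul, mul_assoc]
    simp only [WithLp.smul_fst, WithLp.smul_snd]
    rw [h, h, hp φ hφ]
    ring

theorem isClosed_H1 (X : ℝ) : IsClosed (H1 X : Set (WithLp 2 (L2 X × L2 X))) := by
  have key : ∀ ψ : ℝ → ℝ, Continuous ψ → HasCompactSupport ψ →
      Continuous fun v : L2 X => ∫ x in Ioo 0 X, v x * ψ x := by
    intro ψ h1 h2
    have hm : MemLp ψ 2 (dom X) := (h1.memLp_of_hasCompactSupport h2).restrict _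
    have : (fun v : L2 X => ∫ x in Ioo 0 X, v x * ψ x) = fun v => inner ℝ (hm.toLp ψ) v := by
      funext v
      rw [L2.inner_def]
      refine integral_congr_ae ?_
      filter_upwards [hm.coeFn_toLp] with x hx
      simp [hx]
    rw [this]
    exact continuous_const.inner continuous_id
  have hset : (H1 X : Set (WithLp 2 (L2 X × L2 X))) =
      ⋂ φ : {φ : ℝ → ℝ // IsTest 0 X φ}, {p : WithLp 2 (L2 X × L2 X) |
        ∫ x in Ioo 0 X, p.fst x * deriv φ.1 x = -∫ x in Ioo 0 X, p.snd x * φ.1 x} := by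
    ext p
    simp only [mem_iInter, mem_ofPred_eq, Subtype.forall]
    exact ⟨fun hp => hp.2.2, fun hp => ⟨L2.locallyIntegrableOn _, L2.locallyIntegrableOn _, hp⟩⟩
  rw [hset]
  refine isClosed_iInter fun φ => isClosed_eq ?_ ?_
  · exact (key _ (φ.2.1.continuous_deriv (by simp)) φ.2.2.1.deriv).comp
      (WithLp.prod_continuous_ofLp 2 _ _).fst
  · exact ((key _ φ.2.1.continuous φ.2.2.1).comp (WithLp.prod_continuous_ofLp 2 _ _).snd).neg

instance (X : ℝ) : CompleteSpace (H1 X) := (isClosed_H1 X).completeSpace_coe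

/-- `v ∈ H¹_{0,ω}(Ω)` with weak derivative `g`: `v ∈ L²`, `x g ∈ L²`, and `v` has a representative
that is continuous up to the boundary and vanishes there. -/
def MemH10w (X : ℝ) (v g : ℝ → ℝ) : Prop :=
  MemLp v 2 (dom X) ∧ MemLp (fun x => x * g x) 2 (dom X) ∧ HasWeakDeriv X v g ∧
    ∃ w : ℝ → ℝ, ContinuousOn w (Icc 0 X) ∧ w 0 = 0 ∧ w X = 0 ∧ v =ᵐ[dom X] w

/-! ### Spaces of functions of time -/

/-- `U ∈ L²(0,T;E)` has the weak derivative `V ∈ L²(0,T;E)`. -/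
def HasTimeDeriv {E : Type*} [NormedAddCommGroup E] [NormedSpace ℝ E]
    (T : ℝ) (U V : ℝ → E) : Prop :=
  MemLp U 2 (volume.restrict (Ioo 0 T)) ∧ MemLp V 2 (volume.restrict (Ioo 0 T)) ∧
    ∀ ψ, IsTest 0 T ψ →
      ∫ t in Ioo 0 T, deriv ψ t • U t = -∫ t in Ioo 0 T, ψ t • V t

/-- `w ∈ H¹(0,T;H¹(Ω))`. -/
def MemH1H1 (X T : ℝ) (w : ℝ → ℝ → ℝ) : Prop :=
  ∃ U V : ℝ → H1 X, HasTimeDeriv T U V ∧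
    ∀ᵐ t ∂volume.restrict (Ioo 0 T), (U t).1.fst =ᵐ[dom X] w t

/-- `w ∈ H²(0,T;L²(Ω))`. -/
def MemH2L2 (X T : ℝ) (w : ℝ → ℝ → ℝ) : Prop :=
  ∃ U V W : ℝ → L2 X, HasTimeDeriv T U V ∧ HasTimeDeriv T V W ∧
    ∀ᵐ t ∂volume.restrict (Ioo 0 T), U t =ᵐ[dom X] w t

/-- `w ∈ C([0,T];H¹(Ω))`. -/
def MemCH1 (X T : ℝ) (w : ℝ → ℝ → ℝ) : Prop :=
  ∃ U : ℝ → H1 X, ContinuousOn U (Icc 0 T) ∧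
    ∀ᵐ t ∂volume.restrict (Ioo 0 T), (U t).1.fst =ᵐ[dom X] w t

/-! ### The continuous problem -/

/-- `β = sup_{[0,T]} σ²`. -/
def beta (T : ℝ) (σ : ℝ → ℝ) : ℝ := sSup ((fun t => σ t ^ 2) '' Icc 0 T)

def coefA (σ : ℝ → ℝ) (t : ℝ) : ℝ := σ t ^ 2 / 2

def coefB (r σ : ℝ → ℝ) (t : ℝ) : ℝ := r t - σ t ^ 2

def coefC (T : ℝ) (r σ : ℝ → ℝ) (t : ℝ) : ℝ := 2 * r t + beta T σ - σ t ^ 2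

/-- The bilinear form `A(u,v;t) = (a x² u' + b x u, v') + (c u, v)`; `du`, `dv` are the weak
derivatives of `u`, `v`. -/
def formA (X T : ℝ) (r σ : ℝ → ℝ) (t : ℝ) (u du v dv : ℝ → ℝ) : ℝ :=
  (∫ x in Ioo 0 X, (coefA σ t * x ^ 2 * du x + coefB r σ t * x * u x) * dv x) +
    ∫ x in Ioo 0 X, coefC T r σ t * u x * v x

/-- `u ∈ L²(0,T;H¹_{0,ω}(Ω))` solves `d/dt (u,v) + A(u,v;t) = (f,v)` in the sense of distributions
on `(0,T)`, for all `v ∈ H¹_{0,ω}(Ω)`, and `u(·,0) = u₀`. -/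
def IsWeakSolution (X T : ℝ) (r σ : ℝ → ℝ) (f : ℝ → ℝ → ℝ) (u₀ : ℝ → ℝ)
    (u : ℝ → ℝ → ℝ) : Prop :=
  (∃ du : ℝ → ℝ → ℝ,
    MemLp (fun p : ℝ × ℝ => u p.1 p.2) 2 ((volume.restrict (Ioo 0 T)).prod (dom X)) ∧
    MemLp (fun p : ℝ × ℝ => p.2 * du p.1 p.2) 2 ((volume.restrict (Ioo 0 T)).prod (dom X)) ∧
    (∀ᵐ t ∂volume.restrict (Ioo 0 T), MemH10w X (u t) (du t)) ∧
    ∀ v dv : ℝ → ℝ, MemH10w X v dv → ∀ ψ, IsTest 0 T ψ →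
      -(∫ t in Ioo 0 T, deriv ψ t * ∫ x in Ioo 0 X, u t x * v x) +
          (∫ t in Ioo 0 T, ψ t * formA X T r σ t (u t) (du t) v dv) =
        ∫ t in Ioo 0 T, ψ t * ∫ x in Ioo 0 X, f t x * v x) ∧
  ∀ x ∈ Icc 0 X, u 0 x = u₀ x

/-- `F(u) ∈ C([0,T];H¹(Ω))` for the flux `F(u) = -(a x² u' + b x u)`. -/
def FluxRegular (X T : ℝ) (r σ : ℝ → ℝ) (u : ℝ → ℝ → ℝ) : Prop :=
  ∃ du : ℝ → ℝ → ℝ, (∀ᵐ t ∂volume.restrict (Ioo 0 T), HasWeakDeriv X (u t) (du t)) ∧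
    MemCH1 X T (fun t x => -(coefA σ t * x ^ 2 * du t x) - coefB r σ t * x * u t x)

/-! ### Meshes -/

/-- `0 = x₀ < x₁ < ⋯ < x_N < x_{N+1} = X`. -/
structure SpaceMesh (X : ℝ) where
  N : ℕ
  x : ℕ → ℝ
  x_zero : x 0 = 0
  x_last : x (N + 1) = X
  x_lt : ∀ i ≤ N, x i < x (i + 1)

/-- `0 = t₀ < t₁ < ⋯ < t_M = T`. -/
structure TimeMesh (T : ℝ) where
  M : ℕ
  M_pos : 0 < M
  t : ℕ → ℝ
  t_zero : t 0 = 0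
  t_last : t M = T
  t_lt : ∀ m < M, t m < t (m + 1)

namespace SpaceMesh

variable {X : ℝ} (G : SpaceMesh X)

/-- `h = max_{0 ≤ i ≤ N} (x_{i+1} - x_i)`. -/
def h : ℝ :=
  (Finset.range (G.N + 1)).sup' Finset.nonempty_range_add_one fun i => G.x (i + 1) - G.x i

/-- `face i = x_{i-1/2}`, for `i = 0, …, N + 2`, so that `x_{i+1/2} = face (i + 1)`. -/
def face (i : ℕ) : ℝ :=
  if i = 0 then 0 else if i = G.N + 2 then X else (G.x (i - 1) + G.x i) / 2

/-- The length of the dual cell `K_i = [x_{i-1/2}, x_{i+1/2}]`, for `i = 0, …, N + 1`. -/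
def len (i : ℕ) : ℝ := G.face (i + 1) - G.face i

/-- Local quasi-uniformity with constant `c`. -/
def QuasiUniform (c : ℝ) : Prop :=
  ∀ i ≤ G.N, G.len (i + 1) / c ≤ G.len i ∧ G.len i ≤ c * G.len (i + 1)

/-- `T_i = k_i / l_i`, where `k_i` is the mean value of `σ(t)² x² / 2` over `K_i`. -/
def cellTrans (σ : ℝ → ℝ) (t : ℝ) (i : ℕ) : ℝ :=
  (σ t ^ 2 / 6 * ((G.face (i + 1) ^ 3 - G.face i ^ 3) / (G.face (i + 1) - G.face i))) / G.len i

/-- The transmissibility `τ_{i+1/2}`. -/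
def trans (σ : ℝ → ℝ) (t : ℝ) (i : ℕ) : ℝ :=
  2 * G.cellTrans σ t i * G.cellTrans σ t (i + 1) /
    (G.cellTrans σ t i + G.cellTrans σ t (i + 1))

/-- `‖w‖_{0,h}` of a vector of nodal values. -/
def norm0 (w : ℕ → ℝ) : ℝ := √(∑ i ∈ Finset.Icc 1 G.N, G.len i * w i ^ 2)

/-- Nodal values `w₀, …, w_{N+1}` of an element of `V_h` (zero at both end points). -/
def MemVh (w : ℕ → ℝ) : Prop := w 0 = 0 ∧ w (G.N + 1) = 0

end SpaceMesh

namespace TimeMesh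

variable {T : ℝ} (S : TimeMesh T)

/-- `Δt = max_{0 ≤ m < M} (t_{m+1} - t_m)`. -/
def dt : ℝ :=
  (Finset.range S.M).sup' (Finset.nonempty_range_iff.2 S.M_pos.ne') fun m => S.t (m + 1) - S.t m

end TimeMesh

/-! ### The schemes -/

/-- The spatial discretization. -/
inductive Method
  | tpfa
  | fitted

/-- How the value of `u` at a face `x_{i+1/2}` is taken in the convective flux `-b x u`, whose
transport velocity is `-b x`: from the upstream node, or with the two nodes interchanged. -/
inductive FaceValue
  | upwind
  | reversed

/-- The approximation of `b u` at `x_{i+1/2}`; `b⁺ = max b 0`, `b⁻ = min b 0`. -/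
def FaceValue.eval : FaceValue → (b : ℝ) → (w : ℕ → ℝ) → (i : ℕ) → ℝ
  | .upwind, b, w, i => max b 0 * w (i + 1) + min b 0 * w i
  | .reversed, b, w, i => max b 0 * w i + min b 0 * w (i + 1)

variable {X T : ℝ}

/-- The discrete flux at `x_{i+1/2}`, for `i = 0, …, N`; the fitted method differs from TPFA at
`x_{1/2}` only. -/
def discFlux (G : SpaceMesh X) (meth : Method) (fv : FaceValue) (r σ : ℝ → ℝ) (t : ℝ)
    (w : ℕ → ℝ) (i : ℕ) : ℝ :=
  match meth, i with
  | .fitted, 0 => -(1 / 4 * G.x 1 * (coefA σ t + coefB r σ t) * w 1)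
  | _, i => -(G.trans σ t i * (w (i + 1) - w i)) - G.face (i + 1) * fv.eval (coefB r σ t) w i

/-- The discrete bilinear form (`a_h` for TPFA, `b_h` for fitted TPFA). -/
def discForm (G : SpaceMesh X) (T : ℝ) (meth : Method) (fv : FaceValue) (r σ : ℝ → ℝ) (t : ℝ)
    (w v : ℕ → ℝ) : ℝ :=
  (∑ i ∈ Finset.Icc 1 G.N,
      (discFlux G meth fv r σ t w i - discFlux G meth fv r σ t w (i - 1)) * v i) +
    coefC T r σ t * ∑ i ∈ Finset.Icc 1 G.N, G.len i * w i * v i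

/-- `ζ m i` (`0 ≤ m ≤ M`, `0 ≤ i ≤ N + 1`) are the nodal values of a solution of the fully discrete
`θ`-scheme that starts from the interpolant of `u₀`. -/
def IsDiscreteSolution (G : SpaceMesh X) (S : TimeMesh T) (meth : Method) (fv : FaceValue)
    (θ : ℝ) (r σ : ℝ → ℝ) (f : ℝ → ℝ → ℝ) (u₀ : ℝ → ℝ) (ζ : ℕ → ℕ → ℝ) : Prop :=
  (∀ m ≤ S.M, G.MemVh (ζ m)) ∧
  (∀ i ∈ Finset.Icc 1 G.N, ζ 0 i = u₀ (G.x i)) ∧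
  ∀ m < S.M, ∀ v, G.MemVh v →
    (∑ i ∈ Finset.Icc 1 G.N,
        G.len i * ((ζ (m + 1) i - ζ m i) / (S.t (m + 1) - S.t m)) * v i) +
      discForm G T meth fv r σ (θ * S.t (m + 1) + (1 - θ) * S.t m)
        (fun i => θ * ζ (m + 1) i + (1 - θ) * ζ m i) v =
    ∑ i ∈ Finset.Icc 1 G.N,
      G.len i * (θ * f (S.t (m + 1)) (G.x i) + (1 - θ) * f (S.t m) (G.x i)) * v i

end BlackScholes

end

noncomputable section

namespace BlackScholes

/-! ### Test functions and the fundamental lemma -/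

section Test

variable {E : Type*} [NormedAddCommGroup E] [NormedSpace ℝ E]

/-! The proof is an energy estimate for an error equation, with comparison values adapted to the
transmissibilities. By `trans_eq` the two-point difference is divided by half of l_i + l_{i+1}. This
is the distance between the centres of neighbouring dual cells, not between mesh points, so on a
nonuniform mesh the discrete flux of the values u(x_i) is in general not consistent. The discrete
solution is therefore compared with u at the points `node i`: the cell centres, dilated by one
common factor so that the last becomes X, with the node of index 0 placed at 0. The dilation keeps
the ratios of the spacings and moves each point by at most h, so `abs_diffusion_error_le` yields a
consistent flux on every face but the first, and `RegularData.massSq_node_sub_le` returns to the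
values u(x_i) at cost O(h).

Regularity enters through w = x²u'. Since u' is square integrable, the flux has no boundary value at
0, so w is the primitive of its derivative, and the differential equation expresses w' by ∂ₜu, f, u
and xu'. The flux errors are controlled by the variation of u and w on short intervals. They are
tested against differences of nodal values measured with the weight x²_{i+1/2}/(l_i + l_{i+1}); the
dual weight is singular at 0, and summation turns it into the weight min(1, h/z)² on |w'|²
(`sum_len₂_div_mul_osc_sq_le`). A Hardy inequality, `hardy_weight`, makes such an integral O(h²) for
functions that vanish at 0 and have a square-integrable derivative. This covers u, and it covers f
because the equation forces f(t, 0) = 0 (`RegularCurves.source_zero`). The function ∂ₜu is replaced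
by a difference quotient of u in time, which is of this kind; the replacement costs O(Δt) after
summation over the time steps. At the first face no cancellation is needed, since every term there
is small by itself; hence TPFA and fitted TPFA are treated alike.

Stability is `le_discForm`: summation by parts turns the convective term into a multiple of the
squared mass norm plus a remainder. For upwind values the remainder has the good sign. For reversed
values it is absorbed partly by the diffusion and partly, through quasi-uniformity, by a multiple of
the mass norm. That multiple is the only reason for the restriction Δt ≤ δ. Testing with the
θ-average, where θ ≥ 1/2 is used, gives `exists_massSq_step_le`, and `discrete_gronwall` sums the
steps. -/

theorem IsTest.zero_of_notMem {a b : ℝ} {φ : ℝ → ℝ} (h : IsTest a b φ) {x : ℝ}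
    (hx : x ∉ Ioo a b) : φ x = 0 :=
  image_eq_zero_of_notMem_tsupport fun hx' => hx (h.2.2 hx')

theorem IsTest.contDiff_one {a b : ℝ} {φ : ℝ → ℝ} (h : IsTest a b φ) : ContDiff ℝ 1 φ :=
  h.1.of_le (by exact_mod_cast le_top)

theorem ae_eq_zero_of_test {a b : ℝ} [CompleteSpace E] {V : ℝ → E}
    (hV : LocallyIntegrableOn V (Ioo a b))
    (h : ∀ φ, IsTest a b φ → ∫ t in Ioo a b, φ t • V t = 0) :
    V =ᵐ[volume.restrict (Ioo a b)] 0 := by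
  have := isOpen_Ioo.ae_eq_zero_of_integral_contDiff_smul_eq_zero (μ := volume)
    hV (fun g h1 h2 h3 => by
      rw [← h g ⟨h1, h2, h3⟩, setIntegral_eq_integral_of_forall_compl_eq_zero]
      intro x hx
      rw [IsTest.zero_of_notMem ⟨h1, h2, h3⟩ hx, zero_smul])
  exact (ae_restrict_iff' measurableSet_Ioo).2 this

theorem exists_test_integral_eq_one {a b : ℝ} (hab : a < b) :
    ∃ φ, IsTest a b φ ∧ ∫ t in Ioo a b, φ t = 1 := by
  let f : ContDiffBump ((a + b) / 2) :=
    ⟨(b - a) / 8, (b - a) / 4, by linarith, by linarith⟩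
  have hs : tsupport (f.normed volume) ⊆ Ioo a b := by
    rw [f.tsupport_normed_eq, Real.closedBall_eq_Icc]
    change Icc ((a + b) / 2 - (b - a) / 4) ((a + b) / 2 + (b - a) / 4) ⊆ _
    exact Icc_subset_Ioo (by linarith) (by linarith)
  have ht : IsTest a b (f.normed volume) := ⟨f.contDiff_normed, f.hasCompactSupport_normed, hs⟩
  refine ⟨_, ht, ?_⟩
  rw [setIntegral_eq_integral_of_forall_compl_eq_zero fun x hx => ht.zero_of_notMem hx]
  exact f.integral_normed

theorem exists_Icc_of_test {a b : ℝ} (hab : a < b) {φ : ℝ → ℝ} (h : IsTest a b φ) :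
    ∃ α β, a < α ∧ α ≤ β ∧ β < b ∧ ∀ x, x ∉ Icc α β → φ x = 0 := by
  -- The midpoint is added so that the compact set is nonempty even when φ = 0.
  have hK : IsCompact (insert ((a + b) / 2) (tsupport φ)) := h.2.1.isCompact.insert _
  have hsub : insert ((a + b) / 2) (tsupport φ) ⊆ Ioo a b :=
    insert_subset ⟨by linarith, by linarith⟩ h.2.2
  obtain ⟨α, hα, hα'⟩ := hK.exists_isLeast (insert_nonempty _ _)
  obtain ⟨β, hβ, hβ'⟩ := hK.exists_isGreatest (insert_nonempty _ _)
  refine ⟨α, β, (hsub hα).1, hα' hβ, (hsub hβ).2, fun x hx => ?_⟩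
  exact image_eq_zero_of_notMem_tsupport fun hx' =>
    hx ⟨hα' (mem_insert_of_mem _ hx'), hβ' (mem_insert_of_mem _ hx')⟩

/-- A test function of mean zero is the derivative of a test function. -/
theorem exists_test_deriv_eq {a b : ℝ} (hab : a < b) {φ : ℝ → ℝ} (h : IsTest a b φ)
    (h0 : ∫ t in Ioo a b, φ t = 0) : ∃ ψ, IsTest a b ψ ∧ deriv ψ = φ := by
  obtain ⟨α, β, h1, h2, h3, hz⟩ := exists_Icc_of_test hab h
  have hc : Continuous φ := h.1.continuous
  have hd : ∀ x, HasDerivAt (fun x => ∫ t in a..x, φ t) (φ x) x := fun x =>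
    intervalIntegral.integral_hasDerivAt_right (hc.intervalIntegrable a x)
      (hc.stronglyMeasurableAtFilter _ _) hc.continuousAt
  have hder : deriv (fun x => ∫ t in a..x, φ t) = φ := funext fun x => (hd x).deriv
  have hsm : ContDiff ℝ ∞ fun x => ∫ t in a..x, φ t := by
    rw [contDiff_infty_iff_deriv]
    exact ⟨fun x => (hd x).differentiableAt, by rw [hder]; exact h.1⟩
  have hInt : ∀ x y, (∀ t ∈ uIcc x y, t ∉ Icc α β) → ∫ t in x..y, φ t = 0 := by
    intro x y hxy
    rw [intervalIntegral.integral_congr (g := fun _ => 0) fun t ht => hz t (hxy t ht)]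
    simp
  have hab0 : ∫ t in a..b, φ t = 0 := by
    rw [intervalIntegral.integral_of_le hab.le, integral_Ioc_eq_integral_Ioo, h0]
  -- Left of α nothing has been integrated yet; right of β the integral is the total one, which is
  -- zero by assumption.
  have hzero : ∀ x, x ∉ Icc α β → ∫ t in a..x, φ t = 0 := by
    intro x hx
    rcases lt_or_ge x α with hxα | hxα
    · refine hInt a x fun t ht hm => ?_
      have : t ≤ max a x := ht.2
      have := max_lt h1 hxα
      linarith [hm.1]
    · have hxβ : β < x := by
        by_contra hcon
        exact hx ⟨hxα, not_lt.1 hcon⟩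
      rw [← intervalIntegral.integral_add_adjacent_intervals (hc.intervalIntegrable a b)
        (hc.intervalIntegrable b x), hab0, zero_add]
      refine hInt b x fun t ht hm => ?_
      have : min b x ≤ t := ht.1
      have := lt_min h3 hxβ
      linarith [hm.2]
  have hts : tsupport (fun x => ∫ t in a..x, φ t) ⊆ Icc α β := by
    refine closure_minimal (fun x hx => ?_) isClosed_Icc
    by_contra hcon
    exact hx (hzero x hcon)
  refine ⟨_, ⟨hsm, ?_, hts.trans (Icc_subset_Ioo h1 h3)⟩, hder⟩
  exact isCompact_Icc.of_isClosed_subset (isClosed_tsupport _) hts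

theorem intervalIntegrable_of_Ioo {E : Type*} [NormedAddCommGroup E] {T : ℝ} {V : ℝ → E}
    (hV : IntegrableOn V (Ioo 0 T)) {a b : ℝ} (ha : a ∈ Icc 0 T) (hb : b ∈ Icc 0 T) :
    IntervalIntegrable V volume a b := by
  have h : IntegrableOn V (Icc 0 T) :=
    integrableOn_Icc_iff_integrableOn_Ioo (by simp) (by simp) |>.2 hV
  exact (h.mono_set (uIcc_subset_Icc ha hb)).intervalIntegrable

theorem continuousOn_primitive_of_Ioo {T : ℝ} {V : ℝ → E} (hV : IntegrableOn V (Ioo 0 T)) :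
    ContinuousOn (fun t => ∫ s in 0..t, V s) (Icc 0 T) := by
  rcases le_or_gt 0 T with h | h
  · have := intervalIntegral.continuousOn_primitive_interval (a := 0) (b := T) (f := V)
      (μ := volume) (by
        rw [uIcc_of_le h]
        exact integrableOn_Icc_iff_integrableOn_Ioo (by simp) (by simp) |>.2 hV)
    rwa [uIcc_of_le h] at this
  · rw [Icc_eq_empty (not_le.2 h)]; exact continuousOn_empty _

variable [CompleteSpace E]

/-- Integration by parts against a primitive. -/
theorem integral_deriv_smul_primitive {T : ℝ} {V : ℝ → E}
    (hV : IntegrableOn V (Ioo 0 T)) {ψ : ℝ → ℝ} (hψ : ContDiff ℝ 1 ψ) (hψT : ψ T = 0) :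
    ∫ t in Ioo 0 T, deriv ψ t • ∫ s in 0..t, V s = -∫ t in Ioo 0 T, ψ t • V t := by
  have hc : Continuous (deriv ψ) := hψ.continuous_deriv le_rfl
  let μ : Measure ℝ := volume.restrict (Ioo 0 T)
  -- Fubini on the triangle s ≤ t: integrating ψ' over t from s to T gives -ψ(s), because ψ vanishes
  -- at T.
  let k : ℝ → ℝ → ℝ := fun t s => if s ≤ t then deriv ψ t else 0
  have hin : ∀ t ∈ Ioo 0 T, deriv ψ t • ∫ s in 0..t, V s = ∫ s, k t s • V s ∂μ := by
    intro t ht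
    have hsub : Ioc 0 t = Ioo 0 T ∩ Iic t := by
      ext s
      simp only [mem_Ioc, mem_inter_iff, mem_Ioo, mem_Iic]
      constructor
      · rintro ⟨h1, h2⟩; exact ⟨⟨h1, h2.trans_lt ht.2⟩, h2⟩
      · rintro ⟨⟨h1, _⟩, h2⟩; exact ⟨h1, h2⟩
    rw [intervalIntegral.integral_of_le ht.1.le, hsub, ← integral_smul, inter_comm,
      ← Measure.restrict_restrict measurableSet_Iic, ← integral_indicator measurableSet_Iic]
    refine integral_congr_ae (Eventually.of_forall fun s => ?_)
    by_cases hs : s ≤ t <;> simp [k, hs]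
  obtain ⟨C, hC⟩ := isCompact_Icc.exists_bound_of_continuousOn (hc.continuousOn (s := Icc 0 T))
  have hk : Integrable (Function.uncurry fun t s => k t s • V s) (μ.prod μ) := by
    have h1 : Integrable (fun p : ℝ × ℝ => V p.2) (μ.prod μ) := Integrable.comp_snd hV μ
    have hm : Measurable (fun p : ℝ × ℝ => k p.1 p.2) :=
      Measurable.ite (measurableSet_le measurable_snd measurable_fst)
        (hc.measurable.comp measurable_fst) measurable_const
    refine h1.bdd_smul C hm.aestronglyMeasurable ?_
    have : ∀ᵐ p ∂μ.prod μ, p.1 ∈ Ioo 0 T := by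
      have := ae_restrict_mem (μ := (volume : Measure ℝ)) (measurableSet_Ioo (a := (0:ℝ)) (b := T))
      exact Measure.quasiMeasurePreserving_fst.ae this
    filter_upwards [this] with p hp
    have hp' := hC p.1 (Ioo_subset_Icc_self hp)
    by_cases hs : p.2 ≤ p.1
    · simpa [k, hs] using hp'
    · simpa [k, hs] using (norm_nonneg _).trans hp'
  have hout : ∀ s ∈ Ioo 0 T, ∫ t, k t s • V s ∂μ = -(ψ s • V s) := by
    intro s hs
    rw [integral_smul_const]
    have : ∫ t, k t s ∂μ = -ψ s := by
      have e : ∀ t, k t s = (Ici s).indicator (deriv ψ) t := fun t => by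
        by_cases hst : s ≤ t <;> simp [k, hst]
      simp_rw [e]
      rw [integral_indicator measurableSet_Ici, Measure.restrict_restrict measurableSet_Ici]
      have hsub : Ici s ∩ Ioo 0 T = Ico s T := by
        ext t
        simp only [mem_inter_iff, mem_Ici, mem_Ioo, mem_Ico]
        constructor
        · rintro ⟨h1, _, h2⟩; exact ⟨h1, h2⟩
        · rintro ⟨h1, h2⟩; exact ⟨h1, hs.1.trans_le h1, h2⟩
      rw [hsub, integral_Ico_eq_integral_Ioo, ← integral_Ioc_eq_integral_Ioo,
        ← intervalIntegral.integral_of_le hs.2.le,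
        intervalIntegral.integral_deriv_eq_sub
          (fun x _ => (hψ.differentiable one_ne_zero).differentiableAt)
          (hc.intervalIntegrable _ _), hψT, zero_sub]
    rw [this, neg_smul]
  rw [setIntegral_congr_fun measurableSet_Ioo hin, integral_integral_swap hk,
    setIntegral_congr_fun measurableSet_Ioo hout, integral_neg]

/-- A function with an integrable weak derivative is a primitive of it, up to a constant. -/
theorem eq_const_add_primitive {T : ℝ} (hT : 0 < T) {U V : ℝ → E}
    (hU : IntegrableOn U (Ioo 0 T)) (hV : IntegrableOn V (Ioo 0 T))
    (h : ∀ ψ, IsTest 0 T ψ → ∫ t in Ioo 0 T, deriv ψ t • U t = -∫ t in Ioo 0 T, ψ t • V t) :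
    ∃ c : E, ∀ᵐ t ∂volume.restrict (Ioo 0 T), U t = c + ∫ s in 0..t, V s := by
  obtain ⟨φ₀, hφ₀, hone⟩ := exists_test_integral_eq_one hT
  -- Z has weak derivative zero. Any test function minus its mean times φ₀ is the derivative of a
  -- test function, so Z pairs with it to zero; hence Z equals its φ₀-average.
  let Z : ℝ → E := fun t => U t - ∫ s in 0..t, V s
  have hI : IntegrableOn (fun t => ∫ s in 0..t, V s) (Ioo 0 T) :=
    ((continuousOn_primitive_of_Ioo hV).integrableOn_Icc).mono_set Ioo_subset_Icc_self
  have hZ : IntegrableOn Z (Ioo 0 T) := hU.sub hI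
  have hbd : ∀ {φ : ℝ → ℝ} {W : ℝ → E}, Continuous φ → HasCompactSupport φ →
      IntegrableOn W (Ioo 0 T) → IntegrableOn (fun t => φ t • W t) (Ioo 0 T) := by
    intro φ W h1 h2 h3
    obtain ⟨C, hC⟩ := h2.exists_bound_of_continuous h1
    exact Integrable.bdd_smul h3 C h1.aestronglyMeasurable (Eventually.of_forall hC)
  have hZ0 : ∀ ψ, IsTest 0 T ψ → ∫ t in Ioo 0 T, deriv ψ t • Z t = 0 := by
    intro ψ hψ
    have hc' : Continuous (deriv ψ) := hψ.1.continuous_deriv (by simp)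
    simp only [Z, smul_sub]
    rw [integral_sub (hbd hc' hψ.2.1.deriv hU) (hbd hc' hψ.2.1.deriv hI), h ψ hψ,
      integral_deriv_smul_primitive hV hψ.contDiff_one
        (hψ.zero_of_notMem (by simp)), sub_self]
  refine ⟨∫ t in Ioo 0 T, φ₀ t • Z t, ?_⟩
  set c := ∫ t in Ioo 0 T, φ₀ t • Z t
  have hZc : IntegrableOn (fun t => Z t - c) (Ioo 0 T) :=
    hZ.sub (integrableOn_const (by simp))
  have key := ae_eq_zero_of_test hZc.locallyIntegrableOn fun φ hφ => by
    have hInt : ∀ {φ}, IsTest 0 T φ → IntegrableOn φ (Ioo 0 T) := fun {φ} h =>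
      (h.1.continuous.integrable_of_hasCompactSupport h.2.1).integrableOn
    set m := ∫ t in Ioo 0 T, φ t
    have htest : IsTest 0 T fun t => φ t - m * φ₀ t := by
      refine ⟨hφ.1.sub (contDiff_const.mul hφ₀.1), hφ.2.1.sub hφ₀.2.1.mul_left, ?_⟩
      refine (tsupport_sub _ _).trans (union_subset hφ.2.2 ?_)
      exact (tsupport_mul_subset_right).trans hφ₀.2.2
    obtain ⟨ψ, hψ, hd⟩ := exists_test_deriv_eq hT htest (by
      rw [integral_sub (hInt hφ) ((hInt hφ₀).const_mul m), integral_const_mul, hone, mul_one,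
        sub_self])
    have h0 := hZ0 ψ hψ
    rw [hd] at h0
    simp only [sub_smul, mul_smul] at h0
    rw [integral_sub (hbd hφ.1.continuous hφ.2.1 hZ)
      (g := fun t => m • φ₀ t • Z t) ((hbd hφ₀.1.continuous hφ₀.2.1 hZ).smul m),
      integral_smul] at h0
    simp only [smul_sub]
    rw [integral_sub (hbd hφ.1.continuous hφ.2.1 hZ)
      ((hInt hφ).smul_const c), integral_smul_const]
    exact h0
  filter_upwards [key] with t ht
  have : U t - (∫ s in 0..t, V s) - c = 0 := ht
  rw [sub_sub, sub_eq_zero, add_comm] at this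
  exact this

end Test

/-! ### Weak derivatives in time -/

section TimeDeriv

variable {E F : Type*} [NormedAddCommGroup E] [NormedSpace ℝ E]
  [NormedAddCommGroup F] [NormedSpace ℝ F]
variable {T : ℝ} {U V U' V' : ℝ → E}

theorem integrableOn_of_memLp_two {E : Type*} [NormedAddCommGroup E] {T : ℝ} {U : ℝ → E}
    (h : MemLp U 2 (volume.restrict (Ioo 0 T))) : IntegrableOn U (Ioo 0 T) :=
  h.integrable (by norm_num)

theorem integrableOn_test_smul {E : Type*} [NormedAddCommGroup E] [NormedSpace ℝ E] {T : ℝ}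
    {ψ : ℝ → ℝ} (hc : Continuous ψ) (hs : HasCompactSupport ψ) {U : ℝ → E}
    (hU : IntegrableOn U (Ioo 0 T)) : IntegrableOn (fun t => ψ t • U t) (Ioo 0 T) := by
  obtain ⟨C, hC⟩ := hs.exists_bound_of_continuous hc
  exact Integrable.bdd_smul hU C hc.aestronglyMeasurable (Eventually.of_forall hC)

theorem HasTimeDeriv.congr_left (h : HasTimeDeriv T U V)
    (hU : U =ᵐ[volume.restrict (Ioo 0 T)] U') : HasTimeDeriv T U' V := by
  refine ⟨(memLp_congr_ae hU).1 h.1, h.2.1, fun ψ hψ => ?_⟩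
  rw [← h.2.2 ψ hψ]
  refine integral_congr_ae ?_
  filter_upwards [hU] with t ht
  rw [ht]

variable [CompleteSpace E] [CompleteSpace F]

theorem HasTimeDeriv.ae_unique (h : HasTimeDeriv T U V) (h' : HasTimeDeriv T U V') :
    V =ᵐ[volume.restrict (Ioo 0 T)] V' := by
  have hV := integrableOn_of_memLp_two h.2.1
  have hV' := integrableOn_of_memLp_two h'.2.1
  have := ae_eq_zero_of_test (hV.sub hV').locallyIntegrableOn fun φ hφ => by
    simp only [Pi.sub_apply, smul_sub]
    rw [integral_sub (integrableOn_test_smul hφ.1.continuous hφ.2.1 hV)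
      (integrableOn_test_smul hφ.1.continuous hφ.2.1 hV'), sub_eq_zero]
    exact neg_injective ((h.2.2 φ hφ).symm.trans (h'.2.2 φ hφ))
  filter_upwards [this] with t ht
  exact sub_eq_zero.1 ht

/-- Bounded linear maps commute with the Bochner integral. This is applied to the projection from H¹
to L² and to the boundary functional `H1.trace`. -/
theorem HasTimeDeriv.map (L : E →L[ℝ] F) (h : HasTimeDeriv T U V) :
    HasTimeDeriv T (fun t => L (U t)) fun t => L (V t) := by
  refine ⟨L.comp_memLp' h.1, L.comp_memLp' h.2.1, fun ψ hψ => ?_⟩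
  have hU := integrableOn_test_smul (hψ.1.continuous_deriv (by simp)) hψ.2.1.deriv
    (integrableOn_of_memLp_two h.1)
  have hV := integrableOn_test_smul hψ.1.continuous hψ.2.1 (integrableOn_of_memLp_two h.2.1)
  have h1 := L.integral_comp_comm hU
  have h2 := L.integral_comp_comm hV
  simp only [map_smul] at h1 h2
  rw [h1, h2, h.2.2 ψ hψ, map_neg]

theorem HasTimeDeriv.exists_continuousOn (hT : 0 < T) (h : HasTimeDeriv T U V) :
    ∃ U' : ℝ → E, ContinuousOn U' (Icc 0 T) ∧ U =ᵐ[volume.restrict (Ioo 0 T)] U' ∧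
      ∀ s ∈ Icc 0 T, ∀ t ∈ Icc 0 T, U' t - U' s = ∫ τ in s..t, V τ := by
  have hV := integrableOn_of_memLp_two h.2.1
  obtain ⟨c, hc⟩ := eq_const_add_primitive hT (integrableOn_of_memLp_two h.1) hV h.2.2
  refine ⟨fun t => c + ∫ s in 0..t, V s,
    continuousOn_const.add (continuousOn_primitive_of_Ioo hV), hc, fun s hs t ht => ?_⟩
  have h0 : (0 : ℝ) ∈ Icc 0 T := ⟨le_rfl, hT.le⟩
  rw [add_sub_add_left_eq_sub, intervalIntegral.integral_interval_sub_left
    (intervalIntegrable_of_Ioo hV h0 ht) (intervalIntegrable_of_Ioo hV h0 hs)]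

/-- The hypotheses of the theorem hold at almost every time, while the schemes sample u and f at
mesh times. This is the device that upgrades one to the other. -/
theorem eqOn_Icc_of_ae_eq_Ioo {Y : Type*} [TopologicalSpace Y] [T2Space Y] {f g : ℝ → Y}
    (hT : 0 < T) (hf : ContinuousOn f (Icc 0 T)) (hg : ContinuousOn g (Icc 0 T))
    (h : f =ᵐ[volume.restrict (Ioo 0 T)] g) : EqOn f g (Icc 0 T) :=
  Measure.eqOn_Icc_of_ae_eq (μ := volume) hT.ne
    (by rwa [← Measure.restrict_congr_set Ioo_ae_eq_Icc]) hf hg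

end TimeDeriv

/-! ### Pairings and primitives on `Ω` -/

section Pairing

variable {X : ℝ}

theorem memLp_dom_of_continuousOn {ψ : ℝ → ℝ} (h : ContinuousOn ψ (Icc 0 X)) :
    MemLp ψ 2 (dom X) := by
  obtain ⟨C, hC⟩ := isCompact_Icc.exists_bound_of_continuousOn h
  refine MemLp.of_bound (C := C) ?_ ?_
  · exact (h.mono Ioo_subset_Icc_self).aestronglyMeasurable measurableSet_Ioo
  · exact (ae_restrict_iff' measurableSet_Ioo).2
      (Eventually.of_forall fun x hx => hC x (Ioo_subset_Icc_self hx))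

/-- The functional `v ↦ ∫ v ψ` on `L²(Ω)`. -/
def pairing (X : ℝ) (ψ : ℝ → ℝ) (h : Continuous ψ) : L2 X →L[ℝ] ℝ :=
  innerSL ℝ ((memLp_dom_of_continuousOn (X := X) h.continuousOn).toLp ψ)

theorem pairing_apply {ψ : ℝ → ℝ} (h : Continuous ψ) (v : L2 X) :
    pairing X ψ h v = ∫ x in Ioo 0 X, v x * ψ x := by
  rw [pairing, innerSL_apply_apply, L2.inner_def]
  refine integral_congr_ae ?_
  filter_upwards [(memLp_dom_of_continuousOn (X := X) h.continuousOn).coeFn_toLp] with x hx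
  simp [hx]

theorem pairing_eq_of_ae {ψ : ℝ → ℝ} (h : Continuous ψ) {v : L2 X} {w : ℝ → ℝ}
    (hv : v =ᵐ[dom X] w) : pairing X ψ h v = ∫ x in Ioo 0 X, w x * ψ x := by
  rw [pairing_apply]
  refine integral_congr_ae ?_
  filter_upwards [hv] with x hx
  rw [hx]

theorem L2.eq_zero_of_pairing {v : L2 X}
    (h : ∀ φ (hφ : IsTest 0 X φ), pairing X φ hφ.1.continuous v = 0) : v = 0 := by
  have := ae_eq_zero_of_test (L2.locallyIntegrableOn v) fun φ hφ => by
    have := h φ hφ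
    rw [pairing_apply] at this
    simpa only [smul_eq_mul, mul_comm] using this
  exact (Lp.eq_zero_iff_ae_eq_zero).2 this

/-- Uniform continuity on the compact rectangle makes the slices close in the supremum norm, hence
in L². -/
theorem exists_continuousOn_L2 {T : ℝ} {u : ℝ → ℝ → ℝ}
    (h : ContinuousOn (Function.uncurry u) (Icc 0 T ×ˢ Icc 0 X)) :
    ∃ U : ℝ → L2 X, ContinuousOn U (Icc 0 T) ∧ ∀ t ∈ Icc 0 T, U t =ᵐ[dom X] u t := by
  have hs : ∀ t ∈ Icc 0 T, ContinuousOn (u t) (Icc 0 X) := fun t ht =>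
    h.comp (f := fun x => (t, x)) (by fun_prop) fun x hx => ⟨ht, hx⟩
  classical
  let U : ℝ → L2 X := fun t =>
    if ht : t ∈ Icc 0 T then (memLp_dom_of_continuousOn (hs t ht)).toLp (u t) else 0
  have hU : ∀ t ∈ Icc 0 T, U t =ᵐ[dom X] u t := fun t ht => by
    simp only [U, dif_pos ht]
    exact MemLp.coeFn_toLp _
  refine ⟨U, ?_, hU⟩
  have huc := (isCompact_Icc.prod isCompact_Icc).uniformContinuousOn_of_continuous h
  rw [Metric.continuousOn_iff]
  intro t ht ε hε
  set m : ℝ := (measureUnivNNReal (dom X) : ℝ) ^ (2 : ENNReal).toReal⁻¹ with hm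
  have hm0 : 0 ≤ m := by positivity
  obtain ⟨δ, hδ, hd⟩ := Metric.uniformContinuousOn_iff.1 huc (ε / (2 * (m + 1))) (by positivity)
  refine ⟨δ, hδ, fun s hst hsd => ?_⟩
  rw [dist_eq_norm]
  have hb : ‖U s - U t‖ ≤ m * (ε / (2 * (m + 1))) := by
    refine Lp.norm_le_of_ae_bound (by positivity) ?_
    filter_upwards [Lp.coeFn_sub (U s) (U t), hU s hst, hU t ht,
      ae_restrict_mem measurableSet_Ioo] with x h1 h2 h3 h4
    rw [h1, Pi.sub_apply, h2, h3]
    have := hd (s, x) ⟨hst, Ioo_subset_Icc_self h4⟩ (t, x) ⟨ht, Ioo_subset_Icc_self h4⟩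
      (by simpa [Prod.dist_eq] using hsd)
    exact (dist_eq_norm (u s x) (u t x) ▸ this).le
  refine hb.trans_lt ?_
  rw [← mul_div_assoc, div_lt_iff₀ (by positivity)]
  nlinarith

/-- The projections of `H¹(Ω)`. -/
def H1.val (X : ℝ) : H1 X →L[ℝ] L2 X := (WithLp.fstL 2 ℝ (L2 X) (L2 X)).comp (H1 X).subtypeL

def H1.der (X : ℝ) : H1 X →L[ℝ] L2 X := (WithLp.sndL 2 ℝ (L2 X) (L2 X)).comp (H1 X).subtypeL

theorem H1.norm_sq (p : H1 X) : ‖p‖ ^ 2 = ‖H1.val X p‖ ^ 2 + ‖H1.der X p‖ ^ 2 :=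
  WithLp.prod_norm_sq_eq_of_L2 p.1

theorem H1.hasWeakDeriv (p : H1 X) : HasWeakDeriv X (H1.val X p) (H1.der X p) := p.2

theorem H1.norm_der_le (p : H1 X) : ‖H1.der X p‖ ≤ ‖p‖ := by
  have := H1.norm_sq p
  exact abs_le_of_sq_le_sq' (by nlinarith [sq_nonneg ‖H1.val X p‖]) (norm_nonneg _) |>.2

theorem H1.exists_primitive (hX : 0 < X) (p : H1 X) :
    ∃ c : ℝ, ∀ᵐ x ∂dom X, H1.val X p x = c + ∫ y in 0..x, H1.der X p y := by
  refine eq_const_add_primitive hX (L2.integrable _) (L2.integrable _) fun ψ hψ => ?_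
  have := (H1.hasWeakDeriv p).2.2 ψ hψ
  simpa only [smul_eq_mul, mul_comm] using this

theorem HasWeakDeriv.congr_left {v v' g : ℝ → ℝ} (h : HasWeakDeriv X v g)
    (hv : v =ᵐ[dom X] v') : HasWeakDeriv X v' g := by
  refine ⟨?_, h.2.1, fun φ hφ => ?_⟩
  · intro x hx
    obtain ⟨s, hs, hi⟩ := h.1 x hx
    refine ⟨s ∩ Ioo 0 X, inter_mem hs self_mem_nhdsWithin, ?_⟩
    refine (hi.mono_set inter_subset_left).congr ?_
    exact ae_restrict_of_ae_restrict_of_subset inter_subset_right hv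
  · rw [← h.2.2 φ hφ]
    refine integral_congr_ae ?_
    filter_upwards [hv] with x hx
    rw [hx]

theorem integrableOn_test_smul_of_locallyIntegrableOn {g φ : ℝ → ℝ} (hφ : IsTest 0 X φ)
    (hg : LocallyIntegrableOn g (Ioo 0 X)) : IntegrableOn (fun x => φ x • g x) (Ioo 0 X) := by
  have h1 := hg.integrableOn_compact_subset hφ.2.2 hφ.2.1.isCompact
  obtain ⟨C, hC⟩ := hφ.2.1.exists_bound_of_continuous hφ.1.continuous
  have h2 : IntegrableOn (fun x => φ x • g x) (tsupport φ) :=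
    Integrable.bdd_smul h1 C hφ.1.continuous.aestronglyMeasurable (Eventually.of_forall hC)
  exact (h2.integrable_of_forall_notMem_eq_zero fun x hx => by
    rw [image_eq_zero_of_notMem_tsupport hx, zero_smul]).integrableOn

/-- The weak formulation, the flux hypothesis and the H¹-valued curve each bring their own spatial
derivative of u; this identifies them. -/
theorem HasWeakDeriv.ae_unique {v g g' : ℝ → ℝ} (h : HasWeakDeriv X v g)
    (h' : HasWeakDeriv X v g') : g =ᵐ[dom X] g' := by
  have := ae_eq_zero_of_test (h.2.1.sub h'.2.1) fun φ hφ => by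
    simp only [Pi.sub_apply, smul_sub]
    rw [integral_sub (integrableOn_test_smul_of_locallyIntegrableOn hφ h.2.1)
      (integrableOn_test_smul_of_locallyIntegrableOn hφ h'.2.1), sub_eq_zero]
    have := neg_injective ((h.2.2 φ hφ).symm.trans (h'.2.2 φ hφ))
    simpa only [smul_eq_mul, mul_comm] using this
  filter_upwards [this] with t ht
  exact sub_eq_zero.1 ht

theorem memH10w_of_test (hX : 0 < X) {v : ℝ → ℝ} (hv : IsTest 0 X v) :
    MemH10w X v (deriv v) := by
  have hc' : Continuous (deriv v) := hv.1.continuous_deriv (by simp)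
  have hc := hv.1.continuous
  have h0 : v 0 = 0 := hv.zero_of_notMem (by simp)
  have h1 : v X = 0 := hv.zero_of_notMem (by simp)
  refine ⟨memLp_dom_of_continuousOn hc.continuousOn,
    memLp_dom_of_continuousOn (continuous_id.mul hc').continuousOn,
    ⟨hc.locallyIntegrable.locallyIntegrableOn _, hc'.locallyIntegrable.locallyIntegrableOn _,
      fun φ hφ => ?_⟩, v, hc.continuousOn, h0, h1, EventuallyEq.rfl⟩
  have hd : ∀ {w : ℝ → ℝ}, IsTest 0 X w → ∀ x ∈ uIcc 0 X, HasDerivAt w (deriv w x) x :=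
    fun hw x _ => ((hw.1.differentiable (by simp)) x).hasDerivAt
  have := intervalIntegral.integral_mul_deriv_eq_deriv_mul (hd hv) (hd hφ)
    (hc'.intervalIntegrable _ _) ((hφ.1.continuous_deriv (by simp)).intervalIntegrable _ _)
  rw [h0, h1, zero_mul, zero_mul, sub_zero, zero_sub, intervalIntegral.integral_of_le hX.le,
    intervalIntegral.integral_of_le hX.le, integral_Ioc_eq_integral_Ioo,
    integral_Ioc_eq_integral_Ioo] at this
  exact this

end Pairing

/-! ### Coefficients -/

section Coef

variable {T : ℝ} {r σ : ℝ → ℝ}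

theorem continuousOn_coefA (hσ : ContinuousOn σ (Icc 0 T)) :
    ContinuousOn (coefA σ) (Icc 0 T) := by
  unfold coefA; fun_prop

theorem continuousOn_coefB (hr : ContinuousOn r (Icc 0 T)) (hσ : ContinuousOn σ (Icc 0 T)) :
    ContinuousOn (coefB r σ) (Icc 0 T) := by
  unfold coefB; fun_prop

theorem continuousOn_coefC (hr : ContinuousOn r (Icc 0 T)) (hσ : ContinuousOn σ (Icc 0 T)) :
    ContinuousOn (coefC T r σ) (Icc 0 T) := by
  unfold coefC; fun_prop

end Coef

/-! ### The regular solution as a curve in function spaces -/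

/-- `U`, `Uf`, `UF` are the continuous curves `u`, `f`, `F(u)` in `H¹(Ω)`, `P` is `∂ₜu` as a
continuous curve in `L²(Ω)`, `V` is `∂ₜu` as an element of `L²(0,T;H¹(Ω))` and `W` is `∂ₜₜu`. -/
structure RegularCurves (X T : ℝ) (r σ : ℝ → ℝ) (f u : ℝ → ℝ → ℝ)
    (U V Uf UF : ℝ → H1 X) (P W : ℝ → L2 X) : Prop where
  contU : ContinuousOn U (Icc 0 T)
  contUf : ContinuousOn Uf (Icc 0 T)
  contUF : ContinuousOn UF (Icc 0 T)
  contP : ContinuousOn P (Icc 0 T)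
  valU : ∀ t ∈ Icc 0 T, H1.val X (U t) =ᵐ[dom X] u t
  valUf : ∀ t ∈ Icc 0 T, H1.val X (Uf t) =ᵐ[dom X] f t
  valUF : ∀ t ∈ Icc 0 T, ∀ᵐ x ∂dom X, H1.val X (UF t) x =
    -(coefA σ t * x ^ 2 * H1.der X (U t) x) - coefB r σ t * x * u t x
  eqn : ∀ t, P t = H1.val X (Uf t) - H1.der X (UF t) - coefC T r σ t • H1.val X (U t)
  bdry : ∀ t ∈ Icc 0 T, u t 0 = 0 ∧ u t X = 0
  memV : MemLp V 2 (volume.restrict (Ioo 0 T))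
  memW : MemLp W 2 (volume.restrict (Ioo 0 T))
  derivU : HasTimeDeriv T U V
  diffU : ∀ s ∈ Icc 0 T, ∀ t ∈ Icc 0 T, U t - U s = ∫ τ in s..t, V τ
  diffP : ∀ s ∈ Icc 0 T, ∀ t ∈ Icc 0 T, P t - P s = ∫ τ in s..t, W τ
  valV : ∀ᵐ t ∂volume.restrict (Ioo 0 T), H1.val X (V t) = P t

section Extract

variable {X T : ℝ} {r σ : ℝ → ℝ} {f u : ℝ → ℝ → ℝ} {u₀ : ℝ → ℝ}

theorem ae_mem_Icc {T : ℝ} : ∀ᵐ t ∂volume.restrict (Ioo 0 T), t ∈ Icc 0 T := by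
  filter_upwards [ae_restrict_mem measurableSet_Ioo] with t ht using Ioo_subset_Icc_self ht

theorem continuousOn_slice (h : ContinuousOn (Function.uncurry u) (Icc 0 T ×ˢ Icc 0 X)) {t : ℝ}
    (ht : t ∈ Icc 0 T) : ContinuousOn (u t) (Icc 0 X) :=
  h.comp (f := fun x => (t, x)) (by fun_prop) fun _ hx => ⟨ht, hx⟩

/-- A continuous curve that agrees with a jointly continuous function at almost every time agrees
with it at every time. -/
theorem ae_eq_slice_of_ae (hT : 0 < T)
    (hu : ContinuousOn (Function.uncurry u) (Icc 0 T ×ˢ Icc 0 X)) {U : ℝ → L2 X}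
    (hU : ContinuousOn U (Icc 0 T))
    (h : ∀ᵐ t ∂volume.restrict (Ioo 0 T), U t =ᵐ[dom X] u t) :
    ∀ t ∈ Icc 0 T, U t =ᵐ[dom X] u t := by
  obtain ⟨Z, hZ, hZu⟩ := exists_continuousOn_L2 hu
  have : EqOn U Z (Icc 0 T) := by
    refine eqOn_Icc_of_ae_eq_Ioo hT hU hZ ?_
    filter_upwards [h, ae_mem_Icc] with t h1 h2
    exact Lp.ext (h1.trans (hZu t h2).symm)
  intro t ht
  rw [this ht]
  exact hZu t ht

theorem boundary_eq_zero (hX : 0 < X) (hT : 0 < T)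
    (hu : ContinuousOn (Function.uncurry u) (Icc 0 T ×ˢ Icc 0 X)) {du : ℝ → ℝ → ℝ}
    (h : ∀ᵐ t ∂volume.restrict (Ioo 0 T), MemH10w X (u t) (du t)) :
    ∀ t ∈ Icc 0 T, u t 0 = 0 ∧ u t X = 0 := by
  have h0 : (0 : ℝ) ∈ Icc 0 X := ⟨le_rfl, hX.le⟩
  have h1 : X ∈ Icc 0 X := ⟨hX.le, le_rfl⟩
  have hae : ∀ᵐ t ∂volume.restrict (Ioo 0 T), u t 0 = 0 ∧ u t X = 0 := by
    filter_upwards [h, ae_mem_Icc] with t ht ht'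
    obtain ⟨w, hw, hw0, hw1, he⟩ := ht.2.2.2
    have := eqOn_Icc_of_ae_eq_Ioo hX (continuousOn_slice hu ht') hw he
    exact ⟨(this h0).trans hw0, (this h1).trans hw1⟩
  have hc : ∀ x ∈ Icc 0 X, ContinuousOn (fun t => u t x) (Icc 0 T) := fun x hx =>
    hu.comp (f := fun t => (t, x)) (by fun_prop) fun _ ht => ⟨ht, hx⟩
  intro t ht
  exact ⟨eqOn_Icc_of_ae_eq_Ioo hT (hc 0 h0) continuousOn_const (hae.mono fun _ h => h.1) ht,
    eqOn_Icc_of_ae_eq_Ioo hT (hc X h1) continuousOn_const (hae.mono fun _ h => h.2) ht⟩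

theorem L2.integrable_mul_continuous {X : ℝ} (v : L2 X) {ψ : ℝ → ℝ} (h : Continuous ψ) :
    Integrable (fun x => v x * ψ x) (dom X) := by
  have := (Lp.memLp v).integrable_mul (memLp_dom_of_continuousOn (X := X) h.continuousOn)
  exact this

/-- For a fixed test function both sides become continuous in t once the factors x² and x are moved
onto the test function. The identity thus passes from almost every t to every t, and then back to
almost every x. -/
theorem flux_ae_eq (hT : 0 < T) (ha : ContinuousOn (coefA σ) (Icc 0 T))
    (hb : ContinuousOn (coefB r σ) (Icc 0 T)) {U UF : ℝ → H1 X}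
    (hU : ContinuousOn U (Icc 0 T)) (hUF : ContinuousOn UF (Icc 0 T))
    (h : ∀ᵐ t ∂volume.restrict (Ioo 0 T), ∀ᵐ x ∂dom X, H1.val X (UF t) x =
      -(coefA σ t * x ^ 2 * H1.der X (U t) x) - coefB r σ t * x * H1.val X (U t) x) :
    ∀ t ∈ Icc 0 T, ∀ᵐ x ∂dom X, H1.val X (UF t) x =
      -(coefA σ t * x ^ 2 * H1.der X (U t) x) - coefB r σ t * x * H1.val X (U t) x := by
  have hpair : ∀ (ψ : ℝ → ℝ) (hψ : Continuous ψ) (t : ℝ),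
      ∫ x in Ioo 0 X, (-(coefA σ t * x ^ 2 * H1.der X (U t) x)
        - coefB r σ t * x * H1.val X (U t) x) * ψ x =
      -(coefA σ t * pairing X (fun x => x ^ 2 * ψ x) (by fun_prop) (H1.der X (U t)))
        - coefB r σ t * pairing X (fun x => x * ψ x) (by fun_prop) (H1.val X (U t)) := by
    intro ψ hψ t
    rw [pairing_apply, pairing_apply, ← integral_const_mul, ← integral_const_mul, ← integral_neg,
      ← integral_sub]
    · congr 1; ext x; ring
    · exact ((L2.integrable_mul_continuous _ (by fun_prop)).const_mul _).neg
    · exact (L2.integrable_mul_continuous _ (by fun_prop)).const_mul _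
  have hall : ∀ φ (hφ : IsTest 0 X φ), EqOn (fun t => pairing X φ hφ.1.continuous (H1.val X (UF t)))
      (fun t => -(coefA σ t * pairing X (fun x => x ^ 2 * φ x)
          ((continuous_pow 2).mul hφ.1.continuous) (H1.der X (U t)))
        - coefB r σ t * pairing X (fun x => x * φ x)
          (continuous_id.mul hφ.1.continuous) (H1.val X (U t))) (Icc 0 T) := by
    intro φ hφ
    refine eqOn_Icc_of_ae_eq_Ioo hT (by fun_prop) (by fun_prop) ?_
    filter_upwards [h] with t ht
    rw [← hpair φ hφ.1.continuous t, pairing_eq_of_ae _ ht]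
  intro t ht
  have hInt : LocallyIntegrableOn (fun x => H1.val X (UF t) x -
      (-(coefA σ t * x ^ 2 * H1.der X (U t) x) - coefB r σ t * x * H1.val X (U t) x))
      (Ioo 0 X) := by
    refine IntegrableOn.locallyIntegrableOn ((L2.integrable _).sub (Integrable.sub ?_ ?_))
    · have := (L2.integrable_mul_continuous (H1.der X (U t))
        (ψ := fun x => -(coefA σ t * x ^ 2)) (by fun_prop))
      exact this.congr (Eventually.of_forall fun x => by simp only []; ring)
    · have := (L2.integrable_mul_continuous (H1.val X (U t))
        (ψ := fun x => (coefB r σ t * x)) (by fun_prop))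
      exact this.congr (Eventually.of_forall fun x => by simp only []; ring)
  have := ae_eq_zero_of_test hInt fun φ hφ => by
    have h1 := hall φ hφ ht
    simp only at h1
    rw [← hpair φ hφ.1.continuous t, pairing_apply] at h1
    simp only [smul_eq_mul, mul_sub]
    rw [integral_sub]
    · simpa only [mul_comm, mul_sub, sub_eq_zero, mul_neg] using h1
    · exact (L2.integrable_mul_continuous _ hφ.1.continuous).congr
        (Eventually.of_forall fun x => mul_comm _ _)
    · have := ((L2.integrable_mul_continuous (H1.der X (U t))
        (ψ := fun x => -(coefA σ t * x ^ 2) * φ x) (by have := hφ.1.continuous; fun_prop)).sub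
          (L2.integrable_mul_continuous (H1.val X (U t))
        (ψ := fun x => coefB r σ t * x * φ x) (by have := hφ.1.continuous; fun_prop)))
      exact this.congr (Eventually.of_forall fun x => by simp only [Pi.sub_apply]; ring)
  filter_upwards [this] with x hx
  exact sub_eq_zero.1 hx

/-- The bracket in the form is minus the flux, and the flux has a weak derivative, so one
integration by parts removes the derivative from the test function. -/
theorem formA_eq {t : ℝ} {p q : H1 X} {g v : ℝ → ℝ}
    (hp : H1.val X p =ᵐ[dom X] u t) (hg : g =ᵐ[dom X] H1.der X p)
    (hq : ∀ᵐ x ∂dom X, H1.val X q x =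
      -(coefA σ t * x ^ 2 * H1.der X p x) - coefB r σ t * x * H1.val X p x)
    (hv : IsTest 0 X v) :
    formA X T r σ t (u t) g v (deriv v) =
      pairing X v hv.1.continuous (H1.der X q + coefC T r σ t • H1.val X p) := by
  have h1 : ∫ x in Ioo 0 X, (coefA σ t * x ^ 2 * g x + coefB r σ t * x * u t x) * deriv v x =
      -∫ x in Ioo 0 X, H1.val X q x * deriv v x := by
    rw [← integral_neg]
    refine integral_congr_ae ?_
    filter_upwards [hp, hg, hq] with x h1 h2 h3
    rw [h3, h2, h1]; ring
  have h2 : ∫ x in Ioo 0 X, coefC T r σ t * u t x * v x =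
      coefC T r σ t * pairing X v hv.1.continuous (H1.val X p) := by
    rw [pairing_eq_of_ae _ hp, ← integral_const_mul]
    congr 1; ext x; ring
  rw [formA, h1, h2, (H1.hasWeakDeriv q).2.2 v hv, neg_neg, map_add, map_smul, smul_eq_mul,
    pairing_apply, pairing_apply]

/-- Three descriptions of ∂ₜu are reconciled: the one given by the equation (continuous in time with
values in L²), the derivative in H¹(0,T;H¹), and the first derivative in H²(0,T;L²). Uniqueness of
weak derivatives makes them equal almost everywhere. -/
theorem exists_regularCurves (hX : 0 < X) (hT : 0 < T) (hr : ContinuousOn r (Icc 0 T))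
    (hσ : ContinuousOn σ (Icc 0 T))
    (hfc : ContinuousOn (Function.uncurry f) (Icc 0 T ×ˢ Icc 0 X)) (hf : MemCH1 X T f)
    (huc : ContinuousOn (Function.uncurry u) (Icc 0 T ×ˢ Icc 0 X))
    (hsol : IsWeakSolution X T r σ f u₀ u) (h1 : MemH1H1 X T u) (h2 : MemH2L2 X T u)
    (hF : FluxRegular X T r σ u) :
    ∃ (U V Uf UF : ℝ → H1 X) (P W : ℝ → L2 X), RegularCurves X T r σ f u U V Uf UF P W := by
  have ha := continuousOn_coefA hσ
  have hb := continuousOn_coefB hr hσ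
  have hc := continuousOn_coefC (T := T) hr hσ
  obtain ⟨U₁, V, hUV, hU₁⟩ := h1
  obtain ⟨U, hU, hUae, hdiff⟩ := hUV.exists_continuousOn hT
  obtain ⟨Uf, hUf, hUfae⟩ := hf
  obtain ⟨dF, hdF, UF, hUF, hUFae⟩ := hF
  obtain ⟨⟨du, -, -, hdu, heq⟩, -⟩ := hsol
  have valU : ∀ t ∈ Icc 0 T, H1.val X (U t) =ᵐ[dom X] u t := by
    refine ae_eq_slice_of_ae hT huc (by fun_prop) ?_
    filter_upwards [hU₁, hUae] with t h1 h2
    rw [← h2]; exact h1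
  have valUf : ∀ t ∈ Icc 0 T, H1.val X (Uf t) =ᵐ[dom X] f t :=
    ae_eq_slice_of_ae hT hfc (by fun_prop) hUfae
  have hderiv : ∀ t ∈ Icc 0 T, ∀ g, HasWeakDeriv X (u t) g → g =ᵐ[dom X] H1.der X (U t) :=
    fun t ht g hg => hg.ae_unique ((H1.hasWeakDeriv (U t)).congr_left (valU t ht))
  have valUF := flux_ae_eq hT ha hb hU hUF (by
    filter_upwards [hUFae, hdF, ae_mem_Icc] with t k1 k2 k3
    filter_upwards [k1, hderiv t k3 _ k2, valU t k3] with x m1 m2 m3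
    rw [m3, ← m2]; exact m1)
  -- ∂ₜu is defined by the strong form of the equation, which provides a value at every time.
  let P : ℝ → L2 X := fun t =>
    H1.val X (Uf t) - H1.der X (UF t) - coefC T r σ t • H1.val X (U t)
  have hP : ContinuousOn P (Icc 0 T) := by fun_prop
  have hmem : ∀ {Z : ℝ → L2 X}, ContinuousOn Z (Icc 0 T) →
      MemLp Z 2 (volume.restrict (Ioo 0 T)) := by
    intro Z hZ
    obtain ⟨C, hC⟩ := isCompact_Icc.exists_bound_of_continuousOn hZ
    refine MemLp.of_bound (C := C) ?_ ?_
    · exact (hZ.mono Ioo_subset_Icc_self).aestronglyMeasurable measurableSet_Ioo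
    · filter_upwards [ae_mem_Icc] with t ht using hC t ht
  have hvalc : ContinuousOn (fun t => H1.val X (U t)) (Icc 0 T) := by fun_prop
  have hDP : HasTimeDeriv T (fun t => H1.val X (U t)) P := by
    refine ⟨hmem hvalc, hmem hP, fun ψ hψ => ?_⟩
    have hψc' : Continuous (deriv ψ) := hψ.1.continuous_deriv (by simp)
    have i1 := integrableOn_test_smul hψc' hψ.2.1.deriv (integrableOn_of_memLp_two (hmem hvalc))
    have i2 := integrableOn_test_smul hψ.1.continuous hψ.2.1 (integrableOn_of_memLp_two (hmem hP))
    rw [← sub_eq_zero, sub_neg_eq_add]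
    -- Smooth compactly supported v are admissible in the weak formulation and already determine an
    -- element of L².
    refine L2.eq_zero_of_pairing fun v hv => ?_
    set L := pairing X v hv.1.continuous
    have e := heq v (deriv v) (memH10w_of_test hX hv) ψ hψ
    have e1 : ∫ t in Ioo 0 T, deriv ψ t * ∫ x in Ioo 0 X, u t x * v x =
        L (∫ t in Ioo 0 T, deriv ψ t • H1.val X (U t)) := by
      rw [← L.integral_comp_comm i1]
      refine setIntegral_congr_fun measurableSet_Ioo fun t ht => ?_
      simp only [map_smul, smul_eq_mul, L]
      rw [pairing_eq_of_ae _ (valU t (Ioo_subset_Icc_self ht))]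
    have hG : ContinuousOn (fun t => H1.der X (UF t) + coefC T r σ t • H1.val X (U t))
      (Icc 0 T) := by fun_prop
    have hFc : ContinuousOn (fun t => H1.val X (Uf t)) (Icc 0 T) := by fun_prop
    have i3 := integrableOn_test_smul hψ.1.continuous hψ.2.1 (integrableOn_of_memLp_two (hmem hG))
    have i4 := integrableOn_test_smul hψ.1.continuous hψ.2.1 (integrableOn_of_memLp_two (hmem hFc))
    have e2 : ∫ t in Ioo 0 T, ψ t * formA X T r σ t (u t) (du t) v (deriv v) =
        L (∫ t in Ioo 0 T, ψ t • (H1.der X (UF t) + coefC T r σ t • H1.val X (U t))) := by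
      rw [← L.integral_comp_comm i3]
      refine integral_congr_ae ?_
      filter_upwards [hdu, ae_mem_Icc] with t k1 k2
      rw [formA_eq (valU t k2) (hderiv t k2 _ k1.2.2.1) (valUF t k2) hv, map_smul, smul_eq_mul]
    have e3 : ∫ t in Ioo 0 T, ψ t * ∫ x in Ioo 0 X, f t x * v x =
        L (∫ t in Ioo 0 T, ψ t • H1.val X (Uf t)) := by
      rw [← L.integral_comp_comm i4]
      refine setIntegral_congr_fun measurableSet_Ioo fun t ht => ?_
      simp only [map_smul, smul_eq_mul, L]
      rw [pairing_eq_of_ae _ (valUf t (Ioo_subset_Icc_self ht))]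
    have e4 : ∫ t in Ioo 0 T, ψ t • P t = (∫ t in Ioo 0 T, ψ t • H1.val X (Uf t)) -
        ∫ t in Ioo 0 T, ψ t • (H1.der X (UF t) + coefC T r σ t • H1.val X (U t)) := by
      rw [← integral_sub i4 i3]
      congr 1; ext1 t
      rw [← smul_sub, ← sub_sub]
    rw [e1, e2, e3] at e
    rw [map_add, e4, map_sub]
    linarith
  obtain ⟨U₂, V₂, W, hUV₂, hVW, hU₂⟩ := h2
  have hU₂U : U₂ =ᵐ[volume.restrict (Ioo 0 T)] fun t => H1.val X (U t) := by
    filter_upwards [hU₂, ae_mem_Icc] with t k1 k2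
    exact Lp.ext (k1.trans (valU t k2).symm)
  -- From here the curve `P` inherits the weak derivative `W`, and with it control of its
  -- increments.
  have hV₂P : V₂ =ᵐ[volume.restrict (Ioo 0 T)] P := (hUV₂.congr_left hU₂U).ae_unique hDP
  obtain ⟨P', hP', hP'ae, hdiffP⟩ := (hVW.congr_left hV₂P).exists_continuousOn hT
  have hPP' : EqOn P P' (Icc 0 T) := eqOn_Icc_of_ae_eq_Ioo hT hP hP' hP'ae
  have hUV' := hUV.congr_left hUae
  refine ⟨U, V, Uf, UF, P, W, hU, hUf, hUF, hP, valU, valUf, fun t ht => ?_, fun _ => rfl,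
    boundary_eq_zero hX hT huc hdu, hUV.2.1, hVW.2.1, hUV', hdiff, fun s hs t ht => ?_, ?_⟩
  · filter_upwards [valUF t ht, valU t ht] with x k1 k2
    rw [k1, k2]
  · rw [hPP' hs, hPP' ht, hdiffP s hs t ht]
  · exact (hUV'.map (H1.val X)).ae_unique hDP

end Extract

/-! ### Square-integrable functions on `Ω` -/

section SquareIntegrable

variable {X : ℝ} {g : ℝ → ℝ}

/-- Cauchy–Schwarz, read off from the nonnegativity of the variance of g on the interval. -/
theorem sq_integral_le {a b : ℝ} (hab : a ≤ b) (hg : IntervalIntegrable g volume a b)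
    (hg2 : IntervalIntegrable (fun x => g x ^ 2) volume a b) :
    (∫ x in a..b, g x) ^ 2 ≤ (b - a) * ∫ x in a..b, g x ^ 2 := by
  rcases hab.eq_or_lt with rfl | hlt
  · simp
  set m := (∫ x in a..b, g x) / (b - a) with hm
  have hpos : 0 < b - a := sub_pos.2 hlt
  have h0 : 0 ≤ ∫ x in a..b, (g x - m) ^ 2 :=
    intervalIntegral.integral_nonneg hab fun x _ => sq_nonneg _
  have h1 : ∫ x in a..b, (g x - m) ^ 2 =
      (∫ x in a..b, g x ^ 2) - 2 * m * (∫ x in a..b, g x) + (b - a) * m ^ 2 := by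
    have e : ∀ x, (g x - m) ^ 2 = g x ^ 2 - 2 * m * g x + m ^ 2 := fun x => by ring
    simp_rw [e]
    rw [intervalIntegral.integral_add (hg2.sub (hg.const_mul _)) intervalIntegrable_const,
      intervalIntegral.integral_sub hg2 (hg.const_mul _), intervalIntegral.integral_const_mul,
      intervalIntegral.integral_const, smul_eq_mul]
  have h2 : (∫ x in a..b, g x) = (b - a) * m := by rw [hm]; field_simp
  rw [h1, h2] at h0
  rw [h2]
  nlinarith

theorem MemLp.intervalIntegrable_dom (h : MemLp g 2 (dom X)) {a b : ℝ} (ha : a ∈ Icc 0 X)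
    (hb : b ∈ Icc 0 X) : IntervalIntegrable g volume a b :=
  intervalIntegrable_of_Ioo (h.integrable (by norm_num)) ha hb

theorem MemLp.intervalIntegrable_sq_dom (h : MemLp g 2 (dom X)) {a b : ℝ} (ha : a ∈ Icc 0 X)
    (hb : b ∈ Icc 0 X) : IntervalIntegrable (fun x => g x ^ 2) volume a b :=
  intervalIntegrable_of_Ioo h.integrable_sq ha hb

theorem MemLp.continuousOn_primitive_dom (h : MemLp g 2 (dom X)) :
    ContinuousOn (fun x => ∫ y in 0..x, g y) (Icc 0 X) :=
  continuousOn_primitive_of_Ioo (h.integrable (by norm_num))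

theorem integral_dom_eq (hX : 0 ≤ X) (g : ℝ → ℝ) :
    ∫ x in Ioo 0 X, g x = ∫ x in 0..X, g x := by
  rw [intervalIntegral.integral_of_le hX, integral_Ioc_eq_integral_Ioo]

theorem intervalIntegral_congr_dom {g g' : ℝ → ℝ} (h : g =ᵐ[dom X] g') {a b : ℝ}
    (ha : a ∈ Icc 0 X) (hb : b ∈ Icc 0 X) : ∫ x in a..b, g x = ∫ x in a..b, g' x := by
  have h' : g =ᵐ[volume.restrict (Icc 0 X)] g' := by
    rwa [← Measure.restrict_congr_set Ioo_ae_eq_Icc]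
  refine intervalIntegral.integral_congr_ae_restrict ?_
  exact ae_restrict_of_ae_restrict_of_subset
    (uIoc_subset_uIcc.trans (uIcc_subset_Icc ha hb)) h'

theorem L2.integral_sq (hX : 0 ≤ X) (v : L2 X) : ∫ x in 0..X, v x ^ 2 = ‖v‖ ^ 2 := by
  rw [← real_inner_self_eq_norm_sq, L2.inner_def, ← integral_dom_eq hX]
  refine integral_congr_ae (Eventually.of_forall fun x => ?_)
  simp [sq]

/-- `x · d(x)` has no nonzero limit at `0` if `d` is square-integrable. -/
theorem tendsto_eq_zero_of_memLp (hX : 0 < X) {d φ : ℝ → ℝ} (hd : MemLp d 2 (dom X)) {l : ℝ}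
    (hφ : Tendsto φ (𝓝[>] 0) (𝓝 l)) (h : ∀ᵐ x ∂dom X, x * d x = φ x) : l = 0 := by
  by_contra hl
  have hl' : 0 < |l| := abs_pos.2 hl
  have hev : ∀ᶠ x in 𝓝[>] (0 : ℝ), |l| / 2 < |φ x| :=
    hφ.abs.eventually (lt_mem_nhds (by linarith))
  obtain ⟨ε, hε, hε'⟩ := mem_nhdsGT_iff_exists_Ioo_subset.1 hev
  have hε0 : 0 < min ε X := lt_min hε hX
  have hsub : Ioo 0 (min ε X) ⊆ Ioo 0 X := Ioo_subset_Ioo_right (min_le_right _ _)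
  have hInt : IntegrableOn (fun x => d x ^ 2) (Ioo 0 (min ε X)) :=
    IntegrableOn.mono_set hd.integrable_sq hsub
  -- A nonzero limit would give |d(x)| ≥ |l|/(2x) near 0, making x⁻² integrable there.
  have : IntegrableOn (fun x : ℝ => x ^ (-2 : ℝ)) (Ioo 0 (min ε X)) := by
    refine Integrable.mono' (hInt.const_mul (4 / |l| ^ 2)) ?_ ?_
    · exact (ContinuousOn.aestronglyMeasurable (fun x hx =>
        (Real.continuousAt_rpow_const _ _ (Or.inl hx.1.ne')).continuousWithinAt)
        measurableSet_Ioo)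
    · filter_upwards [ae_restrict_of_ae_restrict_of_subset hsub h,
        ae_restrict_mem measurableSet_Ioo] with x h1 h2
      have hx : 0 < x := h2.1
      have h3 : |l| / 2 < |φ x| := hε' ⟨hx, h2.2.trans_le (min_le_left _ _)⟩
      have h4 : (|l| / 2) ^ 2 ≤ (x * d x) ^ 2 := by
        rw [h1, ← sq_abs (φ x)]
        exact pow_le_pow_left₀ (by positivity) h3.le 2
      rw [Real.norm_of_nonneg (by positivity), Real.rpow_neg hx.le,
        show (2 : ℝ) = ((2 : ℕ) : ℝ) by norm_num, Real.rpow_natCast, inv_eq_one_div,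
        div_le_iff₀ (by positivity)]
      have h5 : 4 / |l| ^ 2 * d x ^ 2 * x ^ 2 = (x * d x) ^ 2 / (|l| / 2) ^ 2 := by
        field_simp; ring
      rw [h5, le_div_iff₀ (by positivity), one_mul]
      exact h4
  rw [intervalIntegral.integrableOn_Ioo_rpow_iff hε0] at this
  norm_num at this

/-- This is the one-sided derivative of the primitive at 0; q is continuous only on [0, X], so a
two-sided derivative is not available. -/
theorem tendsto_mean_primitive (hX : 0 < X) {q : ℝ → ℝ} (hq : ContinuousOn q (Icc 0 X)) :
    Tendsto (fun x => (∫ y in 0..x, q y) / x) (𝓝[>] 0) (𝓝 (q 0)) := by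
  have hmem : Icc 0 X ∈ 𝓝[>] (0 : ℝ) := mem_of_superset (Ioo_mem_nhdsGT hX) Ioo_subset_Icc_self
  have h0 : (0 : ℝ) ∈ Icc 0 X := ⟨le_rfl, hX.le⟩
  have hd : HasDerivWithinAt (fun x => ∫ y in 0..x, q y) (q 0) (Ici 0) 0 := by
    refine intervalIntegral.integral_hasDerivWithinAt_right (by simp)
      (t := Ioi 0) ?_ ?_
    · exact ⟨Icc 0 X, hmem, hq.aestronglyMeasurable measurableSet_Icc⟩
    · exact ((hq 0 h0).mono_of_mem_nhdsWithin
        (mem_of_superset (Ico_mem_nhdsGE hX) Ico_subset_Icc_self)).mono Ioi_subset_Ici_self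
  have := (hasDerivWithinAt_iff_tendsto_slope' (by simp)).1 (hd.mono Ioi_subset_Ici_self)
  refine this.congr' (Eventually.of_forall fun x => ?_)
  simp [slope_def_field]

/-- Integration by parts against y - x, which vanishes at the upper end. -/
theorem integral_primitive_eq (hg : MemLp g 2 (dom X)) {x : ℝ} (hx : x ∈ Icc 0 X) :
    ∫ y in 0..x, (∫ z in 0..y, g z) = x * (∫ y in 0..x, g y) - ∫ y in 0..x, y * g y := by
  have hi : IntegrableOn g (Ioo 0 x) :=
    IntegrableOn.mono_set (hg.integrable (by norm_num)) (Ioo_subset_Ioo_right hx.2)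
  have := integral_deriv_smul_primitive hi (ψ := fun y => y - x)
    (contDiff_id.sub contDiff_const) (sub_self x)
  have hd : deriv (fun y : ℝ => y - x) = fun _ => 1 := by ext y; simp
  rw [hd] at this
  simp only [smul_eq_mul, one_mul, sub_mul] at this
  rw [integral_dom_eq hx.1, integral_dom_eq hx.1] at this
  have h0 : (0 : ℝ) ∈ Icc 0 X := ⟨le_rfl, hx.1.trans hx.2⟩
  have hi' := MemLp.intervalIntegrable_dom hg h0 hx
  rw [intervalIntegral.integral_sub (hi'.continuousOn_mul (g := fun y => y) continuousOn_id)
    (hi'.const_mul _),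
    intervalIntegral.integral_const_mul] at this
  rw [this]; ring

end SquareIntegrable

/-! ### The solution at a fixed time -/

/-- The derivative of `x² du`, expressed by the differential equation; `p` stands for `∂ₜu`. -/
def fluxDeriv (a b c₀ : ℝ) (u du f p : ℝ → ℝ) (x : ℝ) : ℝ :=
  (p x - f x + (c₀ - b) * u x - b * x * du x) / a

/-- The regularity of `u` and `f` at a fixed time, together with the differential equation. -/
structure Snapshot (X a b c₀ : ℝ) (u du f df p : ℝ → ℝ) : Prop where
  mem_du : MemLp du 2 (dom X)
  mem_df : MemLp df 2 (dom X)
  mem_p : MemLp p 2 (dom X)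
  u_eq : ∀ x ∈ Icc 0 X, u x = ∫ y in 0..x, du y
  u_last : u X = 0
  f_eq : ∀ x ∈ Icc 0 X, f x = ∫ y in 0..x, df y
  flux_eq : ∀ᵐ x ∂dom X, x ^ 2 * du x = ∫ y in 0..x, fluxDeriv a b c₀ u du f p y

section Trace

variable {X : ℝ}

theorem H1.eq_primitive_of_continuousOn (hX : 0 < X) {p : H1 X} {v : ℝ → ℝ}
    (hv : ContinuousOn v (Icc 0 X)) (h : H1.val X p =ᵐ[dom X] v) :
    ∀ x ∈ Icc 0 X, v x = v 0 + ∫ y in 0..x, H1.der X p y := by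
  obtain ⟨c, hc⟩ := H1.exists_primitive hX p
  have he := eqOn_Icc_of_ae_eq_Ioo hX hv
    (continuousOn_const (c := c).add
      (MemLp.continuousOn_primitive_dom (Lp.memLp (H1.der X p)))) (h.symm.trans hc)
  have h0 : v 0 = c := by simpa using he ⟨le_rfl, hX.le⟩
  intro x hx
  rw [h0]
  exact he hx

/-- `X` times the boundary value at `0`. -/
def H1.trace (X : ℝ) : H1 X →L[ℝ] ℝ :=
  (pairing X (fun _ => 1) continuous_const).comp (H1.val X) +
    (pairing X (fun x => x - X) (by fun_prop)).comp (H1.der X)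

/-- The two integrals of the derivative cancel by `integral_primitive_eq`. Writing the boundary
value as a bounded functional lets it commute with the weak time derivative, which
`RegularCurves.source_zero` needs. -/
theorem H1.trace_eq (hX : 0 < X) {p : H1 X} {c : ℝ}
    (h : ∀ᵐ x ∂dom X, H1.val X p x = c + ∫ y in 0..x, H1.der X p y) : H1.trace X p = X * c := by
  have hm : MemLp (H1.der X p) 2 (dom X) := Lp.memLp _
  have h0 : (0 : ℝ) ∈ Icc 0 X := ⟨le_rfl, hX.le⟩
  have h1 : X ∈ Icc 0 X := ⟨hX.le, le_rfl⟩
  have hi := MemLp.intervalIntegrable_dom hm h0 h1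
  have hci : IntervalIntegrable (fun x => ∫ y in 0..x, H1.der X p y) volume 0 X := by
    refine ContinuousOn.intervalIntegrable ?_
    rw [uIcc_of_le hX.le]
    exact MemLp.continuousOn_primitive_dom hm
  simp only [H1.trace, _root_.add_apply, ContinuousLinearMap.comp_apply]
  rw [pairing_eq_of_ae _ h, pairing_apply, integral_dom_eq hX.le, integral_dom_eq hX.le]
  simp only [mul_one, mul_sub]
  rw [intervalIntegral.integral_add intervalIntegrable_const hci,
    intervalIntegral.integral_sub (hi.mul_continuousOn (g := fun x => x) continuousOn_id)
      (hi.mul_const _), integral_primitive_eq hm h1, intervalIntegral.integral_mul_const]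
  simp only [intervalIntegral.integral_const, smul_eq_mul, mul_comm (H1.der X p _)]
  ring

end Trace

/-! ### Boundary behaviour at 0, the equation in integrated form, and increments in time -/

namespace RegularCurves

variable {X T : ℝ} {r σ : ℝ → ℝ} {f u : ℝ → ℝ → ℝ} {U V Uf UF : ℝ → H1 X} {P W : ℝ → L2 X}

theorem u_eq (h : RegularCurves X T r σ f u U V Uf UF P W) (hX : 0 < X)
    (hu : ContinuousOn (Function.uncurry u) (Icc 0 T ×ˢ Icc 0 X)) {t : ℝ} (ht : t ∈ Icc 0 T)
    {x : ℝ} (hx : x ∈ Icc 0 X) : u t x = ∫ y in 0..x, H1.der X (U t) y := by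
  rw [H1.eq_primitive_of_continuousOn hX (continuousOn_slice hu ht) (h.valU t ht) x hx,
    (h.bdry t ht).1, zero_add]

theorem der_flux (h : RegularCurves X T r σ f u U V Uf UF P W) {t : ℝ} (ht : t ∈ Icc 0 T) :
    H1.der X (UF t) =ᵐ[dom X] fun x => f t x - P t x - coefC T r σ t * u t x := by
  have e := h.eqn t
  have e' : H1.der X (UF t) = H1.val X (Uf t) - P t - coefC T r σ t • H1.val X (U t) := by
    rw [e]; abel
  rw [e']
  filter_upwards [Lp.coeFn_sub (H1.val X (Uf t) - P t) (coefC T r σ t • H1.val X (U t)),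
    Lp.coeFn_sub (H1.val X (Uf t)) (P t), Lp.coeFn_smul (coefC T r σ t) (H1.val X (U t)),
    h.valU t ht, h.valUf t ht] with x h1 h2 h3 h4 h5
  rw [h1, Pi.sub_apply, h2, Pi.sub_apply, h3, Pi.smul_apply, h4, h5, smul_eq_mul]

/-- The flux vanishes at `0`. -/
theorem sq_mul_der (h : RegularCurves X T r σ f u U V Uf UF P W) (hX : 0 < X)
    (hu : ContinuousOn (Function.uncurry u) (Icc 0 T ×ˢ Icc 0 X)) {t : ℝ} (ht : t ∈ Icc 0 T)
    (ha : 0 < coefA σ t) :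
    ∀ᵐ x ∂dom X, coefA σ t * x ^ 2 * H1.der X (U t) x =
      -(∫ y in 0..x, H1.der X (UF t) y) - coefB r σ t * x * u t x := by
  obtain ⟨c, hc⟩ := H1.exists_primitive hX (UF t)
  have key : ∀ᵐ x ∂dom X, coefA σ t * x ^ 2 * H1.der X (U t) x =
      -(c + ∫ y in 0..x, H1.der X (UF t) y) - coefB r σ t * x * u t x := by
    filter_upwards [hc, h.valUF t ht] with x h1 h2
    rw [← h1, h2]; ring
  have hcont : ContinuousOn (fun x => (-(c + ∫ y in 0..x, H1.der X (UF t) y)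
      - coefB r σ t * x * u t x) / coefA σ t) (Icc 0 X) := by
    have := continuousOn_slice hu ht
    have := MemLp.continuousOn_primitive_dom (Lp.memLp (H1.der X (UF t)))
    fun_prop
  have hmem : Icc 0 X ∈ 𝓝[>] (0 : ℝ) := mem_of_superset (Ioo_mem_nhdsGT hX) Ioo_subset_Icc_self
  have hlim := (hcont 0 ⟨le_rfl, hX.le⟩).mono_of_mem_nhdsWithin hmem
  have hd : MemLp (fun x => x * H1.der X (U t) x) 2 (dom X) := by
    refine (Lp.memLp (H1.der X (U t))).of_le_mul (c := X) ?_ ?_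
    · exact (continuous_id.aestronglyMeasurable).mul (Lp.aestronglyMeasurable _)
    · filter_upwards [ae_restrict_mem measurableSet_Ioo] with x hx
      rw [norm_mul, Real.norm_of_nonneg hx.1.le]
      exact mul_le_mul_of_nonneg_right hx.2.le (norm_nonneg _)
  -- By continuity x · (x u') tends to -c / a at 0. As x u' is square integrable, this limit, and so
  -- the boundary value c of the flux, must vanish.
  have h0 := tendsto_eq_zero_of_memLp hX hd hlim (by
    filter_upwards [key] with x hx
    rw [eq_div_iff ha.ne', ← hx]; ring)
  have hc0 : c = 0 := by
    simpa [ha.ne'] using h0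
  filter_upwards [key] with x hx
  rw [hx, hc0, zero_add]

/-- Since u(t, 0) = 0 for all t, ∂ₜu also vanishes at 0. Dividing the integrated equation by x shows
that x u' tends to -f(t, 0)/a(t) at 0, and square integrability of u' excludes a nonzero limit.
Without this property Hardy's inequality could not be applied to f. -/
theorem source_zero (h : RegularCurves X T r σ f u U V Uf UF P W) (hX : 0 < X) (hT : 0 < T)
    (hu : ContinuousOn (Function.uncurry u) (Icc 0 T ×ˢ Icc 0 X))
    (hf : ContinuousOn (Function.uncurry f) (Icc 0 T ×ˢ Icc 0 X))
    (ha : ∀ t ∈ Icc 0 T, 0 < coefA σ t) : ∀ t ∈ Icc 0 T, f t 0 = 0 := by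
  have h0 : (0 : ℝ) ∈ Icc 0 X := ⟨le_rfl, hX.le⟩
  have htr : ∀ t ∈ Icc 0 T, H1.trace X (U t) = 0 := by
    intro t ht
    rw [H1.trace_eq hX (c := 0), mul_zero]
    filter_upwards [h.valU t ht, ae_restrict_mem measurableSet_Ioo] with x h1 h2
    rw [h1, zero_add, h.u_eq hX hu ht (Ioo_subset_Icc_self h2)]
  have htrV : ∀ᵐ t ∂volume.restrict (Ioo 0 T), H1.trace X (V t) = 0 := by
    -- The trace of `U` is identically zero, so the trace of `V` is a weak time derivative of the
    -- zero function.
    refine (h.derivU.map (H1.trace X)).ae_unique (V' := fun _ => (0 : ℝ)) ?_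
    have hz : HasTimeDeriv T (fun _ => (0 : ℝ)) (fun _ => (0 : ℝ)) :=
      ⟨MemLp.zero', MemLp.zero', fun ψ _ => by simp⟩
    refine hz.congr_left ?_
    filter_upwards [ae_mem_Icc] with t ht using (htr t ht).symm
  have hae : ∀ᵐ t ∂volume.restrict (Ioo 0 T), f t 0 = 0 := by
    filter_upwards [htrV, h.valV, ae_mem_Icc] with t h1 h2 ht
    obtain ⟨c, hc⟩ := H1.exists_primitive hX (V t)
    have hc0 : c = 0 := by
      rw [H1.trace_eq hX hc] at h1
      exact (mul_eq_zero.1 h1).resolve_left hX.ne'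
    have hucont := continuousOn_slice hu ht
    have hfcont := continuousOn_slice hf ht
    let q : ℝ → ℝ := fun x =>
      f t x - (∫ y in 0..x, H1.der X (V t) y) - coefC T r σ t * u t x
    have hq : ContinuousOn q (Icc 0 X) := by
      have := MemLp.continuousOn_primitive_dom (Lp.memLp (H1.der X (V t)))
      fun_prop
    have hqe : H1.der X (UF t) =ᵐ[dom X] q := by
      filter_upwards [h.der_flux ht, hc] with x k1 k2
      rw [k1, ← h2, k2, hc0, zero_add]
    have hmem : Icc 0 X ∈ 𝓝[>] (0 : ℝ) :=
      mem_of_superset (Ioo_mem_nhdsGT hX) Ioo_subset_Icc_self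
    have hul : Tendsto (u t) (𝓝[>] 0) (𝓝 (u t 0)) :=
      (hucont 0 h0).mono_of_mem_nhdsWithin hmem
    -- The limit is (-q(0) - b u(t, 0)) / a, and q(0) = f(t, 0) because u and ∂ₜu vanish at 0.
    have hlim := (((tendsto_mean_primitive hX hq).neg).sub
      (hul.const_mul (coefB r σ t))).div_const (coefA σ t)
    have := tendsto_eq_zero_of_memLp hX (Lp.memLp (H1.der X (U t))) hlim (by
      filter_upwards [h.sq_mul_der hX hu ht (ha t ht),
        ae_restrict_mem measurableSet_Ioo] with x k1 k2
      rw [intervalIntegral_congr_dom hqe h0 (Ioo_subset_Icc_self k2)] at k1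
      have hx : x ≠ 0 := k2.1.ne'
      have ha' := (ha t ht).ne'
      have k3 : ∫ y in 0..x, q y = -(coefA σ t * x ^ 2 * H1.der X (U t) x)
        - coefB r σ t * x * u t x := by linarith
      rw [k3]
      field_simp
      ring)
    have hu0 := (h.bdry t ht).1
    simpa [q, hu0, (ha t ht).ne'] using this
  have hc : ContinuousOn (fun t => f t 0) (Icc 0 T) :=
    hf.comp (f := fun t => (t, (0 : ℝ))) (by fun_prop) fun _ ht => ⟨ht, h0⟩
  exact fun t ht => eqOn_Icc_of_ae_eq_Ioo hT hc continuousOn_const hae ht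

theorem snapshot (h : RegularCurves X T r σ f u U V Uf UF P W) (hX : 0 < X) (hT : 0 < T)
    (hu : ContinuousOn (Function.uncurry u) (Icc 0 T ×ˢ Icc 0 X))
    (hf : ContinuousOn (Function.uncurry f) (Icc 0 T ×ˢ Icc 0 X))
    (ha : ∀ t ∈ Icc 0 T, 0 < coefA σ t) {t : ℝ} (ht : t ∈ Icc 0 T) :
    Snapshot X (coefA σ t) (coefB r σ t) (coefC T r σ t) (u t) (H1.der X (U t)) (f t)
      (H1.der X (Uf t)) (P t) := by
  have h0 : (0 : ℝ) ∈ Icc 0 X := ⟨le_rfl, hX.le⟩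
  refine ⟨Lp.memLp _, Lp.memLp _, Lp.memLp _, fun x hx => h.u_eq hX hu ht hx,
    (h.bdry t ht).2, fun x hx => ?_, ?_⟩
  · rw [H1.eq_primitive_of_continuousOn hX (continuousOn_slice hf ht) (h.valUf t ht) x hx,
      h.source_zero hX hT hu hf ha t ht, zero_add]
  · have hmd : MemLp (H1.der X (U t)) 2 (dom X) := Lp.memLp _
    filter_upwards [h.sq_mul_der hX hu ht (ha t ht), ae_restrict_mem measurableSet_Ioo]
      with x k1 k2
    have hx := Ioo_subset_Icc_self k2
    have e1 : ∫ y in 0..x, fluxDeriv (coefA σ t) (coefB r σ t) (coefC T r σ t) (u t)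
        (H1.der X (U t)) (f t) (P t) y = (∫ y in 0..x, (-(H1.der X (UF t) y)
          - coefB r σ t * (u t y + y * H1.der X (U t) y))) / coefA σ t := by
      rw [← intervalIntegral.integral_div]
      refine intervalIntegral_congr_dom ?_ h0 hx
      filter_upwards [h.der_flux ht] with y hy
      rw [fluxDeriv, hy]; ring
    have hsub : uIcc 0 x ⊆ Icc 0 X := uIcc_subset_Icc h0 hx
    have iu : IntervalIntegrable (u t) volume 0 x :=
      ((continuousOn_slice hu ht).mono hsub).intervalIntegrable
    have id' : IntervalIntegrable (fun y => y * H1.der X (U t) y) volume 0 x :=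
      (MemLp.intervalIntegrable_dom hmd h0 hx).continuousOn_mul continuousOn_id
    have iF : IntervalIntegrable (H1.der X (UF t)) volume 0 x :=
      MemLp.intervalIntegrable_dom (Lp.memLp _) h0 hx
    have e2 : ∫ y in 0..x, u t y = ∫ y in 0..x, (∫ z in 0..y, H1.der X (U t) z) :=
      intervalIntegral.integral_congr fun y hy => h.u_eq hX hu ht (hsub hy)
    -- The product rule for x u, in integrated form; it moves the convective part of the flux under
    -- the integral.
    have e3 : ∫ y in 0..x, (u t y + y * H1.der X (U t) y) = x * u t x := by
      rw [intervalIntegral.integral_add iu id', e2, integral_primitive_eq hmd hx,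
        h.u_eq hX hu ht hx]
      ring
    rw [e1, intervalIntegral.integral_sub (f := fun y => -(H1.der X (UF t) y)) iF.neg
      ((iu.add id').const_mul _),
      intervalIntegral.integral_neg, intervalIntegral.integral_const_mul, e3,
      eq_div_iff (ha t ht).ne']
    linarith

theorem integral_sq_der_sub_le (h : RegularCurves X T r σ f u U V Uf UF P W) (hX : 0 < X)
    {s e : ℝ} (hs : s ∈ Icc 0 T) (he : e ∈ Icc 0 T) (hse : s ≤ e) :
    ∫ x in 0..X, (H1.der X (U e) x - H1.der X (U s) x) ^ 2 ≤
      (e - s) * ∫ τ in s..e, ‖V τ‖ ^ 2 := by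
  have h0 : (0 : ℝ) ∈ Icc 0 X := ⟨le_rfl, hX.le⟩
  have h1 : X ∈ Icc 0 X := ⟨hX.le, le_rfl⟩
  have hV := h.memV.norm
  have e1 : ∫ x in 0..X, (H1.der X (U e) x - H1.der X (U s) x) ^ 2 =
      ‖H1.der X (U e - U s)‖ ^ 2 := by
    rw [← L2.integral_sq hX.le, map_sub]
    refine intervalIntegral_congr_dom ?_ h0 h1
    filter_upwards [Lp.coeFn_sub (H1.der X (U e)) (H1.der X (U s))] with x hx
    rw [hx, Pi.sub_apply]
  have h2 : ‖U e - U s‖ ≤ ∫ τ in s..e, ‖V τ‖ := by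
    rw [h.diffU s hs e he]
    exact intervalIntegral.norm_integral_le_integral_norm hse
  rw [e1]
  refine (pow_le_pow_left₀ (norm_nonneg _) ((H1.norm_der_le _).trans h2) 2).trans ?_
  exact sq_integral_le hse (MemLp.intervalIntegrable_dom hV hs he)
    (MemLp.intervalIntegrable_sq_dom hV hs he)

theorem integral_sq_sub_quotient_le (h : RegularCurves X T r σ f u U V Uf UF P W) (hX : 0 < X)
    {s e τ : ℝ} (hs : s ∈ Icc 0 T) (he : e ∈ Icc 0 T) (hse : s < e) (hτ : τ ∈ Icc s e) :
    ∫ x in 0..X, (P τ x - (u e x - u s x) / (e - s)) ^ 2 ≤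
      (e - s) * ∫ τ in s..e, ‖W τ‖ ^ 2 := by
  have h0 : (0 : ℝ) ∈ Icc 0 X := ⟨le_rfl, hX.le⟩
  have h1 : X ∈ Icc 0 X := ⟨hX.le, le_rfl⟩
  have hpos : 0 < e - s := sub_pos.2 hse
  have hτT : τ ∈ Icc 0 T := ⟨hs.1.trans hτ.1, hτ.2.trans he.2⟩
  have hsub : Icc s e ⊆ Icc 0 T := Icc_subset_Icc hs.1 he.2
  have hW := h.memW.norm
  have hWi : ∀ {a b}, a ∈ Icc 0 T → b ∈ Icc 0 T → IntervalIntegrable (fun t => ‖W t‖) volume a b :=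
    fun ha hb => MemLp.intervalIntegrable_dom hW ha hb
  set I := ∫ t in s..e, ‖W t‖ with hI
  have hPd : ∀ t ∈ Icc s e, ‖P τ - P t‖ ≤ I := by
    intro t ht
    rw [h.diffP t (hsub ht) τ hτT]
    refine (intervalIntegral.norm_integral_le_abs_integral_norm).trans ?_
    rw [hI, ← abs_of_nonneg (intervalIntegral.integral_nonneg hse.le fun t _ => norm_nonneg (W t))]
    refine intervalIntegral.abs_integral_mono_interval ?_
      (Eventually.of_forall fun t => norm_nonneg (W t)) (hWi hs he)
    rw [uIoc_of_le hse.le]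
    exact Ioc_subset_Ioc (le_min ht.1 hτ.1) (max_le ht.2 hτ.2)
  have hval : H1.val X (U e) - H1.val X (U s) = ∫ t in s..e, P t := by
    have hVi : IntervalIntegrable V volume s e :=
      intervalIntegrable_of_Ioo (integrableOn_of_memLp_two h.memV) hs he
    rw [← map_sub, h.diffU s hs e he, ← ContinuousLinearMap.intervalIntegral_comp_comm _ hVi]
    refine intervalIntegral.integral_congr_ae_restrict ?_
    have h' : ∀ᵐ t ∂volume.restrict (Icc 0 T), H1.val X (V t) = P t := by
      rw [← Measure.restrict_congr_set Ioo_ae_eq_Icc]; exact h.valV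
    exact ae_restrict_of_ae_restrict_of_subset (uIoc_subset_uIcc.trans (uIcc_subset_Icc hs he)) h'
  have hPi : IntervalIntegrable P volume s e :=
    (h.contP.mono (uIcc_subset_Icc hs he)).intervalIntegrable
  -- The difference quotient of u is the time average of `P`, so only increments of `P` remain, and
  -- these are integrals of `W`.
  have hmean : P τ - (e - s)⁻¹ • (H1.val X (U e) - H1.val X (U s)) =
      (e - s)⁻¹ • ∫ t in s..e, (P τ - P t) := by
    rw [hval, intervalIntegral.integral_sub intervalIntegrable_const hPi,
      intervalIntegral.integral_const, smul_sub, smul_smul, inv_mul_cancel₀ hpos.ne', one_smul]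
  have hb : ‖P τ - (e - s)⁻¹ • (H1.val X (U e) - H1.val X (U s))‖ ≤ I := by
    rw [hmean, norm_smul, norm_inv, Real.norm_of_nonneg hpos.le]
    have := intervalIntegral.norm_integral_le_of_norm_le_const (a := s) (b := e) (C := I)
      (f := fun t => P τ - P t) fun t ht => hPd t (by
        rw [uIoc_of_le hse.le] at ht; exact Ioc_subset_Icc_self ht)
    rw [abs_of_pos hpos] at this
    rw [inv_mul_le_iff₀ hpos]
    linarith
  have e1 : ∫ x in 0..X, (P τ x - (u e x - u s x) / (e - s)) ^ 2 =
      ‖P τ - (e - s)⁻¹ • (H1.val X (U e) - H1.val X (U s))‖ ^ 2 := by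
    rw [← L2.integral_sq hX.le]
    refine intervalIntegral_congr_dom ?_ h0 h1
    filter_upwards [Lp.coeFn_sub (P τ) ((e - s)⁻¹ • (H1.val X (U e) - H1.val X (U s))),
      Lp.coeFn_smul (e - s)⁻¹ (H1.val X (U e) - H1.val X (U s)),
      Lp.coeFn_sub (H1.val X (U e)) (H1.val X (U s)), h.valU e he, h.valU s hs]
      with x k1 k2 k3 k4 k5
    rw [k1, Pi.sub_apply, k2, Pi.smul_apply, k3, Pi.sub_apply, k4, k5, smul_eq_mul,
      div_eq_inv_mul]
  rw [e1]
  refine (pow_le_pow_left₀ (norm_nonneg _) hb 2).trans ?_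
  exact sq_integral_le hse.le (hWi hs he) (MemLp.intervalIntegrable_sq_dom hW hs he)

end RegularCurves

/-- Everything the error analysis uses about the exact solution. -/
structure RegularData (X T : ℝ) (r σ : ℝ → ℝ) (f u du df p : ℝ → ℝ → ℝ) (k₁ k₂ : ℝ → ℝ)
    (K : ℝ) : Prop where
  snap : ∀ t ∈ Icc 0 T, Snapshot X (coefA σ t) (coefB r σ t) (coefC T r σ t)
    (u t) (du t) (f t) (df t) (p t)
  du_le : ∀ t ∈ Icc 0 T, ∫ x in 0..X, du t x ^ 2 ≤ K
  df_le : ∀ t ∈ Icc 0 T, ∫ x in 0..X, df t x ^ 2 ≤ K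
  k₁_nonneg : ∀ t, 0 ≤ k₁ t
  k₂_nonneg : ∀ t, 0 ≤ k₂ t
  k₁_int : IntegrableOn k₁ (Ioo 0 T)
  k₂_int : IntegrableOn k₂ (Ioo 0 T)
  du_diff : ∀ s ∈ Icc 0 T, ∀ e ∈ Icc 0 T, s ≤ e →
    ∫ x in 0..X, (du e x - du s x) ^ 2 ≤ (e - s) * ∫ t in s..e, k₁ t
  p_diff : ∀ s ∈ Icc 0 T, ∀ e ∈ Icc 0 T, s < e → ∀ τ ∈ Icc s e,
    ∫ x in 0..X, (p τ x - (u e x - u s x) / (e - s)) ^ 2 ≤ (e - s) * ∫ t in s..e, k₂ t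

theorem exists_regularData {X T : ℝ} {r σ : ℝ → ℝ} {f u : ℝ → ℝ → ℝ} {u₀ : ℝ → ℝ}
    (hX : 0 < X) (hT : 0 < T) (hr : ContinuousOn r (Icc 0 T)) (hσ : ContinuousOn σ (Icc 0 T))
    (ha : ∀ t ∈ Icc 0 T, 0 < coefA σ t)
    (hfc : ContinuousOn (Function.uncurry f) (Icc 0 T ×ˢ Icc 0 X)) (hf : MemCH1 X T f)
    (huc : ContinuousOn (Function.uncurry u) (Icc 0 T ×ˢ Icc 0 X))
    (hsol : IsWeakSolution X T r σ f u₀ u) (h1 : MemH1H1 X T u) (h2 : MemH2L2 X T u)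
    (hF : FluxRegular X T r σ u) :
    ∃ du df p k₁ k₂ K, RegularData X T r σ f u du df p k₁ k₂ K := by
  obtain ⟨U, V, Uf, UF, P, W, h⟩ := exists_regularCurves hX hT hr hσ hfc hf huc hsol h1 h2 hF
  obtain ⟨C₁, hC₁⟩ := isCompact_Icc.exists_bound_of_continuousOn h.contU
  obtain ⟨C₂, hC₂⟩ := isCompact_Icc.exists_bound_of_continuousOn h.contUf
  have hle : ∀ (p : H1 X) (C : ℝ), ‖p‖ ≤ C → ∫ x in 0..X, H1.der X p x ^ 2 ≤ C ^ 2 := by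
    intro p C hC
    rw [L2.integral_sq hX.le]
    exact pow_le_pow_left₀ (norm_nonneg _) ((H1.norm_der_le p).trans hC) 2
  refine ⟨fun t => H1.der X (U t), fun t => H1.der X (Uf t), fun t => P t, fun t => ‖V t‖ ^ 2,
    fun t => ‖W t‖ ^ 2, max (C₁ ^ 2) (C₂ ^ 2), fun t ht => h.snapshot hX hT huc hfc ha ht,
    fun t ht => (hle _ _ (hC₁ t ht)).trans (le_max_left _ _),
    fun t ht => (hle _ _ (hC₂ t ht)).trans (le_max_right _ _), fun t => sq_nonneg _,
    fun t => sq_nonneg _, h.memV.norm.integrable_sq, h.memW.norm.integrable_sq,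
    fun s hs e he hse => h.integral_sq_der_sub_le hX hs he hse,
    fun s hs e he hse τ hτ => h.integral_sq_sub_quotient_le hX hs he hse hτ⟩

/-! ### Mesh geometry -/

namespace SpaceMesh

variable {X : ℝ} (G : SpaceMesh X)

theorem x_mono {i j : ℕ} (hij : i ≤ j) (hj : j ≤ G.N + 1) : G.x i ≤ G.x j := by
  induction j, hij using Nat.le_induction with
  | base => exact le_rfl
  | succ k hk ih => exact (ih (by omega)).trans (G.x_lt k (by omega)).le

theorem x_mem {i : ℕ} (hi : i ≤ G.N + 1) : G.x i ∈ Icc 0 X :=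
  ⟨G.x_zero ▸ G.x_mono (Nat.zero_le i) hi, (G.x_mono hi le_rfl).trans_eq G.x_last⟩

theorem X_pos (G : SpaceMesh X) : 0 < X := by
  have h1 := G.x_lt 0 (Nat.zero_le _)
  have h2 := G.x_mono (i := 1) (j := G.N + 1) (by omega) le_rfl
  rw [G.x_zero] at h1
  rw [G.x_last] at h2
  linarith

theorem face_zero : G.face 0 = 0 := by simp [face]

theorem face_last : G.face (G.N + 2) = X := by simp [face]

theorem face_succ {i : ℕ} (hi : i ≤ G.N) : G.face (i + 1) = (G.x i + G.x (i + 1)) / 2 := by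
  have : i + 1 ≠ G.N + 2 := by omega
  simp [face]
  omega

theorem sub_le_h {i : ℕ} (hi : i ≤ G.N) : G.x (i + 1) - G.x i ≤ G.h :=
  Finset.le_sup' (fun i => G.x (i + 1) - G.x i) (Finset.mem_range.2 (by omega))

theorem h_pos : 0 < G.h := by
  have h1 := G.x_lt 0 (Nat.zero_le _)
  have h2 := G.sub_le_h (Nat.zero_le G.N)
  linarith

theorem face_le_x {i : ℕ} (hi : i ≤ G.N + 1) :
    G.face i ≤ G.x i ∧ G.x i - G.face i ≤ G.h / 2 := by
  have := G.h_pos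
  rcases i with _ | i
  · rw [G.face_zero, G.x_zero]; constructor <;> linarith
  · rw [G.face_succ (by omega)]
    have h1 := G.x_lt i (by omega)
    have h2 := G.sub_le_h (i := i) (by omega)
    constructor <;> linarith

theorem x_le_face {i : ℕ} (hi : i ≤ G.N + 1) :
    G.x i ≤ G.face (i + 1) ∧ G.face (i + 1) - G.x i ≤ G.h / 2 := by
  have := G.h_pos
  rcases hi.eq_or_lt with rfl | hlt
  · rw [G.face_last, G.x_last]; constructor <;> linarith
  · rw [G.face_succ (by omega)]
    have h1 := G.x_lt i (by omega)
    have h2 := G.sub_le_h (i := i) (by omega)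
    constructor <;> linarith

theorem len_pos {i : ℕ} (hi : i ≤ G.N + 1) : 0 < G.len i := by
  have h1 := G.face_le_x hi
  have h2 := G.x_le_face hi
  rw [len]
  rcases i with _ | i
  · rw [G.face_zero, G.face_succ (by omega), G.x_zero]
    have := G.x_lt 0 (by omega)
    rw [G.x_zero] at this
    linarith
  · rw [G.face_succ (i := i) (by omega)] at h1 ⊢
    have := G.x_lt i (by omega)
    linarith

theorem len_le_h {i : ℕ} (hi : i ≤ G.N + 1) : G.len i ≤ G.h := by
  have h1 := G.face_le_x hi
  have h2 := G.x_le_face hi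
  rw [len]; linarith

theorem face_add_len (i : ℕ) : G.face (i + 1) = G.face i + G.len i := by rw [len]; ring

theorem face_mono {i j : ℕ} (hij : i ≤ j) (hj : j ≤ G.N + 2) : G.face i ≤ G.face j := by
  induction j, hij using Nat.le_induction with
  | base => exact le_rfl
  | succ k hk ih =>
    have := G.len_pos (i := k) (by omega)
    rw [G.face_add_len]
    linarith [ih (by omega)]

theorem face_mem {i : ℕ} (hi : i ≤ G.N + 2) : G.face i ∈ Icc 0 X :=
  ⟨G.face_zero ▸ G.face_mono (Nat.zero_le i) hi, (G.face_mono hi le_rfl).trans_eq G.face_last⟩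

theorem face_pos {i : ℕ} (hi : i ≤ G.N + 1) : 0 < G.face (i + 1) := by
  have h1 := G.len_pos hi
  have h2 := (G.face_mem (i := i) (by omega)).1
  rw [G.face_add_len]; linarith

/-- The centre of the dual cell `K_i`. -/
def mid (i : ℕ) : ℝ := (G.face i + G.face (i + 1)) / 2

/-- The factor by which the cell centres are dilated so that the last one becomes `X`. -/
def dil : ℝ := X / G.mid (G.N + 1)

/-- The points at which the exact solution is compared with the discrete one. -/
def node (i : ℕ) : ℝ := if i = 0 then 0 else G.dil * G.mid i

/-- The left end point of the interval `J_i = [lo i, node (i + 1)]`, which contains `node i`,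
`node (i + 1)` and `x_{i+1/2}`. -/
def lo (i : ℕ) : ℝ := if i = 0 then 0 else G.mid i

/-- `L_i = l_i + l_{i+1}`. -/
def len₂ (i : ℕ) : ℝ := G.len i + G.len (i + 1)

theorem len₂_pos {i : ℕ} (hi : i ≤ G.N) : 0 < G.len₂ i :=
  add_pos (G.len_pos (by omega)) (G.len_pos (by omega))

theorem len₂_le {i : ℕ} (hi : i ≤ G.N) : G.len₂ i ≤ 2 * G.h := by
  have h1 := G.len_le_h (i := i) (by omega)
  have h2 := G.len_le_h (i := i + 1) (by omega)
  rw [len₂]; linarith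

/-- The last dual cell starts at the midpoint of x_N and X, hence at X/2 or later; its centre is
therefore at 3X/4 or later. -/
theorem mid_last : 3 / 4 * X ≤ G.mid (G.N + 1) ∧ G.mid (G.N + 1) ≤ X ∧
    X - G.mid (G.N + 1) ≤ G.h / 2 := by
  have h1 := (G.x_mem (i := G.N) (by omega))
  have h2 := G.face_succ (i := G.N) le_rfl
  have h3 := G.len_le_h (i := G.N + 1) le_rfl
  rw [len, show G.N + 1 + 1 = G.N + 2 from rfl, G.face_last] at h3
  rw [G.x_last] at h2
  rw [mid, show G.N + 1 + 1 = G.N + 2 from rfl, G.face_last]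
  refine ⟨?_, ?_, ?_⟩ <;> linarith [h1.1, h1.2]

theorem one_le_dil : 1 ≤ G.dil := by
  have := G.X_pos
  obtain ⟨h1, h2, -⟩ := G.mid_last
  rw [dil, le_div_iff₀ (by linarith)]
  linarith

theorem dil_le : G.dil ≤ 4 / 3 := by
  have := G.X_pos
  obtain ⟨h1, h2, -⟩ := G.mid_last
  rw [dil, div_le_iff₀ (by linarith)]
  linarith

/-- The left side is the dilation factor, at most 4/3, times the distance h/2 at most from the last
cell centre to X. -/
theorem dil_sub_one_mul : (G.dil - 1) * X ≤ G.h := by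
  have hX := G.X_pos
  obtain ⟨h1, h2, h3⟩ := G.mid_last
  have hm : 0 < G.mid (G.N + 1) := by linarith
  have e : (G.dil - 1) * X = G.dil * (X - G.mid (G.N + 1)) := by
    rw [dil]; field_simp
  rw [e]
  have := G.dil_le
  have := G.one_le_dil
  have := G.h_pos
  nlinarith

theorem mid_succ_sub (i : ℕ) : G.mid (i + 1) - G.mid i = G.len₂ i / 2 := by
  simp only [mid, len₂, len]; ring

theorem mid_bounds {i : ℕ} (hi : i ≤ G.N + 1) :
    G.face i ≤ G.mid i ∧ G.mid i ≤ G.face (i + 1) ∧ G.face (i + 1) ≤ 2 * G.mid i ∧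
      0 < G.mid i := by
  have h1 := G.len_pos hi
  have h2 := (G.face_mem (i := i) (by omega)).1
  rw [len] at h1
  simp only [mid]
  refine ⟨?_, ?_, ?_, ?_⟩ <;> linarith

theorem node_zero : G.node 0 = 0 := by simp [node]

theorem node_succ (i : ℕ) : G.node (i + 1) = G.dil * G.mid (i + 1) := by simp [node]

theorem node_last : G.node (G.N + 1) = X := by
  have := G.X_pos
  obtain ⟨h1, -, -⟩ := G.mid_last
  have hm : G.mid (G.N + 1) ≠ 0 := by linarith
  rw [node_succ, dil]; field_simp

theorem node_of_pos {i : ℕ} (hi : 1 ≤ i) : G.node i = G.dil * G.mid i := by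
  rw [node, if_neg (by omega)]

theorem lo_of_pos {i : ℕ} (hi : 1 ≤ i) : G.lo i = G.mid i := by
  rw [lo, if_neg (by omega)]

/-- The purpose of the nodes: their spacing is a fixed multiple of the length in the denominator of
the transmissibility. It fails for i = 0, where the node is 0 rather than a dilated centre. -/
theorem node_succ_sub {i : ℕ} (hi : 1 ≤ i) :
    G.node (i + 1) - G.node i = G.dil * (G.len₂ i / 2) := by
  rw [node_succ, G.node_of_pos hi, ← mid_succ_sub]; ring

theorem lo_nonneg {i : ℕ} (hi : i ≤ G.N + 1) : 0 ≤ G.lo i := by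
  rw [lo]; split_ifs
  · exact le_rfl
  · exact (G.mid_bounds hi).2.2.2.le

theorem lo_le_node {i : ℕ} (hi : i ≤ G.N + 1) : G.lo i ≤ G.node i := by
  rw [lo, node]; split_ifs
  · exact le_rfl
  · have h1 := (G.mid_bounds hi).2.2.2
    have h2 := G.one_le_dil
    nlinarith

theorem node_le_succ {i : ℕ} (hi : i ≤ G.N) : G.node i ≤ G.node (i + 1) := by
  have h2 := G.one_le_dil
  rcases Nat.eq_zero_or_pos i with rfl | hpos
  · rw [node_zero, node_succ]
    have h1 := (G.mid_bounds (i := 1) (by omega)).2.2.2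
    positivity
  · have := G.node_succ_sub hpos
    have h3 := G.len₂_pos hi
    have : 0 ≤ G.dil * (G.len₂ i / 2) := by positivity
    linarith

theorem node_mono {i j : ℕ} (hij : i ≤ j) (hj : j ≤ G.N + 1) : G.node i ≤ G.node j := by
  induction j, hij using Nat.le_induction with
  | base => exact le_rfl
  | succ k hk ih => exact (ih (by omega)).trans (G.node_le_succ (by omega))

theorem node_mem {i : ℕ} (hi : i ≤ G.N + 1) : G.node i ∈ Icc 0 X :=
  ⟨G.node_zero ▸ G.node_mono (Nat.zero_le i) hi, (G.node_mono hi le_rfl).trans_eq G.node_last⟩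

theorem lo_mem {i : ℕ} (hi : i ≤ G.N + 1) : G.lo i ∈ Icc 0 X :=
  ⟨G.lo_nonneg hi, (G.lo_le_node hi).trans (G.node_mem hi).2⟩

theorem lo_le_face {i : ℕ} (hi : i ≤ G.N + 1) : G.lo i ≤ G.face (i + 1) := by
  rw [lo]; split_ifs
  · exact (G.face_mem (by omega)).1
  · exact (G.mid_bounds hi).2.1

theorem face_le_node {i : ℕ} (hi : i ≤ G.N) : G.face (i + 1) ≤ G.node (i + 1) := by
  have h1 := G.mid_bounds (i := i + 1) (by omega)
  have h2 := G.one_le_dil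
  rw [node_succ]
  nlinarith [h1.1, h1.2.2.2]

theorem node_sub_mid_le {i : ℕ} (hi : i ≤ G.N + 1) : G.dil * G.mid i - G.mid i ≤ G.h := by
  have h1 := G.dil_sub_one_mul
  have h2 := G.one_le_dil
  have h3 := (G.mid_bounds hi).2.1
  have h4 := (G.face_mem (i := i + 1) (by omega)).2
  have : (G.dil - 1) * G.mid i ≤ (G.dil - 1) * X :=
    mul_le_mul_of_nonneg_left (h3.trans h4) (by linarith)
  linarith

/-- One h for the dilation, one for the distance of two cell centres, and one for the first cell,
whose interval starts at 0 instead of at its centre. -/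
theorem node_sub_lo_le {i : ℕ} (hi : i ≤ G.N) : G.node (i + 1) - G.lo i ≤ 3 * G.h := by
  have h1 := G.node_sub_mid_le (i := i + 1) (by omega)
  have h2 := G.mid_succ_sub i
  have h3 := G.len₂_le hi
  have h4 := G.h_pos
  rw [node_succ, lo]
  split_ifs with h
  · subst h
    have h5 : G.mid 0 ≤ G.h := by
      have h6 := (G.mid_bounds (i := 0) (by omega)).2.1
      have h7 := G.len_le_h (i := 0) (by omega)
      rw [G.face_add_len, G.face_zero] at h6
      linarith
    linarith
  · linarith

theorem lo_le_node_succ {i : ℕ} (hi : i ≤ G.N) : G.lo i ≤ G.node (i + 1) :=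
  (G.lo_le_node (by omega)).trans (G.node_le_succ hi)

variable {G}

theorem QuasiUniform.len_succ_le {c : ℝ} (hc : 0 < c) (h : G.QuasiUniform c) {i : ℕ}
    (hi : i ≤ G.N) : G.len (i + 1) ≤ c * G.len i := by
  have := (h i hi).1
  rw [div_le_iff₀ hc] at this
  linarith

theorem QuasiUniform.face_succ_le {c : ℝ} (hc : 0 < c) (h : G.QuasiUniform c) {i : ℕ}
    (hi : i ≤ G.N) : G.face (i + 2) ≤ (1 + c) * G.face (i + 1) := by
  have h1 := h.len_succ_le hc hi
  have h2 : G.len i ≤ G.face (i + 1) := by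
    have := (G.face_mem (i := i) (by omega)).1
    rw [G.face_add_len]; linarith
  have h3 := G.face_add_len (i + 1)
  nlinarith

theorem QuasiUniform.len₂_le {c : ℝ} (hc : 0 < c) (h : G.QuasiUniform c) {i : ℕ}
    (hi : i ≤ G.N) : G.len₂ i ≤ (1 + c) * G.len i ∧ G.len₂ i ≤ (1 + c) * G.len (i + 1) := by
  have h1 := h.len_succ_le hc hi
  have h2 := (h i hi).2
  constructor <;> rw [SpaceMesh.len₂] <;> linarith

/-- Every point of J_i is bounded by a multiple of x_{i+1/2}. Singular weights at a face can thus be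
exchanged for weights at the integration variable, even next to 0. -/
theorem QuasiUniform.node_succ_le {c : ℝ} (hc : 0 < c) (h : G.QuasiUniform c) {i : ℕ}
    (hi : i ≤ G.N) : G.node (i + 1) ≤ 2 * (1 + c) * G.face (i + 1) := by
  have h1 := h.face_succ_le hc hi
  have h2 := (G.mid_bounds (i := i + 1) (by omega)).2.1
  have h3 := G.dil_le
  have h4 := G.one_le_dil
  have h5 := G.face_pos (i := i) (by omega)
  rw [G.node_succ]
  have : G.dil * G.mid (i + 1) ≤ 4 / 3 * ((1 + c) * G.face (i + 1)) :=
    mul_le_mul h3 (h2.trans h1) (G.mid_bounds (i := i + 1) (by omega)).2.2.2.le (by norm_num)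
  have : 0 < (1 + c) * G.face (i + 1) := by positivity
  linarith

end SpaceMesh

/-! ### Overlapping sums -/

/-- Clamping F to [α, β] leaves the selected increments unchanged and makes all others nonnegative,
so the sum extends to a telescoping one; the index set need not be contiguous. -/
theorem sum_sub_le_of_mem {F : ℕ → ℝ} {n : ℕ} (hF : ∀ i < n, F i ≤ F (i + 1)) {A : Finset ℕ}
    (hA : A ⊆ Finset.range n) {α β : ℝ} (hαβ : α ≤ β)
    (h : ∀ i ∈ A, α ≤ F i ∧ F (i + 1) ≤ β) : ∑ i ∈ A, (F (i + 1) - F i) ≤ β - α := by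
  let k : ℝ → ℝ := fun x => max α (min β x)
  have hk : Monotone k := fun x y hxy => max_le_max le_rfl (min_le_min le_rfl hxy)
  have h1 : ∑ i ∈ A, (F (i + 1) - F i) = ∑ i ∈ A, (k (F (i + 1)) - k (F i)) := by
    refine Finset.sum_congr rfl fun i hi => ?_
    obtain ⟨h2, h3⟩ := h i hi
    have h4 := hF i (Finset.mem_range.1 (hA hi))
    simp only [k]
    rw [min_eq_right h3, min_eq_right (h4.trans h3), max_eq_right h2,
      max_eq_right (h2.trans h4)]
  rw [h1]
  refine (Finset.sum_le_sum_of_subset_of_nonneg hA fun i hi _ => ?_).trans ?_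
  · exact sub_nonneg.2 (hk (hF i (Finset.mem_range.1 hi)))
  · rw [Finset.sum_range_sub (fun i => k (F i))]
    have h5 : k (F n) ≤ β := max_le hαβ (min_le_left _ _)
    have h6 : α ≤ k (F 0) := le_max_left _ _
    linarith

/-- Exchange of sum and integral: m bounds the total weight of the intervals that cover a given
point. -/
theorem sum_mul_integral_le {X : ℝ} (hX : 0 ≤ X) {s : Finset ℕ} {wt α β : ℕ → ℝ} {g m : ℝ → ℝ}
    (hα : ∀ i ∈ s, α i ∈ Icc 0 X) (hβ : ∀ i ∈ s, β i ∈ Icc 0 X) (hαβ : ∀ i ∈ s, α i ≤ β i)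
    (hg0 : ∀ x, 0 ≤ g x) (hg : IntervalIntegrable g volume 0 X)
    (hmg : IntervalIntegrable (fun x => m x * g x) volume 0 X)
    (h : ∀ z ∈ Ioc 0 X, ∑ i ∈ s with z ∈ Ioc (α i) (β i), wt i ≤ m z) :
    ∑ i ∈ s, wt i * ∫ x in α i..β i, g x ≤ ∫ x in 0..X, m x * g x := by
  rw [intervalIntegrable_iff_integrableOn_Ioc_of_le hX] at hg hmg
  have e : ∀ i ∈ s, wt i * ∫ x in α i..β i, g x =
      ∫ x in Ioc 0 X, wt i * (Ioc (α i) (β i)).indicator g x := by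
    intro i hi
    rw [integral_const_mul, integral_indicator measurableSet_Ioc,
      Measure.restrict_restrict measurableSet_Ioc,
      inter_eq_left.2 (Ioc_subset_Ioc (hα i hi).1 (hβ i hi).2),
      intervalIntegral.integral_of_le (hαβ i hi)]
  have hInt : ∀ i ∈ s, IntegrableOn (fun x => wt i * (Ioc (α i) (β i)).indicator g x)
      (Ioc 0 X) := fun i _ => (Integrable.indicator hg measurableSet_Ioc).const_mul _
  rw [Finset.sum_congr rfl e, ← integral_finsetSum s hInt, intervalIntegral.integral_of_le hX]
  refine setIntegral_mono_on (integrable_finsetSum s hInt) hmg measurableSet_Ioc fun z hz => ?_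
  have : ∑ i ∈ s, wt i * (Ioc (α i) (β i)).indicator g z =
      (∑ i ∈ s with z ∈ Ioc (α i) (β i), wt i) * g z := by
    rw [Finset.sum_filter, Finset.sum_mul]
    refine Finset.sum_congr rfl fun i _ => ?_
    by_cases hm : z ∈ Ioc (α i) (β i)
    · rw [indicator_of_mem hm, if_pos hm]
    · rw [indicator_of_notMem hm, if_neg hm, mul_zero, zero_mul]
  rw [this]
  exact mul_le_mul_of_nonneg_right (h z hz) (hg0 z)

namespace SpaceMesh

variable {X : ℝ} (G : SpaceMesh X)

theorem sum_len₂_le_of_mem {A : Finset ℕ} (hA : A ⊆ Finset.range (G.N + 1)) {α β : ℝ}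
    (hαβ : α ≤ β) (h : ∀ i ∈ A, α ≤ G.face i ∧ G.face (i + 2) ≤ β) :
    ∑ i ∈ A, G.len₂ i ≤ 2 * (β - α) := by
  have hlt : ∀ i ∈ A, i < G.N + 1 := fun i hi => Finset.mem_range.1 (hA hi)
  have hm : ∀ i ≤ G.N + 1, G.face i ≤ G.face (i + 1) := fun i hi =>
    G.face_mono (by omega) (by omega)
  have h1 := sum_sub_le_of_mem (F := G.face) (n := G.N + 1) (fun i hi => hm i (by omega)) hA hαβ
    fun i hi => ⟨(h i hi).1, (hm (i + 1) (by have := hlt i hi; omega)).trans (h i hi).2⟩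
  have h2 := sum_sub_le_of_mem (F := fun i => G.face (i + 1)) (n := G.N + 1)
    (fun i hi => hm (i + 1) (by omega)) hA hαβ
    fun i hi => ⟨(h i hi).1.trans (hm i (by have := hlt i hi; omega)), (h i hi).2⟩
  have : ∑ i ∈ A, G.len₂ i = ∑ i ∈ A, (G.face (i + 1) - G.face i) +
      ∑ i ∈ A, (G.face (i + 1 + 1) - G.face (i + 1)) := by
    rw [← Finset.sum_add_distrib]; rfl
  linarith

theorem sum_len₂_le : ∑ i ∈ Finset.range (G.N + 1), G.len₂ i ≤ 2 * X := by
  have := G.sum_len₂_le_of_mem (A := Finset.range (G.N + 1)) subset_rfl (α := 0) (β := X)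
    G.X_pos.le fun i hi => by
      have := Finset.mem_range.1 hi
      exact ⟨(G.face_mem (by omega)).1, (G.face_mem (by omega)).2⟩
  linarith

/-- The last bound rests on z exceeding the centre of K_i. It has no analogue for i = 0, where J_0
starts at 0; the first face is therefore kept apart throughout. -/
theorem face_near {i : ℕ} (h1 : 1 ≤ i) (hi : i ≤ G.N) {z : ℝ}
    (hz : z ∈ Ioc (G.lo i) (G.node (i + 1))) :
    z - 4 * G.h ≤ G.face i ∧ G.face (i + 2) ≤ z + 2 * G.h ∧ G.face (i + 1) ≤ 2 * z := by
  obtain ⟨hz1, hz2⟩ := hz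
  have k1 := G.node_sub_lo_le hi
  have k2 := G.len_le_h (i := i) (by omega)
  have k3 := G.len_le_h (i := i + 1) (by omega)
  have k4 := G.mid_bounds (i := i) (by omega)
  have k5 := G.face_add_len i
  have k6 := G.face_add_len (i + 1)
  rw [G.lo_of_pos h1] at hz1 k1
  refine ⟨?_, ?_, ?_⟩ <;> linarith [k4.1, k4.2.1, k4.2.2.1]

/-- The dilation can shift nodes across many small cells, so counting the intervals over z is of no
use. Their cells, however, all lie within distance O(h) of z, so the total length is bounded. -/
theorem sum_overlap_le_h (z : ℝ) :
    ∑ i ∈ Finset.Icc 1 G.N with z ∈ Ioc (G.lo i) (G.node (i + 1)), G.len₂ i ≤ 12 * G.h := by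
  have h := G.h_pos
  refine (G.sum_len₂_le_of_mem (α := z - 4 * G.h) (β := z + 2 * G.h) ?_ (by linarith) ?_).trans
    (by linarith)
  · intro i hi
    simp only [Finset.mem_filter, Finset.mem_Icc] at hi
    exact Finset.mem_range.2 (by omega)
  · intro i hi
    simp only [Finset.mem_filter, Finset.mem_Icc] at hi
    have := G.face_near hi.1.1 hi.1.2 hi.2
    exact ⟨this.1, this.2.1⟩

/-- This sharper form for z below h uses that all cells concerned lie between 0 and a multiple of z.
-/
theorem sum_overlap_le {c : ℝ} (hc : 0 < c) (hG : G.QuasiUniform c) {z : ℝ} (hz : 0 < z) :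
    ∑ i ∈ Finset.Icc 1 G.N with z ∈ Ioc (G.lo i) (G.node (i + 1)), G.len₂ i ≤
      4 * (1 + c) * z := by
  refine (G.sum_len₂_le_of_mem (α := 0) (β := 2 * (1 + c) * z) ?_ (by positivity) ?_).trans
    (by linarith)
  · intro i hi
    simp only [Finset.mem_filter, Finset.mem_Icc] at hi
    exact Finset.mem_range.2 (by omega)
  · intro i hi
    simp only [Finset.mem_filter, Finset.mem_Icc] at hi
    have h1 := G.face_near hi.1.1 hi.1.2 hi.2
    have h2 := hG.face_succ_le hc hi.1.2
    refine ⟨(G.face_mem (by omega)).1, h2.trans ?_⟩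
    nlinarith [h1.2.2]

end SpaceMesh

theorem sum_range_succ_eq_add_Icc (F : ℕ → ℝ) (n : ℕ) :
    ∑ i ∈ Finset.range (n + 1), F i = F 0 + ∑ i ∈ Finset.Icc 1 n, F i := by
  rw [Finset.sum_range_succ', add_comm, Finset.range_eq_Ico, Finset.sum_Ico_add' F 0 n 1]
  rfl

/-! ### Local oscillations -/

namespace SpaceMesh

variable {X : ℝ} (G : SpaceMesh X) {g : ℝ → ℝ}

/-- `∫_{J_i} |g|`. -/
def osc (g : ℝ → ℝ) (i : ℕ) : ℝ := ∫ x in G.lo i..G.node (i + 1), |g x|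

theorem osc_nonneg {i : ℕ} (hi : i ≤ G.N) : 0 ≤ G.osc g i :=
  intervalIntegral.integral_nonneg (G.lo_le_node_succ hi) fun _ _ => abs_nonneg _

theorem memLp_abs (hg : MemLp g 2 (dom X)) : MemLp (fun x => |g x|) 2 (dom X) := hg.norm

theorem osc_sq_le (hg : MemLp g 2 (dom X)) {i : ℕ} (hi : i ≤ G.N) :
    G.osc g i ^ 2 ≤ (G.node (i + 1) - G.lo i) * ∫ x in G.lo i..G.node (i + 1), g x ^ 2 := by
  have h1 := G.lo_mem (i := i) (by omega)
  have h2 := G.node_mem (i := i + 1) (by omega)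
  have := sq_integral_le (G.lo_le_node_succ hi)
    (MemLp.intervalIntegrable_dom (memLp_abs hg) h1 h2)
    (MemLp.intervalIntegrable_sq_dom (memLp_abs hg) h1 h2)
  simpa only [osc, sq_abs] using this

theorem abs_primitive_sub_le (hg : MemLp g 2 (dom X)) {a b z z' : ℝ} (ha : a ∈ Icc 0 X)
    (hb : b ∈ Icc 0 X) (hz : z ∈ Icc a b) (hz' : z' ∈ Icc a b) :
    |(∫ y in 0..z, g y) - ∫ y in 0..z', g y| ≤ ∫ x in a..b, |g x| := by
  have hsub : Icc a b ⊆ Icc 0 X := Icc_subset_Icc ha.1 hb.2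
  have h0 : (0 : ℝ) ∈ Icc 0 X := ⟨le_rfl, ha.1.trans ha.2⟩
  have hab : a ≤ b := hz.1.trans hz.2
  rw [intervalIntegral.integral_interval_sub_left (MemLp.intervalIntegrable_dom hg h0 (hsub hz))
    (MemLp.intervalIntegrable_dom hg h0 (hsub hz')),
    ← abs_of_nonneg (intervalIntegral.integral_nonneg hab fun x _ => abs_nonneg (g x))]
  refine (intervalIntegral.norm_integral_le_abs_integral_norm (f := g)).trans ?_
  refine intervalIntegral.abs_integral_mono_interval ?_
    (Eventually.of_forall fun t => norm_nonneg (g t))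
    (MemLp.intervalIntegrable_dom (memLp_abs hg) ha hb)
  rw [uIoc_of_le hab]
  exact Ioc_subset_Ioc (le_min hz'.1 hz.1) (max_le hz'.2 hz.2)

theorem abs_sub_le_osc (hg : MemLp g 2 (dom X)) {i : ℕ} (hi : i ≤ G.N) {z z' : ℝ}
    (hz : z ∈ Icc (G.lo i) (G.node (i + 1))) (hz' : z' ∈ Icc (G.lo i) (G.node (i + 1))) :
    |(∫ y in 0..z, g y) - ∫ y in 0..z', g y| ≤ G.osc g i :=
  abs_primitive_sub_le hg (G.lo_mem (by omega)) (G.node_mem (by omega)) hz hz'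

/-- The hull of J_{i-1} and J_i contains x_i, `node i` and the whole cell K_i, so a single bound
serves all comparisons within a cell. -/
theorem abs_sub_le_osc_add (hg : MemLp g 2 (dom X)) {i : ℕ} (h1 : 1 ≤ i) (hi : i ≤ G.N)
    {z z' : ℝ} (hz : z ∈ Icc (G.lo (i - 1)) (G.node (i + 1)))
    (hz' : z' ∈ Icc (G.lo (i - 1)) (G.node (i + 1))) :
    |(∫ y in 0..z, g y) - ∫ y in 0..z', g y| ≤ G.osc g (i - 1) + G.osc g i := by
  obtain ⟨j, rfl⟩ : ∃ j, i = j + 1 := ⟨i - 1, by omega⟩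
  rw [Nat.add_sub_cancel] at *
  have m1 := G.lo_mem (i := j) (by omega)
  have m2 := G.node_mem (i := j + 1) (by omega)
  have m3 := G.node_mem (i := j + 1 + 1) (by omega)
  have m4 := G.lo_mem (i := j + 1) (by omega)
  have hI : ∀ {a b}, a ∈ Icc 0 X → b ∈ Icc 0 X → IntervalIntegrable (fun x => |g x|) volume a b :=
    fun ha hb => MemLp.intervalIntegrable_dom (memLp_abs hg) ha hb
  refine (abs_primitive_sub_le hg m1 m3 hz hz').trans ?_
  rw [← intervalIntegral.integral_add_adjacent_intervals (hI m1 m2) (hI m2 m3)]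
  refine add_le_add le_rfl ?_
  refine intervalIntegral.integral_mono_interval (G.lo_le_node (by omega))
    (G.node_le_succ hi) le_rfl (Eventually.of_forall fun x => abs_nonneg _) (hI m4 m3)

theorem integral_sq_le_of_mem (hg : MemLp g 2 (dom X)) {a b : ℝ} (ha : a ∈ Icc 0 X)
    (hb : b ∈ Icc 0 X) (hab : a ≤ b) : ∫ x in a..b, g x ^ 2 ≤ ∫ x in 0..X, g x ^ 2 := by
  have hX : 0 ≤ X := ha.1.trans ha.2
  exact intervalIntegral.integral_mono_interval ha.1 hab hb.2
    (Eventually.of_forall fun x => sq_nonneg _)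
    (MemLp.intervalIntegrable_sq_dom hg ⟨le_rfl, hX⟩ ⟨hX, le_rfl⟩)

/-- Cauchy–Schwarz on intervals of length at most 3h, followed by the overlap bound. The constant is
3 · (2 + 12), where the 2 belongs to the first interval. -/
theorem sum_len₂_mul_osc_sq_le (hg : MemLp g 2 (dom X)) :
    ∑ i ∈ Finset.range (G.N + 1), G.len₂ i * G.osc g i ^ 2 ≤
      42 * G.h ^ 2 * ∫ x in 0..X, g x ^ 2 := by
  have hX := G.X_pos
  have hh := G.h_pos
  have h0 : (0 : ℝ) ∈ Icc 0 X := ⟨le_rfl, hX.le⟩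
  have h1 : X ∈ Icc 0 X := ⟨hX.le, le_rfl⟩
  have hIsq := MemLp.intervalIntegrable_sq_dom hg h0 h1
  have hnn : ∀ i ≤ G.N, 0 ≤ ∫ x in G.lo i..G.node (i + 1), g x ^ 2 := fun i hi =>
    intervalIntegral.integral_nonneg (G.lo_le_node_succ hi) fun _ _ => sq_nonneg _
  have hstep : ∀ i ≤ G.N, G.len₂ i * G.osc g i ^ 2 ≤
      3 * G.h * (G.len₂ i * ∫ x in G.lo i..G.node (i + 1), g x ^ 2) := by
    intro i hi
    have k1 := (G.osc_sq_le hg hi).trans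
      (mul_le_mul_of_nonneg_right (G.node_sub_lo_le hi) (hnn i hi))
    have := mul_le_mul_of_nonneg_left k1 (G.len₂_pos hi).le
    linarith
  refine (Finset.sum_le_sum fun i hi => hstep i (by
    have := Finset.mem_range.1 hi; omega)).trans ?_
  rw [← Finset.mul_sum, sum_range_succ_eq_add_Icc]
  have hmain := sum_mul_integral_le hX.le (s := Finset.Icc 1 G.N) (wt := G.len₂) (α := G.lo)
    (β := fun i => G.node (i + 1)) (g := fun x => g x ^ 2) (m := fun _ => 12 * G.h)
    (fun i hi => G.lo_mem (by have := Finset.mem_Icc.1 hi; omega))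
    (fun i hi => G.node_mem (by have := Finset.mem_Icc.1 hi; omega))
    (fun i hi => G.lo_le_node_succ (Finset.mem_Icc.1 hi).2) (fun x => sq_nonneg _) hIsq
    (hIsq.const_mul _) (fun z _ => G.sum_overlap_le_h z)
  rw [intervalIntegral.integral_const_mul] at hmain
  have hz : G.len₂ 0 * ∫ x in G.lo 0..G.node (0 + 1), g x ^ 2 ≤
      2 * G.h * ∫ x in 0..X, g x ^ 2 :=
    mul_le_mul (G.len₂_le (Nat.zero_le _)) (integral_sq_le_of_mem hg (G.lo_mem (by omega))
      (G.node_mem (by omega)) (G.lo_le_node_succ (Nat.zero_le _))) (hnn 0 (Nat.zero_le _))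
      (by positivity)
  have := mul_le_mul_of_nonneg_left (add_le_add hz hmain) (by positivity : 0 ≤ 3 * G.h)
  refine this.trans (le_of_eq ?_)
  ring

/-- Here (p + q)² ≤ 2p² + 2q², and each of the two shifted sums is bounded by the previous one; 168
= 4 · 42. -/
theorem sum_len_mul_osc_sq_le (hg : MemLp g 2 (dom X)) :
    ∑ i ∈ Finset.Icc 1 G.N, G.len i * (G.osc g (i - 1) + G.osc g i) ^ 2 ≤
      168 * G.h ^ 2 * ∫ x in 0..X, g x ^ 2 := by
  have hmain := G.sum_len₂_mul_osc_sq_le hg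
  have hterm : ∀ i ≤ G.N, 0 ≤ G.len₂ i * G.osc g i ^ 2 := fun i hi =>
    mul_nonneg (G.len₂_pos hi).le (sq_nonneg _)
  have h1 : ∑ i ∈ Finset.Icc 1 G.N, G.len₂ i * G.osc g i ^ 2 ≤
      ∑ i ∈ Finset.range (G.N + 1), G.len₂ i * G.osc g i ^ 2 := by
    rw [sum_range_succ_eq_add_Icc]
    linarith [hterm 0 (Nat.zero_le _)]
  have h2 : ∑ i ∈ Finset.Icc 1 G.N, G.len₂ (i - 1) * G.osc g (i - 1) ^ 2 ≤
      ∑ i ∈ Finset.range (G.N + 1), G.len₂ i * G.osc g i ^ 2 := by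
    have : ∑ i ∈ Finset.Icc 1 G.N, G.len₂ (i - 1) * G.osc g (i - 1) ^ 2 =
        ∑ i ∈ Finset.range G.N, G.len₂ i * G.osc g i ^ 2 := by
      have := Finset.sum_Ico_add' (fun i => G.len₂ (i - 1) * G.osc g (i - 1) ^ 2) 0 G.N 1
      rw [Finset.range_eq_Ico]
      exact this.symm
    rw [this, Finset.sum_range_succ]
    linarith [hterm G.N le_rfl]
  have h3 : ∑ i ∈ Finset.Icc 1 G.N, G.len i * (G.osc g (i - 1) + G.osc g i) ^ 2 ≤
      ∑ i ∈ Finset.Icc 1 G.N, (2 * (G.len₂ (i - 1) * G.osc g (i - 1) ^ 2) +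
        2 * (G.len₂ i * G.osc g i ^ 2)) := by
    refine Finset.sum_le_sum fun i hi => ?_
    obtain ⟨k1, k2⟩ := Finset.mem_Icc.1 hi
    have l0 := G.len_pos (i := i) (by omega)
    have l1 := G.len_pos (i := i - 1) (by omega)
    have l2 := G.len_pos (i := i + 1) (by omega)
    have e1 : G.len i ≤ G.len₂ (i - 1) := by
      rw [len₂, Nat.sub_add_cancel k1]; linarith
    have e2 : G.len i ≤ G.len₂ i := by rw [len₂]; linarith
    have e3 := mul_le_mul_of_nonneg_right e1 (sq_nonneg (G.osc g (i - 1)))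
    have e4 := mul_le_mul_of_nonneg_right e2 (sq_nonneg (G.osc g i))
    have e5 := mul_nonneg l0.le (sq_nonneg (G.osc g (i - 1) - G.osc g i))
    linarith
  rw [Finset.sum_add_distrib, ← Finset.mul_sum, ← Finset.mul_sum] at h3
  linarith

end SpaceMesh

/-! ### A weighted Hardy inequality -/

/-- The weight `min(1, h/z)²`. -/
def weight (h z : ℝ) : ℝ := (h / max h z) ^ 2

section Weight

variable {h : ℝ}

theorem continuous_weight (hh : 0 < h) : Continuous (weight h) := by
  unfold weight
  exact (continuous_const.div (continuous_const.max continuous_id)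
    fun x => (lt_of_lt_of_le hh (le_max_left _ _)).ne').pow 2

theorem weight_nonneg (h z : ℝ) : 0 ≤ weight h z := sq_nonneg _

theorem weight_le_one (hh : 0 < h) (z : ℝ) : weight h z ≤ 1 := by
  have h1 : h ≤ max h z := le_max_left _ _
  have h2 : h / max h z ≤ 1 := (div_le_one (hh.trans_le h1)).2 h1
  have h3 : 0 ≤ h / max h z := div_nonneg hh.le (hh.le.trans h1)
  exact pow_le_one₀ h3 h2

theorem weight_le (hh : 0 < h) {z : ℝ} (hz : 0 < z) : weight h z ≤ h ^ 2 / z ^ 2 := by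
  rw [weight, div_pow]
  exact div_le_div_of_nonneg_left (by positivity) (by positivity)
    (pow_le_pow_left₀ hz.le (le_max_right _ _) 2)

theorem weight_eq_one (hh : 0 < h) {z : ℝ} (hz : z ≤ h) : weight h z = 1 := by
  rw [weight, max_eq_left hz, div_self hh.ne', one_pow]

end Weight

/-- Cauchy–Schwarz with the factors y^{-1/4} and y^{1/4}. The split keeps y^{-1/2} integrable at 0
and leaves enough decay for the outer integral in `integral_weight_sqrt_le`. It is carried out by
completing the square, with l the optimal multiplier. -/
theorem sq_primitive_le {X : ℝ} {g : ℝ → ℝ} (hg : MemLp g 2 (dom X)) {z : ℝ} (hz0 : 0 < z)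
    (hz : z ≤ X) :
    (∫ y in 0..z, g y) ^ 2 ≤ 2 * √z * ∫ y in 0..z, √y * g y ^ 2 := by
  have m0 : (0 : ℝ) ∈ Icc 0 X := ⟨le_rfl, hz0.le.trans hz⟩
  have mz : z ∈ Icc 0 X := ⟨hz0.le, hz⟩
  have i1 := MemLp.intervalIntegrable_dom hg m0 mz
  have i2 : IntervalIntegrable (fun y => √y * g y ^ 2) volume 0 z :=
    (MemLp.intervalIntegrable_sq_dom hg m0 mz).continuousOn_mul Real.continuous_sqrt.continuousOn
  have i3 : IntervalIntegrable (fun y : ℝ => y ^ (-1 / 2 : ℝ)) volume 0 z :=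
    intervalIntegral.intervalIntegrable_rpow' (by norm_num)
  have e3 : ∫ y in 0..z, y ^ (-1 / 2 : ℝ) = 2 * √z := by
    rw [integral_rpow (Or.inl (by norm_num)), Real.sqrt_eq_rpow, Real.zero_rpow (by norm_num)]
    norm_num
    ring
  set v := ∫ y in 0..z, g y
  set A := ∫ y in 0..z, √y * g y ^ 2
  have hs : 0 < √z := Real.sqrt_pos.2 hz0
  set l := v / (2 * √z) with hl
  have key : ∫ y in 0..z, 2 * l * g y ≤ ∫ y in 0..z, (l ^ 2 * y ^ (-1 / 2 : ℝ) + √y * g y ^ 2) := by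
    refine intervalIntegral.integral_mono_on_of_le_Ioo hz0.le (i1.const_mul _)
      ((i3.const_mul _).add i2) fun y hy => ?_
    have hy0 : 0 < √y := Real.sqrt_pos.2 hy.1
    have e : y ^ (-1 / 2 : ℝ) = (√y)⁻¹ := by
      rw [Real.sqrt_eq_rpow, ← Real.rpow_neg hy.1.le]; norm_num
    rw [e]
    have : l ^ 2 * (√y)⁻¹ + √y * g y ^ 2 - 2 * l * g y = (√y)⁻¹ * (l - √y * g y) ^ 2 := by
      field_simp; ring
    have : 0 ≤ (√y)⁻¹ * (l - √y * g y) ^ 2 := by positivity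
    linarith
  rw [intervalIntegral.integral_const_mul, intervalIntegral.integral_add (i3.const_mul _) i2,
    intervalIntegral.integral_const_mul, e3] at key
  have hv : v = 2 * √z * l := by rw [hl]; field_simp
  have : 2 * √z * l ^ 2 ≤ A := by
    have : 2 * l * v = 4 * √z * l ^ 2 := by rw [hv]; ring
    change 2 * l * v ≤ l ^ 2 * (2 * √z) + A at key
    linarith
  calc v ^ 2 = 2 * √z * (2 * √z * l ^ 2) := by rw [hv]; ring
    _ ≤ 2 * √z * A := mul_le_mul_of_nonneg_left this (by positivity)

theorem integral_weight_sqrt_le {h s X : ℝ} (hh : 0 < h) (hs : 0 < s) (hsX : s ≤ X) :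
    √s * ∫ y in s..X, weight h y * √y ≤ 2 * h ^ 2 := by
  have hX : 0 < X := hs.trans_le hsX
  have h0 : (0 : ℝ) ∉ uIcc s X := by rw [uIcc_of_le hsX]; exact fun h => absurd h.1 (not_le.2 hs)
  have hc : Continuous fun y => weight h y * √y :=
    (continuous_weight hh).mul Real.continuous_sqrt
  have h1 : ∫ y in s..X, weight h y * √y ≤ ∫ y in s..X, h ^ 2 * y ^ (-3 / 2 : ℝ) := by
    refine intervalIntegral.integral_mono_on hsX (hc.intervalIntegrable _ _)
      ((intervalIntegral.intervalIntegrable_rpow (Or.inr h0)).const_mul _) fun y hy => ?_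
    have hy : 0 < y := hs.trans_le hy.1
    have e : y ^ (-3 / 2 : ℝ) = √y / y ^ 2 := by
      rw [Real.sqrt_eq_rpow, ← Real.rpow_natCast, ← Real.rpow_sub hy]; norm_num
    rw [e, ← mul_div_assoc, mul_div_right_comm]
    exact mul_le_mul_of_nonneg_right (weight_le hh hy) (Real.sqrt_nonneg _)
  have h2 : ∫ y in s..X, y ^ (-3 / 2 : ℝ) ≤ 2 * (√s)⁻¹ := by
    rw [integral_rpow (Or.inr ⟨by norm_num, h0⟩)]
    have e1 : (-3 / 2 + 1 : ℝ) = -(1 / 2) := by norm_num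
    rw [e1, Real.rpow_neg hX.le, Real.rpow_neg hs.le, ← Real.sqrt_eq_rpow, ← Real.sqrt_eq_rpow]
    have : 0 ≤ (√X)⁻¹ := by positivity
    linarith
  rw [intervalIntegral.integral_const_mul] at h1
  have hs' : 0 < √s := Real.sqrt_pos.2 hs
  have h3 : h ^ 2 * ∫ y in s..X, y ^ (-3 / 2 : ℝ) ≤ h ^ 2 * (2 * (√s)⁻¹) :=
    mul_le_mul_of_nonneg_left h2 (by positivity)
  calc √s * ∫ y in s..X, weight h y * √y ≤ √s * (h ^ 2 * (2 * (√s)⁻¹)) :=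
        mul_le_mul_of_nonneg_left (h1.trans h3) hs'.le
    _ = 2 * h ^ 2 := by field_simp

/-- `sq_primitive_le` bounds the square by an integral over [0, z]; exchanging the order of
integration leaves the tail integral of `integral_weight_sqrt_le`. Each of the two contributes a
factor 2. -/
theorem hardy_weight {X h : ℝ} (hX : 0 < X) (hh : 0 < h) {g : ℝ → ℝ} (hg : MemLp g 2 (dom X)) :
    ∫ z in 0..X, weight h z * (∫ y in 0..z, g y) ^ 2 ≤ 4 * h ^ 2 * ∫ x in 0..X, g x ^ 2 := by
  have m0 : (0 : ℝ) ∈ Icc 0 X := ⟨le_rfl, hX.le⟩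
  have mX : X ∈ Icc 0 X := ⟨hX.le, le_rfl⟩
  let k : ℝ → ℝ := fun y => weight h y * √y
  have hk : Continuous k := (continuous_weight hh).mul Real.continuous_sqrt
  let A : ℝ → ℝ := fun y => √y * g y ^ 2
  have i2 : IntervalIntegrable A volume 0 X :=
    (MemLp.intervalIntegrable_sq_dom hg m0 mX).continuousOn_mul Real.continuous_sqrt.continuousOn
  have hA : IntegrableOn A (Ioo 0 X) :=
    ((intervalIntegrable_iff_integrableOn_Ioc_of_le hX.le).1 i2).mono_set Ioo_subset_Ioc_self
  -- Based at X, the primitive vanishes there, so the integration by parts that swaps the integrals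
  -- has no boundary term.
  let ψ : ℝ → ℝ := fun z => ∫ y in X..z, k y
  have hd : ∀ x, HasDerivAt ψ (k x) x := fun x =>
    intervalIntegral.integral_hasDerivAt_right (hk.intervalIntegrable X x)
      (hk.stronglyMeasurableAtFilter _ _) hk.continuousAt
  have hder : deriv ψ = k := funext fun x => (hd x).deriv
  have hψ : ContDiff ℝ 1 ψ := by
    rw [contDiff_one_iff_deriv]
    exact ⟨fun x => (hd x).differentiableAt, by rw [hder]; exact hk⟩
  have hF := integral_deriv_smul_primitive hA hψ intervalIntegral.integral_same
  rw [hder, integral_dom_eq hX.le, integral_dom_eq hX.le] at hF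
  have cI := MemLp.continuousOn_primitive_dom hg
  have cA : ContinuousOn (fun z => ∫ y in 0..z, A y) (Icc 0 X) := continuousOn_primitive_of_Ioo hA
  have step1 : ∫ z in 0..X, weight h z * (∫ y in 0..z, g y) ^ 2 ≤
      ∫ z in 0..X, 2 * (k z • ∫ y in 0..z, A y) := by
    refine intervalIntegral.integral_mono_on_of_le_Ioo hX.le ?_ ?_ fun z hz => ?_
    · refine ContinuousOn.intervalIntegrable ?_
      rw [uIcc_of_le hX.le]
      exact (continuous_weight hh).continuousOn.mul (cI.pow 2)
    · refine ContinuousOn.intervalIntegrable ?_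
      rw [uIcc_of_le hX.le]
      exact continuousOn_const.mul (hk.continuousOn.smul cA)
    · have := mul_le_mul_of_nonneg_left (sq_primitive_le hg hz.1 hz.2.le) (weight_nonneg h z)
      refine this.trans (le_of_eq ?_)
      simp only [k, A, smul_eq_mul]
      ring
  have step2 : ∫ z in 0..X, -(ψ z • A z) ≤ ∫ z in 0..X, 2 * h ^ 2 * g z ^ 2 := by
    refine intervalIntegral.integral_mono_on_of_le_Ioo hX.le ?_
      ((MemLp.intervalIntegrable_sq_dom hg m0 mX).const_mul _) fun z hz => ?_
    · exact (i2.continuousOn_mul hψ.continuous.continuousOn).neg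
    · have h1 := integral_weight_sqrt_le hh hz.1 hz.2.le
      have h2 : ψ z = -∫ y in z..X, weight h y * √y := intervalIntegral.integral_symm _ _
      have h3 := mul_le_mul_of_nonneg_right h1 (sq_nonneg (g z))
      refine (le_of_eq ?_).trans h3
      rw [h2]; simp only [A, smul_eq_mul]; ring
  rw [intervalIntegral.integral_const_mul, hF] at step1
  rw [intervalIntegral.integral_neg, intervalIntegral.integral_const_mul] at step2
  linarith

namespace SpaceMesh

variable {X : ℝ} (G : SpaceMesh X) {g : ℝ → ℝ}

theorem intervalIntegrable_weight_mul_sq (hX : 0 < X) {h : ℝ} (hh : 0 < h)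
    (hg : MemLp g 2 (dom X)) : IntervalIntegrable (fun x => weight h x * g x ^ 2) volume 0 X :=
  (MemLp.intervalIntegrable_sq_dom hg ⟨le_rfl, hX.le⟩ ⟨hX.le, le_rfl⟩).continuousOn_mul
    (continuous_weight hh).continuousOn

/-- The singular factor at the faces becomes the weight min(1, h/z)². The power 1/z² would appear on
all of (0, X) if intervals were bounded by h only; near 0 they are also shorter than a multiple of
x_{i+1/2}, which caps the weight. -/
theorem sum_len₂_div_mul_osc_sq_le {c : ℝ} (hc : 0 < c) (hG : G.QuasiUniform c)
    (hg : MemLp g 2 (dom X)) :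
    ∑ i ∈ Finset.Icc 1 G.N, G.len₂ i / G.face (i + 1) ^ 2 * G.osc g i ^ 2 ≤
      36 * (2 * (1 + c)) ^ 3 * ∫ x in 0..X, weight G.h x * g x ^ 2 := by
  have hX := G.X_pos
  have hh := G.h_pos
  set κ := 2 * (1 + c) with hκ
  have hκ1 : 1 ≤ κ := by rw [hκ]; linarith
  have h0 : (0 : ℝ) ∈ Icc 0 X := ⟨le_rfl, hX.le⟩
  have h1 : X ∈ Icc 0 X := ⟨hX.le, le_rfl⟩
  have hIsq := MemLp.intervalIntegrable_sq_dom hg h0 h1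
  have hIw := intervalIntegrable_weight_mul_sq hX hh hg
  have hstep : ∀ i ∈ Finset.Icc 1 G.N, G.len₂ i / G.face (i + 1) ^ 2 * G.osc g i ^ 2 ≤
      (G.len₂ i * ((G.node (i + 1) - G.lo i) / G.face (i + 1) ^ 2)) *
        ∫ x in G.lo i..G.node (i + 1), g x ^ 2 := by
    intro i hi
    have hi' := (Finset.mem_Icc.1 hi).2
    have hL := G.len₂_pos hi'
    have hf := G.face_pos (i := i) (by omega)
    refine (mul_le_mul_of_nonneg_left (G.osc_sq_le hg hi') (by positivity)).trans
      (le_of_eq (by ring))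
  refine (Finset.sum_le_sum hstep).trans ?_
  rw [← intervalIntegral.integral_const_mul]
  have := sum_mul_integral_le hX.le (s := Finset.Icc 1 G.N)
    (wt := fun i => G.len₂ i * ((G.node (i + 1) - G.lo i) / G.face (i + 1) ^ 2)) (α := G.lo)
    (β := fun i => G.node (i + 1)) (g := fun x => g x ^ 2) (m := fun z => 36 * κ ^ 3 * weight G.h z)
    (fun i hi => G.lo_mem (by have := Finset.mem_Icc.1 hi; omega))
    (fun i hi => G.node_mem (by have := Finset.mem_Icc.1 hi; omega))
    (fun i hi => G.lo_le_node_succ (Finset.mem_Icc.1 hi).2) (fun x => sq_nonneg _) hIsq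
    (by convert hIw.const_mul (36 * κ ^ 3) using 1; ext x; ring) ?_
  · simpa only [mul_assoc] using this
  intro z hz
  have hz0 : 0 < z := hz.1
  have hbound : ∀ q Q : ℝ, 0 ≤ q →
      (∀ i ∈ Finset.Icc 1 G.N, z ∈ Ioc (G.lo i) (G.node (i + 1)) →
        (G.node (i + 1) - G.lo i) / G.face (i + 1) ^ 2 ≤ q) →
      (∑ i ∈ Finset.Icc 1 G.N with z ∈ Ioc (G.lo i) (G.node (i + 1)), G.len₂ i ≤ Q) →
      ∑ i ∈ Finset.Icc 1 G.N with z ∈ Ioc (G.lo i) (G.node (i + 1)),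
        G.len₂ i * ((G.node (i + 1) - G.lo i) / G.face (i + 1) ^ 2) ≤ Q * q := by
    intro q Q hq h1 h2
    refine le_trans (Finset.sum_le_sum fun i hi => ?_)
      ((Finset.sum_mul _ _ _).symm.le.trans (mul_le_mul_of_nonneg_right h2 hq))
    obtain ⟨k1, k2⟩ := Finset.mem_filter.1 hi
    exact mul_le_mul_of_nonneg_left (h1 i k1 k2) (G.len₂_pos (Finset.mem_Icc.1 k1).2).le
  have hface : ∀ i ∈ Finset.Icc 1 G.N, z ∈ Ioc (G.lo i) (G.node (i + 1)) →
      0 < G.face (i + 1) ∧ z ≤ κ * G.face (i + 1) ∧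
        G.node (i + 1) - G.lo i ≤ κ * G.face (i + 1) ∧ G.node (i + 1) - G.lo i ≤ 3 * G.h := by
    intro i hi hzi
    have hi' := (Finset.mem_Icc.1 hi).2
    have k1 := hG.node_succ_le hc hi'
    have k2 := G.lo_nonneg (i := i) (by omega)
    exact ⟨G.face_pos (by omega), hzi.2.trans k1, by linarith, G.node_sub_lo_le hi'⟩
  rcases le_or_gt z G.h with hzh | hzh
  -- Near 0 both the interval length and the overlap are measured relative to z, and the powers of z
  -- cancel.
  · rw [weight_eq_one hh hzh, mul_one]
    refine (hbound (κ ^ 2 / z) (2 * κ * z) (by positivity) ?_ ?_).trans ?_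
    · intro i hi hzi
      obtain ⟨k0, k1, k2, -⟩ := hface i hi hzi
      rw [div_le_div_iff₀ (by positivity) hz0]
      calc (G.node (i + 1) - G.lo i) * z ≤ (κ * G.face (i + 1)) * (κ * G.face (i + 1)) :=
            mul_le_mul k2 k1 hz0.le (by positivity)
        _ = κ ^ 2 * G.face (i + 1) ^ 2 := by ring
    · refine (G.sum_overlap_le hc hG hz0).trans (le_of_eq ?_)
      rw [hκ]; ring
    · have : 2 * κ * z * (κ ^ 2 / z) = 2 * κ ^ 3 := by field_simp
      rw [this]
      have : 0 ≤ κ ^ 3 := by positivity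
      linarith
  -- Away from 0 both are measured by h, which leaves h²/z².
  · have hw : weight G.h z = G.h ^ 2 / z ^ 2 := by
      rw [weight, max_eq_right hzh.le, div_pow]
    rw [hw]
    refine (hbound (3 * G.h * κ ^ 2 / z ^ 2) (12 * G.h) (by positivity) ?_
      (G.sum_overlap_le_h z)).trans ?_
    · intro i hi hzi
      obtain ⟨k0, k1, -, k2⟩ := hface i hi hzi
      rw [div_le_div_iff₀ (by positivity) (by positivity)]
      calc (G.node (i + 1) - G.lo i) * z ^ 2 ≤ (3 * G.h) * (κ * G.face (i + 1)) ^ 2 :=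
            mul_le_mul k2 (pow_le_pow_left₀ hz0.le k1 2) (by positivity) (by positivity)
        _ = 3 * G.h * κ ^ 2 * G.face (i + 1) ^ 2 := by ring
    · have e : 12 * G.h * (3 * G.h * κ ^ 2 / z ^ 2) = 36 * κ ^ 2 * (G.h ^ 2 / z ^ 2) := by ring
      rw [e]
      refine mul_le_mul_of_nonneg_right ?_ (by positivity)
      nlinarith [sq_nonneg κ]

/-! ### Transmissibilities -/

/-- The mean value of `x²` over `K_i`. -/
def meanSq (i : ℕ) : ℝ := (G.face (i + 1) ^ 2 + G.face (i + 1) * G.face i + G.face i ^ 2) / 3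

/-- The weighted harmonic mean of the mean values of `x²` over `K_i` and `K_{i+1}`. -/
def harmSq (i : ℕ) : ℝ :=
  G.len₂ i * G.meanSq i * G.meanSq (i + 1) /
    (G.meanSq i * G.len (i + 1) + G.meanSq (i + 1) * G.len i)

theorem meanSq_bounds {i : ℕ} (hi : i ≤ G.N + 1) :
    G.face i ^ 2 ≤ G.meanSq i ∧ G.face (i + 1) ^ 2 / 3 ≤ G.meanSq i ∧
      G.meanSq i ≤ G.face (i + 1) ^ 2 ∧ 0 < G.meanSq i := by
  have h1 := G.face_mono (i := i) (j := i + 1) (by omega) (by omega)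
  have h2 := (G.face_mem (i := i) (by omega)).1
  have h3 := G.face_pos hi
  simp only [meanSq]
  refine ⟨?_, ?_, ?_, by positivity⟩ <;> nlinarith

/-- The cell means of x² increase with the cell, and a weighted harmonic mean lies between its two
entries. -/
theorem harmSq_bounds {i : ℕ} (hi : i ≤ G.N) :
    G.meanSq i ≤ G.harmSq i ∧ G.harmSq i ≤ G.meanSq (i + 1) := by
  obtain ⟨-, -, h1, h2⟩ := G.meanSq_bounds (i := i) (by omega)
  obtain ⟨h3, -, -, h4⟩ := G.meanSq_bounds (i := i + 1) (by omega)
  have h5 := G.len_pos (i := i) (by omega)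
  have h6 := G.len_pos (i := i + 1) (by omega)
  have hle : G.meanSq i ≤ G.meanSq (i + 1) := h1.trans h3
  have hd : 0 < G.meanSq i * G.len (i + 1) + G.meanSq (i + 1) * G.len i := by positivity
  simp only [harmSq, len₂]
  constructor
  · rw [le_div_iff₀ hd]
    have := mul_nonneg (mul_nonneg h2.le h6.le) (sub_nonneg.2 hle)
    nlinarith
  · rw [div_le_iff₀ hd]
    have := mul_nonneg (mul_nonneg h4.le h5.le) (sub_nonneg.2 hle)
    nlinarith

theorem cellTrans_eq (σ : ℝ → ℝ) (t : ℝ) {i : ℕ} (hi : i ≤ G.N + 1) :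
    G.cellTrans σ t i = coefA σ t * (G.meanSq i / G.len i) := by
  have h1 : G.face (i + 1) - G.face i ≠ 0 := (G.len_pos hi).ne'
  have h2 : (G.face (i + 1) ^ 3 - G.face i ^ 3) / (G.face (i + 1) - G.face i) =
      3 * G.meanSq i := by
    rw [div_eq_iff h1, meanSq]; ring
  rw [cellTrans, h2, coefA]; ring

/-- This form exhibits the transmissibility as a diffusion coefficient at the face divided by half
of l_i + l_{i+1}; it determines where the exact solution has to be evaluated. -/
theorem trans_eq (σ : ℝ → ℝ) (t : ℝ) {i : ℕ} (hi : i ≤ G.N) :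
    G.trans σ t i = coefA σ t * (2 * G.harmSq i / G.len₂ i) := by
  rw [trans, G.cellTrans_eq σ t (by omega), G.cellTrans_eq σ t (by omega), harmSq]
  by_cases ha : coefA σ t = 0
  · simp [ha]
  have h1 := (G.meanSq_bounds (i := i) (by omega)).2.2.2
  have h2 := (G.meanSq_bounds (i := i + 1) (by omega)).2.2.2
  have h3 := G.len_pos (i := i) (by omega)
  have h4 := G.len_pos (i := i + 1) (by omega)
  have h5 := G.len₂_pos hi
  have hd : 0 < G.meanSq i * G.len (i + 1) + G.meanSq (i + 1) * G.len i := by positivity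
  have e : coefA σ t * (G.meanSq i / G.len i) + coefA σ t * (G.meanSq (i + 1) / G.len (i + 1)) =
      coefA σ t * (G.meanSq i * G.len (i + 1) + G.meanSq (i + 1) * G.len i) /
        (G.len i * G.len (i + 1)) := by
    field_simp
  rw [e]
  field_simp

theorem harmSq_le {c : ℝ} (hc : 0 < c) (hG : G.QuasiUniform c) {i : ℕ} (hi : i ≤ G.N) :
    G.harmSq i ≤ (1 + c) ^ 2 * G.face (i + 1) ^ 2 := by
  have h1 := (G.harmSq_bounds hi).2.trans (G.meanSq_bounds (i := i + 1) (by omega)).2.2.1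
  have h2 := hG.face_succ_le hc hi
  have h3 := G.face_pos (i := i + 1) (by omega)
  refine h1.trans ?_
  rw [← mul_pow]
  exact pow_le_pow_left₀ h3.le h2 2

/-- Three errors, from the dilation, from the harmonic mean and from moving the point, each of size
h · x_{i+1/2}. The factor x_{i+1/2} is essential: it is consumed by the singular dual weight. -/
theorem abs_dil_mul_harmSq_sub_le {c : ℝ} (hc : 0 < c) (hG : G.QuasiUniform c) {i : ℕ}
    (hi : i ≤ G.N) {x : ℝ} (hx : x ∈ Icc (G.lo i) (G.node (i + 1))) :
    |G.dil * G.harmSq i - x ^ 2| ≤ (8 * c + 12) * G.h * G.face (i + 1) := by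
  have hX := G.X_pos
  have hh := G.h_pos
  set y := G.face (i + 1) with hy
  have hy0 : 0 < y := G.face_pos (by omega)
  have q1 := (G.meanSq_bounds (i := i) (by omega)).1.trans (G.harmSq_bounds hi).1
  have q2 := (G.harmSq_bounds hi).2.trans (G.meanSq_bounds (i := i + 1) (by omega)).2.2.1
  have f2 := hG.face_succ_le hc hi
  have f2X := (G.face_mem (i := i + 2) (by omega)).2
  have f2p := G.face_pos (i := i + 1) (by omega)
  have f0 := (G.face_mem (i := i) (by omega)).1
  have f1 := G.face_add_len i
  have f3 := G.face_add_len (i + 1)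
  have l0 := G.len_le_h (i := i) (by omega)
  have l1 := G.len_le_h (i := i + 1) (by omega)
  have l0p := G.len_pos (i := i) (by omega)
  have l1p := G.len_pos (i := i + 1) (by omega)
  rw [← hy] at f1 f2 f3
  have hd := G.dil_sub_one_mul
  have hd1 := G.one_le_dil
  have qpos : 0 ≤ G.harmSq i := (sq_nonneg _).trans q1
  have t1 : |(G.dil - 1) * G.harmSq i| ≤ (1 + c) * G.h * y := by
    rw [abs_of_nonneg (mul_nonneg (by linarith) qpos)]
    have e1 : G.harmSq i ≤ X * ((1 + c) * y) := by
      refine q2.trans ?_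
      rw [sq]
      exact mul_le_mul f2X f2 f2p.le hX.le
    calc (G.dil - 1) * G.harmSq i ≤ (G.dil - 1) * (X * ((1 + c) * y)) :=
          mul_le_mul_of_nonneg_left e1 (by linarith)
      _ = ((G.dil - 1) * X) * ((1 + c) * y) := by ring
      _ ≤ G.h * ((1 + c) * y) := mul_le_mul_of_nonneg_right hd (by positivity)
      _ = _ := by ring
  have t2 : |G.harmSq i - y ^ 2| ≤ (2 + c) * G.h * y := by
    rw [abs_le]
    constructor
    · have e : y ^ 2 - G.face i ^ 2 = G.len i * (y + G.face i) := by rw [f1]; ring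
      have e2 : G.len i * (y + G.face i) ≤ G.h * (2 * y) :=
        mul_le_mul l0 (by linarith) (by linarith) hh.le
      have : 0 ≤ c * G.h * y := by positivity
      linarith
    · have e : G.face (i + 2) ^ 2 - y ^ 2 = G.len (i + 1) * (G.face (i + 2) + y) := by
        rw [show i + 2 = i + 1 + 1 from rfl, f3]; ring
      have e2 : G.len (i + 1) * (G.face (i + 2) + y) ≤ G.h * ((1 + c) * y + y) :=
        mul_le_mul l1 (by linarith) (by linarith) hh.le
      have q2' : G.harmSq i ≤ G.face (i + 2) ^ 2 := q2
      linarith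
  have t3 : |y ^ 2 - x ^ 2| ≤ (6 * c + 9) * G.h * y := by
    have n1 := hG.node_succ_le hc hi
    have n2 := G.node_sub_lo_le hi
    have n3 := G.lo_le_face (i := i) (by omega)
    have n4 := G.face_le_node hi
    have n5 := G.lo_nonneg (i := i) (by omega)
    rw [← hy] at n1 n3 n4
    have e1 : |y - x| ≤ 3 * G.h := by
      rw [abs_le]; constructor <;> linarith [hx.1, hx.2]
    have e2 : |y + x| ≤ (2 * c + 3) * y := by
      rw [abs_of_nonneg (by linarith [hx.1])]
      linarith [hx.2]
    have e3 : y ^ 2 - x ^ 2 = (y - x) * (y + x) := by ring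
    rw [e3, abs_mul]
    calc |y - x| * |y + x| ≤ (3 * G.h) * ((2 * c + 3) * y) :=
          mul_le_mul e1 e2 (abs_nonneg _) (by positivity)
      _ = _ := by ring
  have e : G.dil * G.harmSq i - x ^ 2 =
      (G.dil - 1) * G.harmSq i + (G.harmSq i - y ^ 2) + (y ^ 2 - x ^ 2) := by ring
  rw [e]
  refine (abs_add_three _ _ _).trans ?_
  linarith

/-- The diffusive flux is consistent at the comparison points. -/
theorem abs_diffusion_error_le {c : ℝ} (hc : 0 < c) (hG : G.QuasiUniform c) {du dw : ℝ → ℝ}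
    (hdu : MemLp du 2 (dom X)) (hdw : MemLp dw 2 (dom X))
    (hw : ∀ᵐ x ∂dom X, x ^ 2 * du x = ∫ y in 0..x, dw y) {i : ℕ} (h1 : 1 ≤ i) (hi : i ≤ G.N) :
    |2 * G.harmSq i / G.len₂ i * (∫ x in G.node i..G.node (i + 1), du x) -
        ∫ y in 0..G.face (i + 1), dw y| ≤
      (16 * c + 24) * G.h * (G.face (i + 1) / G.len₂ i) *
        (∫ x in G.node i..G.node (i + 1), |du x|) + G.osc dw i := by
  have hL := G.len₂_pos hi
  have hd1 := G.one_le_dil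
  have hd0 : 0 < G.dil := by linarith
  have hh := G.h_pos
  have hy0 := G.face_pos (i := i) (by omega)
  have m1 := G.node_mem (i := i) (by omega)
  have m2 := G.node_mem (i := i + 1) (by omega)
  have hle := G.node_le_succ hi
  have m0 : (0 : ℝ) ∈ Icc 0 X := ⟨le_rfl, m1.1.trans m1.2⟩
  have idu := MemLp.intervalIntegrable_dom hdu m1 m2
  set w₀ := ∫ y in 0..G.face (i + 1), dw y with hw₀
  set lam := G.dil
  set q := G.harmSq i
  set L := G.len₂ i
  have hlen : G.node (i + 1) - G.node i = lam * (L / 2) := G.node_succ_sub h1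
  -- Because the node spacing is lam · L / 2, the constant w₀ can be put under the integral exactly;
  -- lam then multiplies q, which is why the preceding estimate concerns the dilated mean.
  have e1 : 2 * q / L * (∫ x in G.node i..G.node (i + 1), du x) - w₀ =
      2 / (lam * L) * ∫ x in G.node i..G.node (i + 1), (lam * q * du x - w₀) := by
    rw [intervalIntegral.integral_sub (idu.const_mul _) intervalIntegrable_const,
      intervalIntegral.integral_const_mul, intervalIntegral.integral_const, smul_eq_mul, hlen]
    field_simp
  have cw : ContinuousOn (fun x => ∫ y in 0..x, dw y) (uIcc (G.node i) (G.node (i + 1))) :=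
    (MemLp.continuousOn_primitive_dom hdw).mono (uIcc_subset_Icc m1 m2)
  have e2 : ∫ x in G.node i..G.node (i + 1), (lam * q * du x - w₀) =
      ∫ x in G.node i..G.node (i + 1), ((lam * q - x ^ 2) * du x +
        ((∫ y in 0..x, dw y) - w₀)) := by
    refine intervalIntegral_congr_dom ?_ m1 m2
    filter_upwards [hw] with x hx
    rw [← hx]; ring
  have i1 : IntervalIntegrable (fun x => (lam * q - x ^ 2) * du x) volume
      (G.node i) (G.node (i + 1)) := idu.continuousOn_mul (by fun_prop)
  have i2 : IntervalIntegrable (fun x => (∫ y in 0..x, dw y) - w₀) volume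
      (G.node i) (G.node (i + 1)) := (cw.sub continuousOn_const).intervalIntegrable
  have iabs := MemLp.intervalIntegrable_dom (memLp_abs hdu) m1 m2
  have e3 : |∫ x in G.node i..G.node (i + 1), ((lam * q - x ^ 2) * du x +
        ((∫ y in 0..x, dw y) - w₀))| ≤
      ∫ x in G.node i..G.node (i + 1), ((8 * c + 12) * G.h * G.face (i + 1) * |du x| +
        G.osc dw i) := by
    refine (intervalIntegral.abs_integral_le_integral_abs hle).trans ?_
    refine intervalIntegral.integral_mono_on hle (i1.add i2).abs
      ((iabs.const_mul _).add intervalIntegrable_const) fun x hx => ?_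
    have hxJ : x ∈ Icc (G.lo i) (G.node (i + 1)) :=
      ⟨(G.lo_le_node (by omega)).trans hx.1, hx.2⟩
    refine (abs_add_le _ _).trans (add_le_add ?_ ?_)
    · rw [abs_mul]
      exact mul_le_mul_of_nonneg_right (G.abs_dil_mul_harmSq_sub_le hc hG hi hxJ) (abs_nonneg _)
    · exact G.abs_sub_le_osc hdw hi hxJ ⟨G.lo_le_face (by omega), G.face_le_node hi⟩
  rw [intervalIntegral.integral_add (iabs.const_mul _) intervalIntegrable_const,
    intervalIntegral.integral_const_mul, intervalIntegral.integral_const, smul_eq_mul, hlen] at e3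
  set E := ∫ x in G.node i..G.node (i + 1), |du x|
  have hE : 0 ≤ E := intervalIntegral.integral_nonneg hle fun _ _ => abs_nonneg _
  rw [e1, e2, abs_mul, abs_of_pos (by positivity : 0 < 2 / (lam * L))]
  refine (mul_le_mul_of_nonneg_left e3 (by positivity)).trans ?_
  have e4 : 2 / (lam * L) * ((8 * c + 12) * G.h * G.face (i + 1) * E + lam * (L / 2) * G.osc dw i) =
      (16 * c + 24) * G.h * (G.face (i + 1) / L) * E / lam + G.osc dw i := by
    field_simp; ring
  rw [e4]
  refine add_le_add (div_le_self ?_ hd1) le_rfl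
  positivity

end SpaceMesh

/-! ### Consistency of the fluxes -/

/-- Either choice is a combination of the two neighbours with coefficients of sum b and absolute sum
|b|. Consistency therefore does not see the upwind direction; only stability does. -/
theorem FaceValue.abs_eval_sub_le (fv : FaceValue) {b o v : ℝ} {w : ℕ → ℝ} {i : ℕ}
    (h1 : |w i - v| ≤ o) (h2 : |w (i + 1) - v| ≤ o) : |fv.eval b w i - b * v| ≤ |b| * o := by
  have hb : b = max b 0 + min b 0 := by rw [max_add_min, add_zero]
  have hp : 0 ≤ max b 0 := le_max_right _ _
  have hm : min b 0 ≤ 0 := min_le_right _ _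
  have habs : |b| = max b 0 - min b 0 := by
    rcases le_total 0 b with h | h
    · rw [max_eq_left h, min_eq_right h, abs_of_nonneg h, sub_zero]
    · rw [max_eq_right h, min_eq_left h, abs_of_nonpos h, zero_sub]
  have key : ∀ p q : ℝ, |p| ≤ o → |q| ≤ o → |max b 0 * p + min b 0 * q| ≤ |b| * o := by
    intro p q hp' hq'
    refine (abs_add_le _ _).trans ?_
    rw [abs_mul, abs_mul, abs_of_nonneg hp, abs_of_nonpos hm, habs]
    have k1 := mul_le_mul_of_nonneg_left hp' hp
    have k2 := mul_le_mul_of_nonneg_left hq' (neg_nonneg.2 hm)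
    linarith
  cases fv with
  | upwind =>
    have e : FaceValue.eval .upwind b w i - b * v =
        max b 0 * (w (i + 1) - v) + min b 0 * (w i - v) := by
      simp only [FaceValue.eval]; linear_combination (-v) * hb
    rw [e]; exact key _ _ h2 h1
  | reversed =>
    have e : FaceValue.eval .reversed b w i - b * v =
        max b 0 * (w i - v) + min b 0 * (w (i + 1) - v) := by
      simp only [FaceValue.eval]; linear_combination (-v) * hb
    rw [e]; exact key _ _ h1 h2

theorem discFlux_of_pos {X : ℝ} (G : SpaceMesh X) (meth : Method) (fv : FaceValue) (r σ : ℝ → ℝ)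
    (t : ℝ) (w : ℕ → ℝ) {i : ℕ} (hi : 1 ≤ i) :
    discFlux G meth fv r σ t w i =
      -(G.trans σ t i * (w (i + 1) - w i)) - G.face (i + 1) * fv.eval (coefB r σ t) w i := by
  obtain ⟨j, rfl⟩ : ∃ j, i = j + 1 := ⟨i - 1, by omega⟩
  cases meth <;> rfl

section FluxError

variable {X : ℝ} (G : SpaceMesh X) {c : ℝ} {u du dw : ℝ → ℝ} {r σ : ℝ → ℝ} {t a b A ε : ℝ}

/-- The flux error at `x_{i+1/2}`: discrete flux of the comparison values minus exact flux. -/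
def fluxError (G : SpaceMesh X) (meth : Method) (fv : FaceValue) (r σ : ℝ → ℝ) (t a b : ℝ)
    (u dw : ℝ → ℝ) (i : ℕ) : ℝ :=
  discFlux G meth fv r σ t (fun j => u (G.node j)) i +
    a * (∫ y in 0..G.face (i + 1), dw y) + b * G.face (i + 1) * u (G.face (i + 1))

/-- The four contributions are the coefficients taken at another time (ε, twice), the diffusion
error and the face value. The exact flux carries the coefficients a, b of its own time, the discrete
flux those of t. -/
theorem abs_fluxError_le (hc : 0 < c) (hG : G.QuasiUniform c) (hdu : MemLp du 2 (dom X))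
    (hdw : MemLp dw 2 (dom X)) (hu : ∀ x ∈ Icc 0 X, u x = ∫ y in 0..x, du y)
    (hw : ∀ᵐ x ∂dom X, x ^ 2 * du x = ∫ y in 0..x, dw y)
    (hbt : |coefB r σ t| ≤ A) (ha : |a| ≤ A)
    (hεa : |coefA σ t - a| ≤ ε) (hεb : |coefB r σ t - b| ≤ ε) (meth : Method) (fv : FaceValue)
    {i : ℕ} (h1 : 1 ≤ i) (hi : i ≤ G.N) :
    |fluxError G meth fv r σ t a b u dw i| ≤
      (A * (16 * c + 24) + 2 * (1 + c) ^ 2 * X) * (G.h + ε) * (G.face (i + 1) / G.len₂ i) *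
        (∫ x in G.node i..G.node (i + 1), |du x|) + A * G.osc dw i +
      A * G.face (i + 1) * G.osc du i + ε * G.face (i + 1) * |u (G.face (i + 1))| := by
  have hA : 0 ≤ A := (abs_nonneg _).trans ha
  have hε : 0 ≤ ε := (abs_nonneg _).trans hεa
  have hX := G.X_pos
  have hh := G.h_pos
  have hL := G.len₂_pos hi
  have m1 := G.node_mem (i := i) (by omega)
  have m2 := G.node_mem (i := i + 1) (by omega)
  have mf := G.face_mem (i := i + 1) (by omega)
  have m0 : (0 : ℝ) ∈ Icc 0 X := ⟨le_rfl, hX.le⟩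
  have hle := G.node_le_succ hi
  have hD := G.abs_diffusion_error_le hc hG hdu hdw hw h1 hi
  have hJf : G.face (i + 1) ∈ Icc (G.lo i) (G.node (i + 1)) :=
    ⟨G.lo_le_face (by omega), G.face_le_node hi⟩
  have hB := fv.abs_eval_sub_le (b := coefB r σ t) (w := fun j => u (G.node j)) (i := i)
    (v := u (G.face (i + 1))) (o := G.osc du i)
    (by
      rw [hu _ m1, hu _ mf]
      exact G.abs_sub_le_osc hdu hi ⟨G.lo_le_node (by omega), hle⟩ hJf)
    (by
      rw [hu _ m2, hu _ mf]
      exact G.abs_sub_le_osc hdu hi ⟨(G.lo_le_node (by omega)).trans hle, le_rfl⟩ hJf)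
  have hq := G.harmSq_le hc hG hi
  have hq0 : 0 ≤ G.harmSq i :=
    (G.meanSq_bounds (i := i) (by omega)).2.2.2.le.trans (G.harmSq_bounds hi).1
  have hy0 := G.face_pos (i := i) (by omega)
  have hdiff : u (G.node (i + 1)) - u (G.node i) = ∫ x in G.node i..G.node (i + 1), du x := by
    rw [hu _ m1, hu _ m2, intervalIntegral.integral_interval_sub_left
      (MemLp.intervalIntegrable_dom hdu m0 m2) (MemLp.intervalIntegrable_dom hdu m0 m1)]
  rw [fluxError, discFlux_of_pos G meth fv r σ t _ h1, G.trans_eq σ t hi, hdiff]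
  set I := ∫ x in G.node i..G.node (i + 1), du x
  set E := ∫ x in G.node i..G.node (i + 1), |du x|
  have hIE : |I| ≤ E := intervalIntegral.abs_integral_le_integral_abs hle
  have hE : 0 ≤ E := (abs_nonneg _).trans hIE
  set y := G.face (i + 1)
  set L := G.len₂ i
  set q := G.harmSq i
  set w₀ := ∫ s in 0..y, dw s
  set B := fv.eval (coefB r σ t) (fun j => u (G.node j)) i
  have e : -(coefA σ t * (2 * q / L) * I) - y * B + a * w₀ + b * y * u y =
      -((coefA σ t - a) * (2 * q / L * I)) + -(a * (2 * q / L * I - w₀)) +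
        -(y * (B - coefB r σ t * u y)) + -((coefB r σ t - b) * (y * u y)) := by ring
  rw [e]
  have s1 : |(coefA σ t - a) * (2 * q / L * I)| ≤ ε * (2 * (1 + c) ^ 2 * X * (y / L) * E) := by
    rw [abs_mul]
    refine mul_le_mul hεa ?_ (abs_nonneg _) hε
    rw [abs_mul, abs_of_nonneg (by positivity)]
    refine mul_le_mul ?_ hIE (abs_nonneg _) (by positivity)
    rw [mul_div_assoc', div_le_div_iff_of_pos_right hL]
    have : (1 + c) ^ 2 * y ^ 2 ≤ (1 + c) ^ 2 * (X * y) := by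
      refine mul_le_mul_of_nonneg_left ?_ (by positivity)
      rw [sq]; exact mul_le_mul_of_nonneg_right mf.2 hy0.le
    linarith
  have s2 : |a * (2 * q / L * I - w₀)| ≤
      A * ((16 * c + 24) * G.h * (y / L) * E + G.osc dw i) := by
    rw [abs_mul]
    exact mul_le_mul ha hD (abs_nonneg _) hA
  have s3 : |y * (B - coefB r σ t * u y)| ≤ y * (A * G.osc du i) := by
    rw [abs_mul, abs_of_pos hy0]
    exact mul_le_mul_of_nonneg_left
      (hB.trans (mul_le_mul_of_nonneg_right hbt (G.osc_nonneg hi))) hy0.le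
  have s4 : |(coefB r σ t - b) * (y * u y)| ≤ ε * (y * |u y|) := by
    rw [abs_mul, abs_mul y, abs_of_pos hy0]
    exact mul_le_mul_of_nonneg_right hεb (by positivity)
  -- Nonnegative cross terms, added so that the two contributions of order ε and h share the factor
  -- h + ε.
  have hextra : 0 ≤ A * (16 * c + 24) * ε * (y / L) * E +
      2 * (1 + c) ^ 2 * X * G.h * (y / L) * E := by
    positivity
  have := abs_add_le (-((coefA σ t - a) * (2 * q / L * I)) + -(a * (2 * q / L * I - w₀)) +
        -(y * (B - coefB r σ t * u y))) (-((coefB r σ t - b) * (y * u y)))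
  have := abs_add_three (-((coefA σ t - a) * (2 * q / L * I))) (-(a * (2 * q / L * I - w₀)))
        (-(y * (B - coefB r σ t * u y)))
  simp only [abs_neg] at *
  linarith

/-- No cancellation is used: u vanishes at 0, so every term is bounded on its own by x_{1/2} times
the variation of u, or by the small value of w at the face. This is why either first flux is
acceptable. -/
theorem abs_fluxError_zero_le (hc : 0 < c) (hG : G.QuasiUniform c) (hdu : MemLp du 2 (dom X))
    (hu : ∀ x ∈ Icc 0 X, u x = ∫ y in 0..x, du y)
    (hat : |coefA σ t| ≤ A) (hbt : |coefB r σ t| ≤ A) (ha : |a| ≤ A) (hb : |b| ≤ A)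
    (meth : Method) (fv : FaceValue) :
    |fluxError G meth fv r σ t a b u dw 0| ≤
      A * (2 * (1 + c) ^ 2 + 2) * G.face 1 * G.osc du 0 +
        A * |∫ y in 0..G.face 1, dw y| := by
  have hA : 0 ≤ A := (abs_nonneg _).trans ha
  have hX := G.X_pos
  have hL := G.len₂_pos (Nat.zero_le _)
  have m0 : (0 : ℝ) ∈ Icc 0 X := ⟨le_rfl, hX.le⟩
  have m2 := G.node_mem (i := 1) (by omega)
  have mf := G.face_mem (i := 1) (by omega)
  have hy0 : 0 < G.face 1 := G.face_pos (i := 0) (by omega)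
  have hlo : G.lo 0 = 0 := by simp [SpaceMesh.lo]
  have hJ : ∀ z ∈ Icc 0 (G.node 1), |u z| ≤ G.osc du 0 := by
    intro z hz
    have := G.abs_sub_le_osc hdu (Nat.zero_le _) (z := z) (z' := 0) (by rw [hlo]; exact hz)
      (by rw [hlo]; exact ⟨le_rfl, m2.1⟩)
    rw [intervalIntegral.integral_same, sub_zero] at this
    rwa [hu z ⟨hz.1, hz.2.trans m2.2⟩]
  have hu1 : |u (G.node 1)| ≤ G.osc du 0 := hJ _ ⟨m2.1, le_rfl⟩
  have huf : |u (G.face 1)| ≤ G.osc du 0 := hJ _ ⟨hy0.le, G.face_le_node (Nat.zero_le _)⟩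
  have hu0 : u (G.node 0) = 0 := by rw [G.node_zero, hu 0 m0, intervalIntegral.integral_same]
  have ho : 0 ≤ G.osc du 0 := (abs_nonneg _).trans hu1
  have hflux : |discFlux G meth fv r σ t (fun j => u (G.node j)) 0| ≤
      A * (2 * (1 + c) ^ 2 + 1) * G.face 1 * G.osc du 0 := by
    have htp : |-(G.trans σ t 0 * (u (G.node 1) - u (G.node 0))) -
        G.face 1 * fv.eval (coefB r σ t) (fun j => u (G.node j)) 0| ≤
        A * (2 * (1 + c) ^ 2 + 1) * G.face 1 * G.osc du 0 := by
      have hB := fv.abs_eval_sub_le (b := coefB r σ t) (w := fun j => u (G.node j)) (i := 0)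
        (v := 0) (o := G.osc du 0) (by simpa [hu0] using ho) (by simpa using hu1)
      rw [mul_zero, sub_zero] at hB
      have hq := G.harmSq_le hc hG (Nat.zero_le _)
      have hq0 : 0 ≤ G.harmSq 0 :=
        (G.meanSq_bounds (i := 0) (by omega)).2.2.2.le.trans (G.harmSq_bounds (Nat.zero_le _)).1
      have hyL : G.face 1 ≤ G.len₂ 0 := by
        have := G.len_pos (i := 1) (by omega)
        have e := G.face_add_len 0
        rw [G.face_zero, zero_add, zero_add] at e
        rw [SpaceMesh.len₂, e]; linarith
      rw [G.trans_eq σ t (Nat.zero_le _), hu0, sub_zero]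
      have k1 : |coefA σ t * (2 * G.harmSq 0 / G.len₂ 0) * u (G.node 1)| ≤
          A * (2 * (1 + c) ^ 2 * G.face 1) * G.osc du 0 := by
        rw [abs_mul, abs_mul, abs_of_nonneg (by positivity : 0 ≤ 2 * G.harmSq 0 / G.len₂ 0)]
        refine mul_le_mul (mul_le_mul hat ?_ (by positivity) hA) hu1 (abs_nonneg _)
          (by positivity)
        rw [div_le_iff₀ hL]
        have : (1 + c) ^ 2 * G.face 1 ^ 2 ≤ (1 + c) ^ 2 * (G.face 1 * G.len₂ 0) := by
          refine mul_le_mul_of_nonneg_left ?_ (by positivity)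
          rw [sq]; exact mul_le_mul_of_nonneg_left hyL hy0.le
        rw [zero_add] at hq
        linarith
      have k2 : |G.face 1 * fv.eval (coefB r σ t) (fun j => u (G.node j)) 0| ≤
          G.face 1 * (A * G.osc du 0) := by
        rw [abs_mul, abs_of_pos hy0]
        exact mul_le_mul_of_nonneg_left
          (hB.trans (mul_le_mul_of_nonneg_right hbt ho)) hy0.le
      have := abs_sub (-(coefA σ t * (2 * G.harmSq 0 / G.len₂ 0) * u (G.node 1)))
        (G.face 1 * fv.eval (coefB r σ t) (fun j => u (G.node j)) 0)
      rw [abs_neg] at this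
      linarith
    cases meth with
    | tpfa => exact htp
    | fitted =>
      have e : G.x 1 = 2 * G.face 1 := by
        have := G.face_succ (i := 0) (Nat.zero_le _)
        rw [zero_add, G.x_zero] at this
        linarith
      have e2 : discFlux G .fitted fv r σ t (fun j => u (G.node j)) 0 =
          -(1 / 2 * G.face 1 * ((coefA σ t + coefB r σ t) * u (G.node 1))) := by
        simp only [discFlux, e]; ring
      rw [e2, abs_neg, abs_mul, abs_mul (coefA σ t + coefB r σ t),
        abs_of_pos (by positivity : 0 < 1 / 2 * G.face 1)]
      have k1 : |coefA σ t + coefB r σ t| ≤ 2 * A := (abs_add_le _ _).trans (by linarith)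
      have k2 := mul_le_mul k1 hu1 (abs_nonneg _) (by positivity)
      have k3 := mul_le_mul_of_nonneg_left k2 (by positivity : 0 ≤ 1 / 2 * G.face 1)
      have : 0 ≤ A * (2 * (1 + c) ^ 2) * G.face 1 * G.osc du 0 := by positivity
      linarith
  rw [fluxError, zero_add]
  have s1 : |a * ∫ y in 0..G.face 1, dw y| ≤ A * |∫ y in 0..G.face 1, dw y| := by
    rw [abs_mul]; exact mul_le_mul_of_nonneg_right ha (abs_nonneg _)
  have s2 : |b * G.face 1 * u (G.face 1)| ≤ A * G.face 1 * G.osc du 0 := by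
    rw [abs_mul, abs_mul, abs_of_pos hy0]
    exact mul_le_mul (mul_le_mul_of_nonneg_right hb hy0.le) huf (abs_nonneg _) (by positivity)
  refine (abs_add_three _ _ _).trans ?_
  linarith

theorem sq_add_four_le (p q r s : ℝ) :
    (p + q + r + s) ^ 2 ≤ 4 * (p ^ 2 + q ^ 2 + r ^ 2 + s ^ 2) := by
  nlinarith [sq_nonneg (p - q), sq_nonneg (p - r), sq_nonneg (p - s), sq_nonneg (q - r),
    sq_nonneg (q - s), sq_nonneg (r - s)]

/-- The sum is the square of the norm dual to `energySq`. Terms containing u' give (h + ε)², and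
terms containing w' give the weighted integral to which Hardy's inequality is applied later. -/
theorem sum_fluxError_sq_le (hc : 0 < c) (hG : G.QuasiUniform c) (hdu : MemLp du 2 (dom X))
    (hdw : MemLp dw 2 (dom X)) (hu : ∀ x ∈ Icc 0 X, u x = ∫ y in 0..x, du y)
    (hw : ∀ᵐ x ∂dom X, x ^ 2 * du x = ∫ y in 0..x, dw y)
    (hat : |coefA σ t| ≤ A) (hbt : |coefB r σ t| ≤ A) (ha : |a| ≤ A) (hb : |b| ≤ A)
    (hεa : |coefA σ t - a| ≤ ε) (hεb : |coefB r σ t - b| ≤ ε) (meth : Method) (fv : FaceValue) :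
    ∑ i ∈ Finset.range (G.N + 1), G.len₂ i / G.face (i + 1) ^ 2 *
        fluxError G meth fv r σ t a b u dw i ^ 2 ≤
      (4 * (A * (16 * c + 24) + 2 * (1 + c) ^ 2 * X) ^ 2 + 168 * A ^ 2 + 8 * X ^ 2 +
          84 * (A * (2 * (1 + c) ^ 2 + 2)) ^ 2) * (G.h + ε) ^ 2 * (∫ x in 0..X, du x ^ 2) +
        (144 * A ^ 2 * (2 * (1 + c)) ^ 3 + 2 * A ^ 2 * (1 + c)) *
          ∫ x in 0..X, weight G.h x * dw x ^ 2 := by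
  have hA : 0 ≤ A := (abs_nonneg _).trans ha
  have hε : 0 ≤ ε := (abs_nonneg _).trans hεa
  have hX := G.X_pos
  have hh := G.h_pos
  have m0 : (0 : ℝ) ∈ Icc 0 X := ⟨le_rfl, hX.le⟩
  have mX : X ∈ Icc 0 X := ⟨hX.le, le_rfl⟩
  set I := ∫ x in 0..X, du x ^ 2 with hI
  have hI0 : 0 ≤ I := intervalIntegral.integral_nonneg hX.le fun _ _ => sq_nonneg _
  set Wt := ∫ x in 0..X, weight G.h x * dw x ^ 2 with hWt
  set C₃ := A * (16 * c + 24) + 2 * (1 + c) ^ 2 * X with hC₃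
  set C₅ := A * (2 * (1 + c) ^ 2 + 2) with hC₅
  have hosc := G.sum_len₂_mul_osc_sq_le hdu
  rw [← hI] at hosc
  have hosc_nn : ∀ i ≤ G.N, 0 ≤ G.len₂ i * G.osc du i ^ 2 := fun i hi =>
    mul_nonneg (G.len₂_pos hi).le (sq_nonneg _)
  -- the first face
  have hzero : G.len₂ 0 / G.face 1 ^ 2 * fluxError G meth fv r σ t a b u dw 0 ^ 2 ≤
      2 * C₅ ^ 2 * (G.len₂ 0 * G.osc du 0 ^ 2) + 2 * A ^ 2 * (1 + c) * Wt := by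
    have hy0 : 0 < G.face 1 := G.face_pos (i := 0) (by omega)
    have hL := G.len₂_pos (Nat.zero_le _)
    have k1 := abs_fluxError_zero_le G hc hG hdu hu hat hbt ha hb (dw := dw) meth fv
    have k2 : fluxError G meth fv r σ t a b u dw 0 ^ 2 ≤
        2 * (C₅ * G.face 1 * G.osc du 0) ^ 2 + 2 * A ^ 2 * (∫ y in 0..G.face 1, dw y) ^ 2 := by
      rw [← sq_abs]
      refine (pow_le_pow_left₀ (abs_nonneg _) k1 2).trans ?_
      rw [← sq_abs (∫ y in 0..G.face 1, dw y)]
      nlinarith [sq_nonneg (C₅ * G.face 1 * G.osc du 0 - A * |∫ y in 0..G.face 1, dw y|)]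
    have mf := G.face_mem (i := 1) (by omega)
    have k3 := sq_integral_le hy0.le (MemLp.intervalIntegrable_dom hdw m0 mf)
      (MemLp.intervalIntegrable_sq_dom hdw m0 mf)
    have hyh : G.face 1 ≤ G.h := by
      have := G.len_le_h (i := 0) (by omega)
      have e := G.face_add_len 0
      rw [G.face_zero, zero_add, zero_add] at e
      rwa [e]
    -- The first cell lies in [0, h], where the weight equals 1.
    have k4 : ∫ y in 0..G.face 1, dw y ^ 2 ≤ Wt := by
      have e : ∫ y in 0..G.face 1, dw y ^ 2 = ∫ y in 0..G.face 1, weight G.h y * dw y ^ 2 := by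
        refine intervalIntegral.integral_congr fun y hy => ?_
        rw [uIcc_of_le hy0.le] at hy
        rw [weight_eq_one hh (hy.2.trans hyh), one_mul]
      rw [e]
      exact intervalIntegral.integral_mono_interval le_rfl hy0.le mf.2
        (Eventually.of_forall fun x => mul_nonneg (weight_nonneg _ _) (sq_nonneg _))
        (SpaceMesh.intervalIntegrable_weight_mul_sq hX hh hdw)
    have k5 : G.len₂ 0 ≤ (1 + c) * G.face 1 := by
      have := (hG.len₂_le hc (Nat.zero_le _)).1
      have e := G.face_add_len 0
      rw [G.face_zero, zero_add, zero_add] at e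
      rwa [e]
    have hWt0 : 0 ≤ Wt := le_trans
      (intervalIntegral.integral_nonneg hy0.le fun _ _ => sq_nonneg _) k4
    have k6 : (∫ y in 0..G.face 1, dw y) ^ 2 ≤ G.face 1 * Wt := by
      rw [sub_zero] at k3
      exact k3.trans (mul_le_mul_of_nonneg_left k4 hy0.le)
    have k7 : G.len₂ 0 / G.face 1 ^ 2 * (∫ y in 0..G.face 1, dw y) ^ 2 ≤ (1 + c) * Wt := by
      rw [div_mul_eq_mul_div, div_le_iff₀ (by positivity)]
      calc G.len₂ 0 * (∫ y in 0..G.face 1, dw y) ^ 2 ≤ ((1 + c) * G.face 1) * (G.face 1 * Wt) :=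
            mul_le_mul k5 k6 (sq_nonneg _) (by positivity)
        _ = _ := by ring
    calc G.len₂ 0 / G.face 1 ^ 2 * fluxError G meth fv r σ t a b u dw 0 ^ 2
        ≤ G.len₂ 0 / G.face 1 ^ 2 * (2 * (C₅ * G.face 1 * G.osc du 0) ^ 2 +
            2 * A ^ 2 * (∫ y in 0..G.face 1, dw y) ^ 2) :=
          mul_le_mul_of_nonneg_left k2 (by positivity)
      _ = 2 * C₅ ^ 2 * (G.len₂ 0 * G.osc du 0 ^ 2) +
            2 * A ^ 2 * (G.len₂ 0 / G.face 1 ^ 2 * (∫ y in 0..G.face 1, dw y) ^ 2) := by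
          field_simp
      _ ≤ _ := by
          have := mul_le_mul_of_nonneg_left k7 (by positivity : 0 ≤ 2 * A ^ 2)
          linarith
  -- the other faces
  have hpos : ∀ i ∈ Finset.Icc 1 G.N, G.len₂ i / G.face (i + 1) ^ 2 *
      fluxError G meth fv r σ t a b u dw i ^ 2 ≤
      4 * C₃ ^ 2 * (G.h + ε) ^ 2 * (∫ x in G.node i..G.node (i + 1), du x ^ 2) +
      4 * A ^ 2 * (G.len₂ i / G.face (i + 1) ^ 2 * G.osc dw i ^ 2) +
      4 * A ^ 2 * (G.len₂ i * G.osc du i ^ 2) + 4 * ε ^ 2 * (X * I) * G.len₂ i := by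
    intro i hi
    obtain ⟨h1, hiN⟩ := Finset.mem_Icc.1 hi
    have hy0 := G.face_pos (i := i) (by omega)
    have hL := G.len₂_pos hiN
    have m1 := G.node_mem (i := i) (by omega)
    have m2 := G.node_mem (i := i + 1) (by omega)
    have mf := G.face_mem (i := i + 1) (by omega)
    have hle := G.node_le_succ hiN
    have k1 := abs_fluxError_le G hc hG hdu hdw hu hw hbt ha hεa hεb meth fv h1 hiN
    set E := ∫ x in G.node i..G.node (i + 1), |du x| with hE
    set e := ∫ x in G.node i..G.node (i + 1), du x ^ 2 with he
    have he0 : 0 ≤ e := intervalIntegral.integral_nonneg hle fun _ _ => sq_nonneg _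
    set y := G.face (i + 1)
    set L := G.len₂ i
    -- The interval has length dil · L / 2, and the dilation factor is below 2.
    have k2 : E ^ 2 ≤ L * e := by
      have := sq_integral_le hle (MemLp.intervalIntegrable_dom (SpaceMesh.memLp_abs hdu) m1 m2)
        (MemLp.intervalIntegrable_sq_dom (SpaceMesh.memLp_abs hdu) m1 m2)
      simp only [sq_abs] at this
      rw [G.node_succ_sub h1] at this
      refine this.trans (mul_le_mul_of_nonneg_right ?_ he0)
      have := G.dil_le
      change G.dil * (L / 2) ≤ L
      nlinarith
    have k3 : |u y| ^ 2 ≤ X * I := by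
      rw [sq_abs, hu y mf]
      have := sq_integral_le mf.1 (MemLp.intervalIntegrable_dom hdu m0 mf)
        (MemLp.intervalIntegrable_sq_dom hdu m0 mf)
      refine this.trans ?_
      rw [sub_zero]
      exact mul_le_mul mf.2 (SpaceMesh.integral_sq_le_of_mem hdu m0 mf mf.1)
        (intervalIntegral.integral_nonneg mf.1 fun _ _ => sq_nonneg _) hX.le
    have k4 : fluxError G meth fv r σ t a b u dw i ^ 2 ≤
        4 * ((C₃ * (G.h + ε) * (y / L) * E) ^ 2 + (A * G.osc dw i) ^ 2 +
          (A * y * G.osc du i) ^ 2 + (ε * y * |u y|) ^ 2) := by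
      rw [← sq_abs]
      exact (pow_le_pow_left₀ (abs_nonneg _) k1 2).trans (sq_add_four_le _ _ _ _)
    calc L / y ^ 2 * fluxError G meth fv r σ t a b u dw i ^ 2
        ≤ L / y ^ 2 * (4 * ((C₃ * (G.h + ε) * (y / L) * E) ^ 2 + (A * G.osc dw i) ^ 2 +
          (A * y * G.osc du i) ^ 2 + (ε * y * |u y|) ^ 2)) :=
          mul_le_mul_of_nonneg_left k4 (by positivity)
      _ = 4 * C₃ ^ 2 * (G.h + ε) ^ 2 * (E ^ 2 / L) + 4 * A ^ 2 * (L / y ^ 2 * G.osc dw i ^ 2) +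
            4 * A ^ 2 * (L * G.osc du i ^ 2) + 4 * ε ^ 2 * |u y| ^ 2 * L := by
          field_simp
      _ ≤ _ := by
          have k5 : E ^ 2 / L ≤ e := by rw [div_le_iff₀ hL]; linarith
          have k6 := mul_le_mul_of_nonneg_left k5
            (by positivity : 0 ≤ 4 * C₃ ^ 2 * (G.h + ε) ^ 2)
          have k7 := mul_le_mul_of_nonneg_right (mul_le_mul_of_nonneg_left k3
            (by positivity : 0 ≤ 4 * ε ^ 2)) hL.le
          linarith
  have hsum := Finset.sum_le_sum hpos
  rw [Finset.sum_add_distrib, Finset.sum_add_distrib, Finset.sum_add_distrib, ← Finset.mul_sum,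
    ← Finset.mul_sum, ← Finset.mul_sum, ← Finset.mul_sum] at hsum
  have hw1 := G.sum_len₂_div_mul_osc_sq_le hc hG hdw
  rw [← hWt] at hw1
  have hnodes : ∑ i ∈ Finset.Icc 1 G.N, ∫ x in G.node i..G.node (i + 1), du x ^ 2 ≤ I := by
    have := intervalIntegral.sum_integral_adjacent_intervals (a := G.node) (n := G.N + 1)
      (f := fun x => du x ^ 2) (μ := volume) fun k hk =>
        MemLp.intervalIntegrable_sq_dom hdu (G.node_mem (by omega)) (G.node_mem (by omega))
    rw [G.node_zero, G.node_last, sum_range_succ_eq_add_Icc] at this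
    have h0 : 0 ≤ ∫ x in G.node 0..G.node (0 + 1), du x ^ 2 :=
      intervalIntegral.integral_nonneg (G.node_le_succ (Nat.zero_le _)) fun _ _ => sq_nonneg _
    linarith
  have hlen := G.sum_len₂_le
  rw [sum_range_succ_eq_add_Icc] at hosc hlen ⊢
  rw [zero_add]
  have hL0 := G.len₂_pos (Nat.zero_le _)
  have hsoscnn : 0 ≤ ∑ i ∈ Finset.Icc 1 G.N, G.len₂ i * G.osc du i ^ 2 :=
    Finset.sum_nonneg fun i hi => hosc_nn i (Finset.mem_Icc.1 hi).2
  have g1 := mul_le_mul_of_nonneg_left hnodes (by positivity : 0 ≤ 4 * C₃ ^ 2 * (G.h + ε) ^ 2)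
  have g2 := mul_le_mul_of_nonneg_left hw1 (by positivity : 0 ≤ 4 * A ^ 2)
  have hhε : G.h ^ 2 ≤ (G.h + ε) ^ 2 := pow_le_pow_left₀ hh.le (by linarith) 2
  have hεh : ε ^ 2 ≤ (G.h + ε) ^ 2 := pow_le_pow_left₀ hε (by linarith) 2
  have hosc1 : ∑ i ∈ Finset.Icc 1 G.N, G.len₂ i * G.osc du i ^ 2 ≤ 42 * (G.h + ε) ^ 2 * I := by
    have := mul_le_mul_of_nonneg_right hhε hI0
    linarith [hosc_nn 0 (Nat.zero_le _)]
  have hosc0 : G.len₂ 0 * G.osc du 0 ^ 2 ≤ 42 * (G.h + ε) ^ 2 * I := by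
    have := mul_le_mul_of_nonneg_right hhε hI0
    linarith
  have g3 := mul_le_mul_of_nonneg_left hosc1 (by positivity : 0 ≤ 4 * A ^ 2)
  have g4 : 4 * ε ^ 2 * (X * I) * ∑ i ∈ Finset.Icc 1 G.N, G.len₂ i ≤
      8 * X ^ 2 * (G.h + ε) ^ 2 * I := by
    have k1 : ∑ i ∈ Finset.Icc 1 G.N, G.len₂ i ≤ 2 * X := by linarith
    have k2 : 0 ≤ ∑ i ∈ Finset.Icc 1 G.N, G.len₂ i :=
      Finset.sum_nonneg fun i hi => (G.len₂_pos (Finset.mem_Icc.1 hi).2).le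
    calc 4 * ε ^ 2 * (X * I) * ∑ i ∈ Finset.Icc 1 G.N, G.len₂ i
        ≤ 4 * (G.h + ε) ^ 2 * (X * I) * (2 * X) := by gcongr
      _ = _ := by ring
  have g5 := mul_le_mul_of_nonneg_left hosc0 (by positivity : 0 ≤ 2 * C₅ ^ 2)
  linarith

end FluxError

/-! ### Consistency of the scheme at a fixed time -/

theorem sum_by_parts (n : ℕ) (F v : ℕ → ℝ) (h0 : v 0 = 0) (h1 : v (n + 1) = 0) :
    ∑ i ∈ Finset.Icc 1 n, (F i - F (i - 1)) * v i =
      -∑ i ∈ Finset.range (n + 1), F i * (v (i + 1) - v i) := by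
  have e1 : ∑ i ∈ Finset.range (n + 1), F i * v i = ∑ i ∈ Finset.Icc 1 n, F i * v i := by
    rw [sum_range_succ_eq_add_Icc (fun i => F i * v i), h0, mul_zero, zero_add]
  have e2 : ∑ i ∈ Finset.range (n + 1), F i * v (i + 1) =
      ∑ i ∈ Finset.Icc 1 n, F (i - 1) * v i := by
    rw [Finset.sum_range_succ, h1, mul_zero, add_zero, Finset.range_eq_Ico]
    exact Finset.sum_Ico_add' (fun i => F (i - 1) * v i) 0 n 1
  simp only [sub_mul, mul_sub, Finset.sum_sub_distrib, e1, e2]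
  ring

theorem sq_add_five_le (p q r s t : ℝ) :
    (p + q + r + s + t) ^ 2 ≤ 5 * (p ^ 2 + q ^ 2 + r ^ 2 + s ^ 2 + t ^ 2) := by
  nlinarith [sq_nonneg (p - q), sq_nonneg (p - r), sq_nonneg (p - s), sq_nonneg (q - r),
    sq_nonneg (q - s), sq_nonneg (r - s), sq_nonneg (p - t), sq_nonneg (q - t),
    sq_nonneg (r - t), sq_nonneg (s - t)]

theorem memLp_of_primitive {X : ℝ} {v dv : ℝ → ℝ} (hdv : MemLp dv 2 (dom X))
    (hv : ∀ x ∈ Icc 0 X, v x = ∫ y in 0..x, dv y) : MemLp v 2 (dom X) :=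
  memLp_dom_of_continuousOn ((MemLp.continuousOn_primitive_dom hdv).congr hv)

namespace Snapshot

variable {X a b c₀ : ℝ} {u du f df p : ℝ → ℝ}

theorem mem_u (S : Snapshot X a b c₀ u du f df p) : MemLp u 2 (dom X) :=
  memLp_of_primitive S.mem_du S.u_eq

theorem mem_f (S : Snapshot X a b c₀ u du f df p) : MemLp f 2 (dom X) :=
  memLp_of_primitive S.mem_df S.f_eq

theorem mem_xdu (S : Snapshot X a b c₀ u du f df p) : MemLp (fun x => x * du x) 2 (dom X) := by
  refine S.mem_du.of_le_mul (c := X) (continuous_id.aestronglyMeasurable.mul S.mem_du.1) ?_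
  filter_upwards [ae_restrict_mem measurableSet_Ioo] with x hx
  rw [norm_mul, Real.norm_of_nonneg hx.1.le]
  exact mul_le_mul_of_nonneg_right hx.2.le (norm_nonneg _)

theorem mem_dw (S : Snapshot X a b c₀ u du f df p) :
    MemLp (fluxDeriv a b c₀ u du f p) 2 (dom X) := by
  have := (((S.mem_p.sub S.mem_f).add (S.mem_u.const_mul (c₀ - b))).sub
    (S.mem_xdu.const_mul b)).const_mul a⁻¹
  refine (memLp_congr_ae (Eventually.of_forall fun x => ?_)).1 this
  simp only [Pi.sub_apply, Pi.add_apply, fluxDeriv]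
  ring

/-- The differential equation integrated over an interval. -/
theorem integral_eq (S : Snapshot X a b c₀ u du f df p) (ha : a ≠ 0) {y z : ℝ}
    (hy : y ∈ Icc 0 X) (hz : z ∈ Icc 0 X) :
    (∫ x in y..z, p x) - (∫ x in y..z, f x) + c₀ * (∫ x in y..z, u x) =
      (a * (∫ x in 0..z, fluxDeriv a b c₀ u du f p x) + b * z * u z) -
      (a * (∫ x in 0..y, fluxDeriv a b c₀ u du f p x) + b * y * u y) := by
  have m0 : (0 : ℝ) ∈ Icc 0 X := ⟨le_rfl, hy.1.trans hy.2⟩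
  -- The derivative of x u in integrated form; it converts the terms with coefficient b into a
  -- difference of convective fluxes.
  have hxu : ∀ z ∈ Icc 0 X, z * u z = (∫ x in 0..z, u x) + ∫ x in 0..z, x * du x := by
    intro z hz
    have e : ∫ x in 0..z, u x = ∫ x in 0..z, ∫ s in 0..x, du s :=
      intervalIntegral.integral_congr fun x hx => S.u_eq x (uIcc_subset_Icc m0 hz hx)
    rw [e, integral_primitive_eq S.mem_du hz, S.u_eq z hz]; ring
  have sub : ∀ {g : ℝ → ℝ}, MemLp g 2 (dom X) →
      (∫ x in 0..z, g x) - (∫ x in 0..y, g x) = ∫ x in y..z, g x := fun hg =>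
    intervalIntegral.integral_interval_sub_left (MemLp.intervalIntegrable_dom hg m0 hz)
      (MemLp.intervalIntegrable_dom hg m0 hy)
  have hI : ∀ {g : ℝ → ℝ}, MemLp g 2 (dom X) → IntervalIntegrable g volume y z :=
    fun hg => MemLp.intervalIntegrable_dom hg hy hz
  have e1 : a * (∫ x in y..z, fluxDeriv a b c₀ u du f p x) = (∫ x in y..z, p x) -
      (∫ x in y..z, f x) + (c₀ - b) * (∫ x in y..z, u x) - b * ∫ x in y..z, x * du x := by
    rw [← intervalIntegral.integral_const_mul, ← intervalIntegral.integral_const_mul,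
      ← intervalIntegral.integral_const_mul, ← intervalIntegral.integral_sub (hI S.mem_p)
      (hI S.mem_f), ← intervalIntegral.integral_add ((hI S.mem_p).sub (hI S.mem_f))
      ((hI S.mem_u).const_mul _), ← intervalIntegral.integral_sub
      (((hI S.mem_p).sub (hI S.mem_f)).add ((hI S.mem_u).const_mul _))
      ((hI S.mem_xdu).const_mul _)]
    refine intervalIntegral.integral_congr fun x _ => ?_
    simp only [fluxDeriv]
    field_simp
  have e2 := sub S.mem_dw
  have e3 := sub S.mem_u
  have e4 := sub S.mem_xdu
  have e5 := hxu z hz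
  have e6 := hxu y hy
  linear_combination (-1) * e1 + (-a) * e2 - b * e3 - b * e4 - b * e5 + b * e6

/-- Each term of the equation is treated by its own means: Hardy for q, f and u, which vanish at 0;
the bound h² on x² times the weight for x u'; and only boundedness of the weight for p - q. In the
application q is the difference quotient replacing p = ∂ₜu, which is merely known to be in L². -/
theorem integral_weight_dw_sq_le (S : Snapshot X a b c₀ u du f df p) (hX : 0 < X) {h A al : ℝ}
    (hh : 0 < h) (hal : 0 < al) (ha : al ≤ a) (hb : |b| ≤ A) (hc : |c₀| ≤ A)
    {q dq : ℝ → ℝ} (hdq : MemLp dq 2 (dom X)) (hq : ∀ x ∈ Icc 0 X, q x = ∫ y in 0..x, dq y) :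
    ∫ x in 0..X, weight h x * fluxDeriv a b c₀ u du f p x ^ 2 ≤
      5 / al ^ 2 * ((∫ x in 0..X, (p x - q x) ^ 2) + 4 * h ^ 2 * (∫ x in 0..X, dq x ^ 2) +
        4 * h ^ 2 * (∫ x in 0..X, df x ^ 2) + 17 * A ^ 2 * h ^ 2 * ∫ x in 0..X, du x ^ 2) := by
  have m0 : (0 : ℝ) ∈ Icc 0 X := ⟨le_rfl, hX.le⟩
  have mX : X ∈ Icc 0 X := ⟨hX.le, le_rfl⟩
  have hA : 0 ≤ A := (abs_nonneg _).trans hb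
  have mq := memLp_of_primitive hdq hq
  have iw : ∀ {g : ℝ → ℝ}, MemLp g 2 (dom X) →
      IntervalIntegrable (fun x => weight h x * g x ^ 2) volume 0 X := fun hg =>
    SpaceMesh.intervalIntegrable_weight_mul_sq hX hh hg
  have isq : ∀ {g : ℝ → ℝ}, MemLp g 2 (dom X) →
      IntervalIntegrable (fun x => g x ^ 2) volume 0 X := fun hg =>
    MemLp.intervalIntegrable_sq_dom hg m0 mX
  have hardy : ∀ {v dv : ℝ → ℝ}, MemLp dv 2 (dom X) → (∀ x ∈ Icc 0 X, v x = ∫ y in 0..x, dv y) →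
      ∫ x in 0..X, weight h x * v x ^ 2 ≤ 4 * h ^ 2 * ∫ x in 0..X, dv x ^ 2 := by
    intro v dv hdv hv
    refine (le_of_eq ?_).trans (hardy_weight hX hh hdv)
    refine intervalIntegral.integral_congr fun x hx => ?_
    rw [uIcc_of_le hX.le] at hx
    rw [hv x hx]
  have mpq : MemLp (fun x => p x - q x) 2 (dom X) := S.mem_p.sub mq
  have hpt : ∀ x ∈ Icc 0 X, weight h x * fluxDeriv a b c₀ u du f p x ^ 2 ≤
      5 / al ^ 2 * ((p x - q x) ^ 2 + weight h x * q x ^ 2 + weight h x * f x ^ 2 +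
        4 * A ^ 2 * (weight h x * u x ^ 2) + A ^ 2 * h ^ 2 * du x ^ 2) := by
    intro x hx
    have hw0 := weight_nonneg h x
    have hw1 := weight_le_one hh x
    have hwx : weight h x * x ^ 2 ≤ h ^ 2 := by
      rcases hx.1.eq_or_lt with h0 | h0
      · rw [← h0]; simp; positivity
      · have := weight_le hh h0
        rwa [le_div_iff₀ (by positivity)] at this
    have hb2 : b ^ 2 ≤ A ^ 2 := by rw [← sq_abs]; exact pow_le_pow_left₀ (abs_nonneg _) hb 2
    have hcb : (c₀ - b) ^ 2 ≤ 4 * A ^ 2 := by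
      have : |c₀ - b| ≤ 2 * A := (abs_sub _ _).trans (by linarith)
      calc (c₀ - b) ^ 2 = |c₀ - b| ^ 2 := (sq_abs _).symm
        _ ≤ (2 * A) ^ 2 := pow_le_pow_left₀ (abs_nonneg _) this 2
        _ = _ := by ring
    set N := (p x - q x) + q x + (-f x) + (c₀ - b) * u x + (-(b * x * du x)) with hN
    have e : fluxDeriv a b c₀ u du f p x ^ 2 = N ^ 2 / a ^ 2 := by
      rw [fluxDeriv, hN, div_pow]; congr 2; ring
    have e1 : N ^ 2 / a ^ 2 ≤ N ^ 2 / al ^ 2 :=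
      div_le_div_of_nonneg_left (sq_nonneg _) (by positivity) (pow_le_pow_left₀ hal.le ha 2)
    have e2 := sq_add_five_le (p x - q x) (q x) (-f x) ((c₀ - b) * u x) (-(b * x * du x))
    have e3 : weight h x * N ^ 2 ≤ 5 * ((p x - q x) ^ 2 + weight h x * q x ^ 2 +
        weight h x * f x ^ 2 + 4 * A ^ 2 * (weight h x * u x ^ 2) + A ^ 2 * h ^ 2 * du x ^ 2) := by
      have k0 := mul_le_mul_of_nonneg_left e2 hw0
      have k1 := mul_le_mul_of_nonneg_right hw1 (sq_nonneg (p x - q x))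
      have k2 := mul_le_mul_of_nonneg_right hcb (mul_nonneg hw0 (sq_nonneg (u x)))
      have k3 : b ^ 2 * (weight h x * x ^ 2) ≤ A ^ 2 * h ^ 2 :=
        mul_le_mul hb2 hwx (by positivity) (by positivity)
      have k4 := mul_le_mul_of_nonneg_right k3 (sq_nonneg (du x))
      linarith
    calc weight h x * fluxDeriv a b c₀ u du f p x ^ 2 ≤ weight h x * (N ^ 2 / al ^ 2) := by
          rw [e]; exact mul_le_mul_of_nonneg_left e1 hw0
      _ = (weight h x * N ^ 2) / al ^ 2 := by ring
      _ ≤ _ := by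
          rw [div_mul_eq_mul_div]
          exact div_le_div_of_nonneg_right e3 (by positivity)
  refine (intervalIntegral.integral_mono_on hX.le (iw S.mem_dw) (((((isq mpq).add (iw mq)).add
    (iw S.mem_f)).add ((iw S.mem_u).const_mul _)).add ((isq S.mem_du).const_mul _) |>.const_mul _)
    hpt).trans ?_
  rw [intervalIntegral.integral_const_mul, intervalIntegral.integral_add
    ((((isq mpq).add (iw mq)).add (iw S.mem_f)).add ((iw S.mem_u).const_mul _))
    ((isq S.mem_du).const_mul _), intervalIntegral.integral_add
    (((isq mpq).add (iw mq)).add (iw S.mem_f)) ((iw S.mem_u).const_mul _),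
    intervalIntegral.integral_add ((isq mpq).add (iw mq)) (iw S.mem_f),
    intervalIntegral.integral_add (isq mpq) (iw mq), intervalIntegral.integral_const_mul,
    intervalIntegral.integral_const_mul]
  refine mul_le_mul_of_nonneg_left ?_ (by positivity)
  have k1 := hardy hdq hq
  have k2 := hardy S.mem_df S.f_eq
  have k3 := mul_le_mul_of_nonneg_left (hardy S.mem_du S.u_eq) (by positivity : 0 ≤ 4 * A ^ 2)
  linarith

end Snapshot

/-! ### The cell residuals -/

namespace SpaceMesh

variable {X : ℝ} (G : SpaceMesh X)

theorem abs_len_mul_sub_integral_le {v dv : ℝ → ℝ} (hdv : MemLp dv 2 (dom X))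
    (hv : ∀ x ∈ Icc 0 X, v x = ∫ y in 0..x, dv y) {i : ℕ} (h1 : 1 ≤ i) (hi : i ≤ G.N) {z : ℝ}
    (hz : z ∈ Icc (G.lo (i - 1)) (G.node (i + 1))) :
    |G.len i * v z - ∫ x in G.face i..G.face (i + 1), v x| ≤
      G.len i * (G.osc dv (i - 1) + G.osc dv i) := by
  have hl := G.len_pos (i := i) (by omega)
  have m1 := G.face_mem (i := i) (by omega)
  have m2 := G.face_mem (i := i + 1) (by omega)
  have hle := G.face_mono (i := i) (j := i + 1) (by omega) (by omega)
  have hlo : G.lo (i - 1) ≤ G.face i := by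
    have := G.lo_le_face (i := i - 1) (by omega)
    rwa [Nat.sub_add_cancel h1] at this
  have hsub : Icc (G.lo (i - 1)) (G.node (i + 1)) ⊆ Icc 0 X :=
    Icc_subset_Icc (G.lo_nonneg (by omega)) (G.node_mem (by omega)).2
  have iv := MemLp.intervalIntegrable_dom (memLp_of_primitive hdv hv) m1 m2
  have e : G.len i * v z - ∫ x in G.face i..G.face (i + 1), v x =
      ∫ x in G.face i..G.face (i + 1), (v z - v x) := by
    rw [intervalIntegral.integral_sub intervalIntegrable_const iv,
      intervalIntegral.integral_const, smul_eq_mul, len]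
  rw [e]
  have := intervalIntegral.norm_integral_le_of_norm_le_const (a := G.face i)
    (b := G.face (i + 1)) (f := fun x => v z - v x) (C := G.osc dv (i - 1) + G.osc dv i)
    fun x hx => by
      rw [uIoc_of_le hle] at hx
      have hx' : x ∈ Icc (G.lo (i - 1)) (G.node (i + 1)) :=
        ⟨hlo.trans hx.1.le, hx.2.trans (G.face_le_node hi)⟩
      rw [Real.norm_eq_abs, hv z (hsub hz), hv x (hsub hx')]
      exact G.abs_sub_le_osc_add hdv h1 hi hz hx'
  rw [Real.norm_eq_abs, abs_of_nonneg (sub_nonneg.2 hle), mul_comm] at this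
  exact this

theorem node_mem_hull {i : ℕ} (h1 : 1 ≤ i) (hi : i ≤ G.N) :
    G.node i ∈ Icc (G.lo (i - 1)) (G.node (i + 1)) :=
  ⟨(G.lo_le_node (by omega)).trans (G.node_mono (by omega) (by omega)), G.node_le_succ hi⟩

theorem x_mem_hull {i : ℕ} (h1 : 1 ≤ i) (hi : i ≤ G.N) :
    G.x i ∈ Icc (G.lo (i - 1)) (G.node (i + 1)) := by
  have hlo := G.lo_le_face (i := i - 1) (by omega)
  rw [Nat.sub_add_cancel h1] at hlo
  exact ⟨hlo.trans (G.face_le_x (by omega)).1,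
    (G.x_le_face (by omega)).1.trans (G.face_le_node hi)⟩

theorem sum_len_le : ∑ i ∈ Finset.Icc 1 G.N, G.len i ≤ 2 * X := by
  have h := G.sum_len₂_le
  rw [sum_range_succ_eq_add_Icc] at h
  have h0 := G.len₂_pos (Nat.zero_le _)
  have : ∑ i ∈ Finset.Icc 1 G.N, G.len i ≤ ∑ i ∈ Finset.Icc 1 G.N, G.len₂ i := by
    refine Finset.sum_le_sum fun i hi => ?_
    have := G.len_pos (i := i + 1) (by have := Finset.mem_Icc.1 hi; omega)
    rw [len₂]; linarith
  linarith

end SpaceMesh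

theorem sq_primitive_le_mul {X : ℝ} (hX : 0 < X) {v dv : ℝ → ℝ} (hdv : MemLp dv 2 (dom X))
    (hv : ∀ x ∈ Icc 0 X, v x = ∫ y in 0..x, dv y) {x : ℝ} (hx : x ∈ Icc 0 X) :
    v x ^ 2 ≤ X * ∫ x in 0..X, dv x ^ 2 := by
  have m0 : (0 : ℝ) ∈ Icc 0 X := ⟨le_rfl, hX.le⟩
  rw [hv x hx]
  refine (sq_integral_le hx.1 (MemLp.intervalIntegrable_dom hdv m0 hx)
    (MemLp.intervalIntegrable_sq_dom hdv m0 hx)).trans ?_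
  rw [sub_zero]
  exact mul_le_mul hx.2 (SpaceMesh.integral_sq_le_of_mem hdv m0 hx hx.1)
    (intervalIntegral.integral_nonneg hx.1 fun _ _ => sq_nonneg _) hX.le

section Residual

variable {X a b c₀ : ℝ} {u du f df p q dq : ℝ → ℝ} (G : SpaceMesh X)

/-- The part of the consistency error that lives in the cell `K_i`. -/
def cellResidual (G : SpaceMesh X) (c₀ c₁ : ℝ) (u f p q : ℝ → ℝ) (i : ℕ) : ℝ :=
  G.len i * q (G.node i) - (∫ x in G.face i..G.face (i + 1), p x) +
    c₁ * (G.len i * u (G.node i)) - c₀ * (∫ x in G.face i..G.face (i + 1), u x) -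
    (G.len i * f (G.x i) - ∫ x in G.face i..G.face (i + 1), f x)

/-- Replacing point values by cell means costs O(h) for each function with a square-integrable
derivative. The terms p - q and c₁ - c₀ account for the two time errors. -/
theorem sum_cellResidual_sq_le (S : Snapshot X a b c₀ u du f df p) (hdq : MemLp dq 2 (dom X))
    (hq : ∀ x ∈ Icc 0 X, q x = ∫ y in 0..x, dq y) {c₁ A ε : ℝ} (hA : |c₀| ≤ A)
    (hε : |c₁ - c₀| ≤ ε) :
    ∑ i ∈ Finset.Icc 1 G.N, cellResidual G c₀ c₁ u f p q i ^ 2 / G.len i ≤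
      5 * (168 * G.h ^ 2 * (∫ x in 0..X, dq x ^ 2) + (∫ x in 0..X, (p x - q x) ^ 2) +
        2 * X ^ 2 * ε ^ 2 * (∫ x in 0..X, du x ^ 2) +
        168 * A ^ 2 * G.h ^ 2 * (∫ x in 0..X, du x ^ 2) +
        168 * G.h ^ 2 * ∫ x in 0..X, df x ^ 2) := by
  have hX := G.X_pos
  have hA0 : 0 ≤ A := (abs_nonneg _).trans hA
  have hε0 : 0 ≤ ε := (abs_nonneg _).trans hε
  have m0 : (0 : ℝ) ∈ Icc 0 X := ⟨le_rfl, hX.le⟩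
  have mX : X ∈ Icc 0 X := ⟨hX.le, le_rfl⟩
  have mq := memLp_of_primitive hdq hq
  have mpq : MemLp (fun x => p x - q x) 2 (dom X) := S.mem_p.sub mq
  set I := ∫ x in 0..X, du x ^ 2 with hI
  have hI0 : 0 ≤ I := intervalIntegral.integral_nonneg hX.le fun _ _ => sq_nonneg _
  have hterm : ∀ i ∈ Finset.Icc 1 G.N, cellResidual G c₀ c₁ u f p q i ^ 2 / G.len i ≤
      5 * (G.len i * (G.osc dq (i - 1) + G.osc dq i) ^ 2 +
        (∫ x in G.face i..G.face (i + 1), (p x - q x) ^ 2) + ε ^ 2 * (X * I) * G.len i +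
        A ^ 2 * (G.len i * (G.osc du (i - 1) + G.osc du i) ^ 2) +
        G.len i * (G.osc df (i - 1) + G.osc df i) ^ 2) := by
    intro i hi
    obtain ⟨h1, hiN⟩ := Finset.mem_Icc.1 hi
    have hl := G.len_pos (i := i) (by omega)
    have m1 := G.face_mem (i := i) (by omega)
    have m2 := G.face_mem (i := i + 1) (by omega)
    have hle := G.face_mono (i := i) (j := i + 1) (by omega) (by omega)
    have b1 := G.abs_len_mul_sub_integral_le hdq hq h1 hiN (G.node_mem_hull h1 hiN)
    have b4 := G.abs_len_mul_sub_integral_le S.mem_du S.u_eq h1 hiN (G.node_mem_hull h1 hiN)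
    have b5 := G.abs_len_mul_sub_integral_le S.mem_df S.f_eq h1 hiN (G.x_mem_hull h1 hiN)
    have b2 := sq_integral_le hle (MemLp.intervalIntegrable_dom mpq m1 m2)
      (MemLp.intervalIntegrable_sq_dom mpq m1 m2)
    have b3 := sq_primitive_le_mul hX S.mem_du S.u_eq (G.node_mem (i := i) (by omega))
    rw [intervalIntegral.integral_sub (MemLp.intervalIntegrable_dom S.mem_p m1 m2)
      (MemLp.intervalIntegrable_dom mq m1 m2)] at b2
    set P := ∫ x in G.face i..G.face (i + 1), p x
    set Q := ∫ x in G.face i..G.face (i + 1), q x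
    set U := ∫ x in G.face i..G.face (i + 1), u x
    set F := ∫ x in G.face i..G.face (i + 1), f x
    set l := G.len i with hldef
    have hlen : G.face (i + 1) - G.face i = l := rfl
    rw [hlen] at b2
    -- As p has no known spatial regularity, q is compared with its own cell mean, and p - q enters
    -- only through an integral.
    have e : cellResidual G c₀ c₁ u f p q i = (l * q (G.node i) - Q) + (-(P - Q)) +
        (c₁ - c₀) * (l * u (G.node i)) + c₀ * (l * u (G.node i) - U) +
        (-(l * f (G.x i) - F)) := by
      simp only [cellResidual]; ring
    have sqb : ∀ {z o : ℝ}, |z| ≤ l * o → z ^ 2 / l ≤ l * o ^ 2 := by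
      intro z o hz
      rw [div_le_iff₀ hl, ← sq_abs]
      refine (pow_le_pow_left₀ (abs_nonneg _) hz 2).trans (le_of_eq (by ring))
    have s1 := sqb b1
    have s4 := sqb b4
    have s5 := sqb b5
    have s2 : (-(P - Q)) ^ 2 / l ≤ ∫ x in G.face i..G.face (i + 1), (p x - q x) ^ 2 := by
      rw [div_le_iff₀ hl, neg_sq]; linarith
    have s3 : ((c₁ - c₀) * (l * u (G.node i))) ^ 2 / l ≤ ε ^ 2 * (X * I) * l := by
      rw [div_le_iff₀ hl]
      have k1 : (c₁ - c₀) ^ 2 ≤ ε ^ 2 := by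
        rw [← sq_abs]; exact pow_le_pow_left₀ (abs_nonneg _) hε 2
      calc ((c₁ - c₀) * (l * u (G.node i))) ^ 2 = ((c₁ - c₀) ^ 2 * u (G.node i) ^ 2) * l ^ 2 := by
            ring
        _ ≤ (ε ^ 2 * (X * I)) * l ^ 2 := mul_le_mul_of_nonneg_right
            (mul_le_mul k1 b3 (sq_nonneg _) (sq_nonneg _)) (sq_nonneg _)
        _ = _ := by ring
    have s4' : (c₀ * (l * u (G.node i) - U)) ^ 2 / l ≤
        A ^ 2 * (l * (G.osc du (i - 1) + G.osc du i) ^ 2) := by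
      have k1 : c₀ ^ 2 ≤ A ^ 2 := by
        rw [← sq_abs]; exact pow_le_pow_left₀ (abs_nonneg _) hA 2
      rw [mul_pow, mul_div_assoc]
      exact mul_le_mul k1 s4 (by positivity) (by positivity)
    rw [neg_sq] at s2
    have k := div_le_div_of_nonneg_right (sq_add_five_le (l * q (G.node i) - Q) (-(P - Q))
      ((c₁ - c₀) * (l * u (G.node i))) (c₀ * (l * u (G.node i) - U)) (-(l * f (G.x i) - F))) hl.le
    rw [e]
    refine k.trans ?_
    rw [mul_div_assoc, add_div, add_div, add_div, add_div, neg_sq, neg_sq]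
    linarith
  refine (Finset.sum_le_sum hterm).trans ?_
  rw [← Finset.mul_sum, Finset.sum_add_distrib, Finset.sum_add_distrib, Finset.sum_add_distrib,
    Finset.sum_add_distrib, ← Finset.mul_sum, ← Finset.mul_sum]
  have g1 := G.sum_len_mul_osc_sq_le hdq
  have g4 := mul_le_mul_of_nonneg_left (G.sum_len_mul_osc_sq_le S.mem_du) (sq_nonneg A)
  have g5 := G.sum_len_mul_osc_sq_le S.mem_df
  have g3 := mul_le_mul_of_nonneg_left G.sum_len_le (by positivity : 0 ≤ ε ^ 2 * (X * I))
  have g2 : ∑ i ∈ Finset.Icc 1 G.N, ∫ x in G.face i..G.face (i + 1), (p x - q x) ^ 2 ≤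
      ∫ x in 0..X, (p x - q x) ^ 2 := by
    have := intervalIntegral.sum_integral_adjacent_intervals (a := G.face) (n := G.N + 2)
      (f := fun x => (p x - q x) ^ 2) (μ := volume) fun k hk =>
        MemLp.intervalIntegrable_sq_dom mpq (G.face_mem (by omega)) (G.face_mem (by omega))
    rw [G.face_zero, G.face_last, Finset.sum_range_succ, sum_range_succ_eq_add_Icc] at this
    have nn : ∀ i ≤ G.N + 1, 0 ≤ ∫ x in G.face i..G.face (i + 1), (p x - q x) ^ 2 := fun i hi =>
      intervalIntegral.integral_nonneg (G.face_mono (by omega) (by omega)) fun _ _ => sq_nonneg _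
    linarith [nn 0 (by omega), nn (G.N + 1) le_rfl]
  linarith

end Residual

/-! ### The consistency error -/

namespace SpaceMesh

variable {X : ℝ} (G : SpaceMesh X)

/-- `‖v‖²_{0,h}`. -/
def massSq (v : ℕ → ℝ) : ℝ := ∑ i ∈ Finset.Icc 1 G.N, G.len i * v i ^ 2

/-- The square of the discrete weighted `H¹` seminorm. -/
def energySq (v : ℕ → ℝ) : ℝ :=
  ∑ i ∈ Finset.range (G.N + 1), G.face (i + 1) ^ 2 / G.len₂ i * (v (i + 1) - v i) ^ 2

theorem massSq_nonneg (v : ℕ → ℝ) : 0 ≤ G.massSq v :=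
  Finset.sum_nonneg fun i hi => mul_nonneg
    (G.len_pos (by have := Finset.mem_Icc.1 hi; omega)).le (sq_nonneg _)

theorem energySq_nonneg (v : ℕ → ℝ) : 0 ≤ G.energySq v :=
  Finset.sum_nonneg fun i hi => mul_nonneg (div_nonneg (sq_nonneg _)
    (G.len₂_pos (by have := Finset.mem_range.1 hi; omega)).le) (sq_nonneg _)

end SpaceMesh

theorem mul_le_young {w μ p q : ℝ} (hw : 0 < w) (hμ : 0 < μ) :
    p * q ≤ μ * (w * q ^ 2) + 1 / μ * (p ^ 2 / w) := by
  have e : μ * (w * q ^ 2) + 1 / μ * (p ^ 2 / w) - p * q =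
      (3 / 4 * (μ * w * q) ^ 2 + (p - μ * w * q / 2) ^ 2) / (μ * w) := by
    field_simp; ring
  have : 0 ≤ (3 / 4 * (μ * w * q) ^ 2 + (p - μ * w * q / 2) ^ 2) / (μ * w) := by positivity
  linarith

section Consistency

variable {X a b c₀ : ℝ} {u du f df p q dq : ℝ → ℝ} {r σ : ℝ → ℝ} (G : SpaceMesh X)

/-- The residual of the comparison values `u (node i)` in the scheme, tested with `v`. -/
def schemeResidual (G : SpaceMesh X) (T : ℝ) (meth : Method) (fv : FaceValue) (r σ : ℝ → ℝ)
    (t : ℝ) (u f q : ℝ → ℝ) (v : ℕ → ℝ) : ℝ :=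
  (∑ i ∈ Finset.Icc 1 G.N, G.len i * q (G.node i) * v i) +
    discForm G T meth fv r σ t (fun i => u (G.node i)) v -
    ∑ i ∈ Finset.Icc 1 G.N, G.len i * f (G.x i) * v i

/-- The equation integrated over each dual cell is subtracted, which leaves a cell part and a
difference of flux errors; summation by parts moves the latter difference onto v. -/
theorem schemeResidual_eq (S : Snapshot X a b c₀ u du f df p) (ha : a ≠ 0) (T t : ℝ)
    (meth : Method) (fv : FaceValue) (q : ℝ → ℝ) {v : ℕ → ℝ} (hv : G.MemVh v) :
    schemeResidual G T meth fv r σ t u f q v =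
      (∑ i ∈ Finset.Icc 1 G.N, cellResidual G c₀ (coefC T r σ t) u f p q i * v i) +
      ∑ i ∈ Finset.range (G.N + 1), -fluxError G meth fv r σ t a b u
        (fluxDeriv a b c₀ u du f p) i * (v (i + 1) - v i) := by
  simp only [neg_mul, Finset.sum_neg_distrib]
  rw [← sum_by_parts G.N _ v hv.1 hv.2, schemeResidual, discForm, Finset.mul_sum,
    ← Finset.sum_add_distrib, ← Finset.sum_add_distrib, ← Finset.sum_sub_distrib,
    ← Finset.sum_add_distrib]
  refine Finset.sum_congr rfl fun i hi => ?_
  obtain ⟨h1, hiN⟩ := Finset.mem_Icc.1 hi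
  have key := S.integral_eq ha (G.face_mem (i := i) (by omega)) (G.face_mem (i := i + 1) (by omega))
  simp only [cellResidual, fluxError, Nat.sub_add_cancel h1]
  linear_combination (v i) * key

theorem schemeResidual_le_young (S : Snapshot X a b c₀ u du f df p) (ha : a ≠ 0) (T t : ℝ)
    (meth : Method) (fv : FaceValue) (q : ℝ → ℝ) {v : ℕ → ℝ} (hv : G.MemVh v) {μ : ℝ}
    (hμ : 0 < μ) :
    schemeResidual G T meth fv r σ t u f q v ≤ μ * (G.massSq v + G.energySq v) + 1 / μ *
      ((∑ i ∈ Finset.Icc 1 G.N, cellResidual G c₀ (coefC T r σ t) u f p q i ^ 2 / G.len i) +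
      ∑ i ∈ Finset.range (G.N + 1), G.len₂ i / G.face (i + 1) ^ 2 *
        fluxError G meth fv r σ t a b u (fluxDeriv a b c₀ u du f p) i ^ 2) := by
  rw [schemeResidual_eq G S ha T t meth fv q hv, SpaceMesh.massSq, SpaceMesh.energySq]
  have h1 : ∑ i ∈ Finset.Icc 1 G.N, cellResidual G c₀ (coefC T r σ t) u f p q i * v i ≤
      μ * (∑ i ∈ Finset.Icc 1 G.N, G.len i * v i ^ 2) + 1 / μ *
        ∑ i ∈ Finset.Icc 1 G.N, cellResidual G c₀ (coefC T r σ t) u f p q i ^ 2 / G.len i := by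
    rw [Finset.mul_sum, Finset.mul_sum, ← Finset.sum_add_distrib]
    refine Finset.sum_le_sum fun i hi => mul_le_young (G.len_pos ?_) hμ
    have := Finset.mem_Icc.1 hi; omega
  have h2 : ∑ i ∈ Finset.range (G.N + 1), -fluxError G meth fv r σ t a b u
        (fluxDeriv a b c₀ u du f p) i * (v (i + 1) - v i) ≤
      μ * (∑ i ∈ Finset.range (G.N + 1), G.face (i + 1) ^ 2 / G.len₂ i * (v (i + 1) - v i) ^ 2) +
        1 / μ * ∑ i ∈ Finset.range (G.N + 1), G.len₂ i / G.face (i + 1) ^ 2 *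
          fluxError G meth fv r σ t a b u (fluxDeriv a b c₀ u du f p) i ^ 2 := by
    rw [Finset.mul_sum, Finset.mul_sum, ← Finset.sum_add_distrib]
    refine Finset.sum_le_sum fun i hi => ?_
    have hi' := Finset.mem_range.1 hi
    have hy := G.face_pos (i := i) (by omega)
    have hL := G.len₂_pos (i := i) (by omega)
    refine (mul_le_young (w := G.face (i + 1) ^ 2 / G.len₂ i) (by positivity) hμ).trans
      (le_of_eq ?_)
    rw [neg_sq, div_div_eq_mul_div]; ring
  linarith

/-- The constant is fixed before the mesh, the times and the data, as the global estimate requires.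
Here ε is the distance between the coefficients in the form and those in the equation satisfied by
u. -/
theorem exists_schemeResidual_le {c A al : ℝ} (X : ℝ) (hc : 0 < c) (hal : 0 < al) :
    ∃ C, 0 < C ∧ ∀ (G : SpaceMesh X) (T t a b c₀ ε μ : ℝ) (meth : Method) (fv : FaceValue)
      (r σ u du f df p q dq : ℝ → ℝ) (v : ℕ → ℝ), G.QuasiUniform c →
      Snapshot X a b c₀ u du f df p → MemLp dq 2 (dom X) →
      (∀ x ∈ Icc 0 X, q x = ∫ y in 0..x, dq y) → al ≤ a → |a| ≤ A → |b| ≤ A → |c₀| ≤ A →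
      |coefA σ t| ≤ A → |coefB r σ t| ≤ A → |coefA σ t - a| ≤ ε → |coefB r σ t - b| ≤ ε →
      |coefC T r σ t - c₀| ≤ ε → 0 < μ → G.MemVh v →
      schemeResidual G T meth fv r σ t u f q v ≤ μ * (G.massSq v + G.energySq v) +
        C / μ * ((G.h + ε) ^ 2 * ((∫ x in 0..X, du x ^ 2) + ∫ x in 0..X, df x ^ 2) +
          G.h ^ 2 * (∫ x in 0..X, dq x ^ 2) + ∫ x in 0..X, (p x - q x) ^ 2) := by
  set K₁ := 4 * (A * (16 * c + 24) + 2 * (1 + c) ^ 2 * X) ^ 2 + 168 * A ^ 2 + 8 * X ^ 2 +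
          84 * (A * (2 * (1 + c) ^ 2 + 2)) ^ 2 with hK₁
  set K₂ := 144 * A ^ 2 * (2 * (1 + c)) ^ 3 + 2 * A ^ 2 * (1 + c) with hK₂
  set K₃ := 5 * (169 + 2 * X ^ 2 + 168 * A ^ 2) with hK₃
  have n1 : 0 ≤ K₁ := by positivity
  have n2 : 0 ≤ K₂ := by positivity
  have n3 : 0 < K₃ := by positivity
  refine ⟨K₁ + K₂ * (5 / al ^ 2 * (4 + 17 * A ^ 2)) + K₃, by positivity, ?_⟩
  intro G T t a b c₀ ε μ meth fv r σ u du f df p q dq v hG S hdq hq haal ha hb hc₀ hat hbt hεa hεb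
    hεc hμ hv
  have hX := G.X_pos
  have hh := G.h_pos
  have hε : 0 ≤ ε := (abs_nonneg _).trans hεa
  have ha0 : a ≠ 0 := (hal.trans_le haal).ne'
  have y := schemeResidual_le_young G S ha0 T t meth fv q hv hμ (r := r) (σ := σ)
  have f1 := sum_fluxError_sq_le G hc hG S.mem_du S.mem_dw S.u_eq S.flux_eq hat hbt ha hb hεa hεb
    meth fv
  have f2 := S.integral_weight_dw_sq_le hX hh hal haal hb hc₀ hdq hq
  have f3 := sum_cellResidual_sq_le G S hdq hq hc₀ hεc
  rw [← hK₁, ← hK₂] at f1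
  have nn : ∀ g : ℝ → ℝ, 0 ≤ ∫ x in 0..X, g x ^ 2 := fun g =>
    intervalIntegral.integral_nonneg hX.le fun _ _ => sq_nonneg _
  have i1 := nn du
  have i2 := nn df
  have i3 := nn dq
  have i4 := nn fun x => p x - q x
  set I := ∫ x in 0..X, du x ^ 2
  set D := ∫ x in 0..X, df x ^ 2
  set Q := ∫ x in 0..X, dq x ^ 2
  set J := ∫ x in 0..X, (p x - q x) ^ 2
  set H := (G.h + ε) ^ 2 with hH
  have hH0 : 0 ≤ H := sq_nonneg _
  have hH1 : G.h ^ 2 ≤ H := pow_le_pow_left₀ hh.le (by linarith) 2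
  have hH2 : ε ^ 2 ≤ H := pow_le_pow_left₀ hε (by linarith) 2
  set R := H * (I + D) + G.h ^ 2 * Q + J with hR
  have hI1 := mul_le_mul_of_nonneg_right hH1 i1
  have hI2 := mul_le_mul_of_nonneg_right hH2 i1
  have hD1 := mul_le_mul_of_nonneg_right hH1 i2
  have hHI : 0 ≤ H * I := by positivity
  have hHD : 0 ≤ H * D := by positivity
  have hhQ : 0 ≤ G.h ^ 2 * Q := by positivity
  have rI : H * I ≤ R := by rw [hR]; linarith
  have rhI : G.h ^ 2 * I ≤ R := hI1.trans rI
  have b1 : K₁ * H * I ≤ K₁ * R := by rw [mul_assoc]; exact mul_le_mul_of_nonneg_left rI n1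
  have b2 : J + 4 * G.h ^ 2 * Q + 4 * G.h ^ 2 * D + 17 * A ^ 2 * G.h ^ 2 * I ≤
      (4 + 17 * A ^ 2) * R := by
    have k := mul_le_mul_of_nonneg_left rhI (by positivity : 0 ≤ 17 * A ^ 2)
    rw [hR] at k ⊢; linarith
  have b2' := mul_le_mul_of_nonneg_left (f2.trans
    (mul_le_mul_of_nonneg_left b2 (by positivity : 0 ≤ 5 / al ^ 2))) n2
  have b3 : 5 * (168 * G.h ^ 2 * Q + J + 2 * X ^ 2 * ε ^ 2 * I + 168 * A ^ 2 * G.h ^ 2 * I +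
      168 * G.h ^ 2 * D) ≤ K₃ * R := by
    have k1 := mul_le_mul_of_nonneg_left rhI (by positivity : 0 ≤ 168 * A ^ 2)
    have k2 := mul_le_mul_of_nonneg_left (hI2.trans rI) (by positivity : 0 ≤ 2 * X ^ 2)
    rw [hK₃]
    have k3 : 168 * G.h ^ 2 * Q + J + 168 * G.h ^ 2 * D ≤ 169 * R := by rw [hR]; linarith
    linarith
  refine y.trans (add_le_add le_rfl ?_)
  rw [div_mul_eq_mul_div, div_mul_eq_mul_div, one_mul, div_le_div_iff_of_pos_right hμ]
  linarith

end Consistency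

/-! ### Coercivity of the discrete bilinear form -/

section Coercivity

variable {X : ℝ} (G : SpaceMesh X) {r σ : ℝ → ℝ} {t : ℝ}

/-- A nodal value times the difference is half the difference of squares, plus or minus half the
squared difference. The upwind choice takes the sign that helps; the reversed one pays |b|/2. -/
theorem FaceValue.le_eval_mul_sub (fv : FaceValue) (b : ℝ) (w : ℕ → ℝ) (i : ℕ) {κ : ℝ}
    (hκ : 0 ≤ κ) (h : fv = .reversed → |b| / 2 ≤ κ) :
    b / 2 * (w (i + 1) ^ 2 - w i ^ 2) - κ * (w (i + 1) - w i) ^ 2 ≤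
      fv.eval b w i * (w (i + 1) - w i) := by
  have hd := sq_nonneg (w (i + 1) - w i)
  cases fv with
  | upwind =>
    simp only [FaceValue.eval]
    have k := mul_nonneg hκ hd
    rcases le_total 0 b with hb | hb
    · rw [max_eq_left hb, min_eq_right hb]
      have := mul_nonneg hb hd
      linarith
    · rw [max_eq_right hb, min_eq_left hb]
      have := mul_nonneg (neg_nonneg.2 hb) hd
      linarith
  | reversed =>
    simp only [FaceValue.eval]
    have k := mul_le_mul_of_nonneg_right (h rfl) hd
    rcases le_total 0 b with hb | hb
    · rw [abs_of_nonneg hb] at k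
      rw [max_eq_left hb, min_eq_right hb]
      linarith
    · rw [abs_of_nonpos hb] at k
      rw [max_eq_right hb, min_eq_left hb]
      linarith

theorem SpaceMesh.le_trans (ha : 0 ≤ coefA σ t) {i : ℕ} (hi : i ≤ G.N) :
    2 / 3 * coefA σ t * (G.face (i + 1) ^ 2 / G.len₂ i) ≤ G.trans σ t i := by
  have h1 := (G.meanSq_bounds (i := i) (by omega)).2.1.trans (G.harmSq_bounds hi).1
  have hL := G.len₂_pos hi
  rw [G.trans_eq σ t hi, mul_comm (2 / 3 : ℝ), mul_assoc]
  refine mul_le_mul_of_nonneg_left ?_ ha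
  rw [← mul_div_assoc, div_le_div_iff_of_pos_right hL]
  linarith

/-- Quasi-uniformity compares l_i + l_{i+1} with either neighbouring cell. The bound turns the loss
of the reversed scheme into a mass term. -/
theorem SpaceMesh.sum_len₂_mul_sub_sq_le {c : ℝ} (hc : 0 < c) (hG : G.QuasiUniform c) {v : ℕ → ℝ}
    (hv : G.MemVh v) :
    ∑ i ∈ Finset.range (G.N + 1), G.len₂ i * (v (i + 1) - v i) ^ 2 ≤ 4 * (1 + c) * G.massSq v := by
  have e1 : ∑ i ∈ Finset.range (G.N + 1), G.len i * v i ^ 2 = G.massSq v := by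
    rw [sum_range_succ_eq_add_Icc (fun i => G.len i * v i ^ 2), hv.1, massSq]; ring
  have e2 : ∑ i ∈ Finset.range (G.N + 1), G.len (i + 1) * v (i + 1) ^ 2 = G.massSq v := by
    rw [Finset.sum_range_succ, hv.2, Finset.range_eq_Ico,
      Finset.sum_Ico_add' (fun i => G.len i * v i ^ 2) 0 G.N 1, massSq]
    simp only [ne_eq, OfNat.ofNat_ne_zero, not_false_eq_true, zero_pow, mul_zero, add_zero]
    rfl
  calc ∑ i ∈ Finset.range (G.N + 1), G.len₂ i * (v (i + 1) - v i) ^ 2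
      ≤ ∑ i ∈ Finset.range (G.N + 1), 2 * (1 + c) *
          (G.len i * v i ^ 2 + G.len (i + 1) * v (i + 1) ^ 2) := by
        refine Finset.sum_le_sum fun i hi => ?_
        have hi' : i ≤ G.N := by have := Finset.mem_range.1 hi; omega
        obtain ⟨k1, k2⟩ := hG.len₂_le hc hi'
        have k3 : (v (i + 1) - v i) ^ 2 ≤ 2 * v i ^ 2 + 2 * v (i + 1) ^ 2 := by
          linarith [sq_nonneg (v (i + 1) + v i)]
        have k4 := mul_le_mul_of_nonneg_left k3 (G.len₂_pos hi').le
        have k5 := mul_le_mul_of_nonneg_right k1 (sq_nonneg (v i))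
        have k6 := mul_le_mul_of_nonneg_right k2 (sq_nonneg (v (i + 1)))
        linarith
    _ = 4 * (1 + c) * G.massSq v := by
        rw [← Finset.mul_sum, Finset.sum_add_distrib, e1, e2]; ring

theorem SpaceMesh.sum_face_mul_sq_sub_sq {v : ℕ → ℝ} (hv : G.MemVh v) :
    ∑ i ∈ Finset.range (G.N + 1), G.face (i + 1) * (v (i + 1) ^ 2 - v i ^ 2) = -G.massSq v := by
  have := sum_by_parts G.N (fun i => G.face (i + 1)) (fun i => v i ^ 2) (by simp [hv.1])
    (by simp [hv.2])
  rw [massSq, eq_neg_iff_add_eq_zero, ← neg_eq_iff_add_eq_zero, ← this]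
  refine Finset.sum_congr rfl fun i hi => ?_
  rw [Nat.sub_add_cancel (Finset.mem_Icc.1 hi).1, len]

/-- Diffusion offers 2a/3 by `SpaceMesh.le_trans`, of which a/6 pays for part of the face value and
a/2 remains. For upwind values κ may be zero. -/
theorem le_neg_discFlux_mul_sub (meth : Method) (fv : FaceValue) (ha : 0 < coefA σ t) {κ : ℝ}
    (hκ : 0 ≤ κ) (h : fv = .reversed → 3 / 8 * (coefB r σ t ^ 2 / coefA σ t) ≤ κ) {v : ℕ → ℝ}
    (hv : G.MemVh v) {i : ℕ} (hi : i ≤ G.N) :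
    coefA σ t / 2 * (G.face (i + 1) ^ 2 / G.len₂ i * (v (i + 1) - v i) ^ 2) +
        coefB r σ t / 2 * (G.face (i + 1) * (v (i + 1) ^ 2 - v i ^ 2)) -
        κ * (G.len₂ i * (v (i + 1) - v i) ^ 2) ≤
      -(discFlux G meth fv r σ t v i * (v (i + 1) - v i)) := by
  set a := coefA σ t with hadef
  set b := coefB r σ t with hbdef
  have hL := G.len₂_pos hi
  have hy := G.face_pos (i := i) (by omega)
  have hd := sq_nonneg (v (i + 1) - v i)
  have tp : a / 2 * (G.face (i + 1) ^ 2 / G.len₂ i * (v (i + 1) - v i) ^ 2) +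
        b / 2 * (G.face (i + 1) * (v (i + 1) ^ 2 - v i ^ 2)) -
        κ * (G.len₂ i * (v (i + 1) - v i) ^ 2) ≤
      -((-(G.trans σ t i * (v (i + 1) - v i)) - G.face (i + 1) * fv.eval b v i) *
        (v (i + 1) - v i)) := by
    have k1 := mul_le_mul_of_nonneg_right (G.le_trans (t := t) ha.le hi) hd
    rw [← hadef] at k1
    have k2 := mul_le_mul_of_nonneg_left (fv.le_eval_mul_sub b v i
      (κ := a / 6 * (G.face (i + 1) / G.len₂ i) + κ * (G.len₂ i / G.face (i + 1)))
      (by positivity) fun hfv => by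
        have h1 := mul_le_mul_of_nonneg_right (h hfv)
          (by positivity : 0 ≤ G.len₂ i / G.face (i + 1))
        refine le_trans ?_ (add_le_add le_rfl h1)
        -- Young's inequality: the choice a/6 forces the coefficient 3/8 of b²/a, and the numerator
        -- is then a perfect square.
        have e : a / 6 * (G.face (i + 1) / G.len₂ i) +
            3 / 8 * (b ^ 2 / a) * (G.len₂ i / G.face (i + 1)) - |b| / 2 =
            (4 * (a * G.face (i + 1)) ^ 2 + 9 * (|b| * G.len₂ i) ^ 2 -
              12 * (a * G.face (i + 1)) * (|b| * G.len₂ i)) /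
              (24 * a * G.face (i + 1) * G.len₂ i) := by
          rw [← sq_abs b]; field_simp; ring
        have : 0 ≤ (4 * (a * G.face (i + 1)) ^ 2 + 9 * (|b| * G.len₂ i) ^ 2 -
              12 * (a * G.face (i + 1)) * (|b| * G.len₂ i)) /
              (24 * a * G.face (i + 1) * G.len₂ i) := by
          refine div_nonneg ?_ (by positivity)
          linarith [sq_nonneg (2 * (a * G.face (i + 1)) - 3 * (|b| * G.len₂ i))]
        linarith) hy.le
    have e1 : G.face (i + 1) * ((a / 6 * (G.face (i + 1) / G.len₂ i) +
        κ * (G.len₂ i / G.face (i + 1))) * (v (i + 1) - v i) ^ 2) =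
        a / 6 * (G.face (i + 1) ^ 2 / G.len₂ i * (v (i + 1) - v i) ^ 2) +
        κ * (G.len₂ i * (v (i + 1) - v i) ^ 2) := by
      field_simp
    rw [mul_sub, e1] at k2
    linarith
  rcases Nat.eq_zero_or_pos i with h0 | h0
  · cases meth with
    | tpfa => exact tp
    | fitted =>
      subst h0
      have ex : G.x 1 = 2 * G.face 1 := by
        have := G.face_succ (i := 0) (Nat.zero_le _)
        rw [zero_add, G.x_zero] at this
        linarith
      -- In the fitted first flux the b-part already agrees with the claim, since v vanishes at 0,
      -- so only the a-part has to be compared.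
      have hyL : G.face 1 ^ 2 / G.len₂ 0 ≤ G.face 1 := by
        have := G.len_pos (i := 1) (by omega)
        have e := G.face_add_len 0
        rw [G.face_zero, zero_add, zero_add] at e
        rw [div_le_iff₀ hL, sq]
        refine mul_le_mul_of_nonneg_left ?_ hy.le
        rw [SpaceMesh.len₂, e]; linarith
      have e2 : discFlux G .fitted fv r σ t v 0 = -(1 / 2 * G.face 1 * ((a + b) * v 1)) := by
        simp only [discFlux, ex, ← hadef, ← hbdef]; ring
      rw [e2, hv.1]
      simp only [zero_add, sub_zero]
      have k1 := mul_le_mul_of_nonneg_left hyL (by positivity : 0 ≤ a / 2 * v 1 ^ 2)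
      have k2 : 0 ≤ κ * (G.len₂ 0 * v 1 ^ 2) := by positivity
      linarith
  · rw [discFlux_of_pos G meth fv r σ t v h0]
    exact tp

/-- After summation by parts the differences of squares, weighted by the faces, sum to minus the
squared mass norm, hence the term -b/2; the differences charged to κ are returned to the mass norm.
-/
theorem le_discForm {c : ℝ} (hc : 0 < c) (hG : G.QuasiUniform c) (T : ℝ) (meth : Method)
    (fv : FaceValue) (ha : 0 < coefA σ t) {κ : ℝ} (hκ : 0 ≤ κ)
    (h : fv = .reversed → 3 / 8 * (coefB r σ t ^ 2 / coefA σ t) ≤ κ) {v : ℕ → ℝ}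
    (hv : G.MemVh v) :
    coefA σ t / 2 * G.energySq v +
        (coefC T r σ t - coefB r σ t / 2 - 4 * (1 + c) * κ) * G.massSq v ≤
      discForm G T meth fv r σ t v v := by
  have k1 := Finset.sum_le_sum fun i (hi : i ∈ Finset.range (G.N + 1)) =>
    le_neg_discFlux_mul_sub G meth fv ha hκ h hv (i := i) (by have := Finset.mem_range.1 hi; omega)
  rw [Finset.sum_sub_distrib, Finset.sum_add_distrib, ← Finset.mul_sum, ← Finset.mul_sum,
    ← Finset.mul_sum, G.sum_face_mul_sq_sub_sq hv, Finset.sum_neg_distrib,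
    ← sum_by_parts G.N (discFlux G meth fv r σ t v) v hv.1 hv.2] at k1
  have k2 := mul_le_mul_of_nonneg_left (G.sum_len₂_mul_sub_sq_le hc hG hv) hκ
  have e : ∑ i ∈ Finset.Icc 1 G.N, G.len i * v i * v i = G.massSq v :=
    Finset.sum_congr rfl fun i _ => by ring
  rw [discForm, e]
  rw [SpaceMesh.energySq]
  linarith

end Coercivity

/-! ### The error equation and its one-step estimate -/

section ErrorEquation

variable {X : ℝ} (G : SpaceMesh X)

theorem FaceValue.eval_combo (fv : FaceValue) (b α β : ℝ) (w z : ℕ → ℝ) (i : ℕ) :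
    fv.eval b (fun j => α * w j + β * z j) i = α * fv.eval b w i + β * fv.eval b z i := by
  cases fv <;> simp only [FaceValue.eval] <;> ring

theorem discFlux_combo (meth : Method) (fv : FaceValue) (r σ : ℝ → ℝ) (t α β : ℝ)
    (w z : ℕ → ℝ) (i : ℕ) :
    discFlux G meth fv r σ t (fun j => α * w j + β * z j) i =
      α * discFlux G meth fv r σ t w i + β * discFlux G meth fv r σ t z i := by
  cases meth <;> cases i <;> simp only [discFlux, FaceValue.eval_combo] <;> ring

theorem discForm_combo (T : ℝ) (meth : Method) (fv : FaceValue) (r σ : ℝ → ℝ) (t α β : ℝ)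
    (w z v : ℕ → ℝ) :
    discForm G T meth fv r σ t (fun j => α * w j + β * z j) v =
      α * discForm G T meth fv r σ t w v + β * discForm G T meth fv r σ t z v := by
  simp only [discForm, discFlux_combo]
  simp only [mul_add, Finset.mul_sum, ← Finset.sum_add_distrib]
  exact Finset.sum_congr rfl fun i _ => by ring

/-- The scheme uses coefficients at the intermediate time but f and the nodal values at the two
ends, so the residual splits into the residuals of u at the two end times, both formed with the
intermediate coefficients. -/
theorem error_equation {T θ s e : ℝ} {meth : Method} {fv : FaceValue} {r σ : ℝ → ℝ}
    {f u : ℝ → ℝ → ℝ} {ζ ζ' v : ℕ → ℝ}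
    (hζ : (∑ i ∈ Finset.Icc 1 G.N, G.len i * ((ζ' i - ζ i) / (e - s)) * v i) +
        discForm G T meth fv r σ (θ * e + (1 - θ) * s) (fun i => θ * ζ' i + (1 - θ) * ζ i) v =
      ∑ i ∈ Finset.Icc 1 G.N, G.len i * (θ * f e (G.x i) + (1 - θ) * f s (G.x i)) * v i) :
    (∑ i ∈ Finset.Icc 1 G.N, G.len i *
        (((u e (G.node i) - ζ' i) - (u s (G.node i) - ζ i)) / (e - s)) * v i) +
      discForm G T meth fv r σ (θ * e + (1 - θ) * s) (fun i => θ * (u e (G.node i) - ζ' i) +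
        (1 - θ) * (u s (G.node i) - ζ i)) v =
    θ * schemeResidual G T meth fv r σ (θ * e + (1 - θ) * s) (u e) (f e)
        (fun x => (u e x - u s x) / (e - s)) v +
      (1 - θ) * schemeResidual G T meth fv r σ (θ * e + (1 - θ) * s) (u s) (f s)
        (fun x => (u e x - u s x) / (e - s)) v := by
  set τ := θ * e + (1 - θ) * s
  have e1 : discForm G T meth fv r σ τ (fun i => θ * (u e (G.node i) - ζ' i) +
        (1 - θ) * (u s (G.node i) - ζ i)) v =
      θ * discForm G T meth fv r σ τ (fun i => u e (G.node i)) v +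
        (1 - θ) * discForm G T meth fv r σ τ (fun i => u s (G.node i)) v -
        discForm G T meth fv r σ τ (fun i => θ * ζ' i + (1 - θ) * ζ i) v := by
    rw [← discForm_combo]
    have := discForm_combo G T meth fv r σ τ 1 (-1)
      (fun i => θ * u e (G.node i) + (1 - θ) * u s (G.node i))
      (fun i => θ * ζ' i + (1 - θ) * ζ i) v
    rw [one_mul, neg_one_mul, ← sub_eq_add_neg] at this
    rw [← this]
    congr 1
    funext i; ring
  have e2 : ∑ i ∈ Finset.Icc 1 G.N, G.len i *
        (((u e (G.node i) - ζ' i) - (u s (G.node i) - ζ i)) / (e - s)) * v i =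
      (∑ i ∈ Finset.Icc 1 G.N, G.len i * ((u e (G.node i) - u s (G.node i)) / (e - s)) * v i) -
        ∑ i ∈ Finset.Icc 1 G.N, G.len i * ((ζ' i - ζ i) / (e - s)) * v i := by
    rw [← Finset.sum_sub_distrib]
    exact Finset.sum_congr rfl fun i _ => by ring
  have e3 : ∑ i ∈ Finset.Icc 1 G.N, G.len i * (θ * f e (G.x i) + (1 - θ) * f s (G.x i)) * v i =
      θ * (∑ i ∈ Finset.Icc 1 G.N, G.len i * f e (G.x i) * v i) +
        (1 - θ) * ∑ i ∈ Finset.Icc 1 G.N, G.len i * f s (G.x i) * v i := by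
    rw [Finset.mul_sum, Finset.mul_sum, ← Finset.sum_add_distrib]
    exact Finset.sum_congr rfl fun i _ => by ring
  simp only [schemeResidual]
  rw [e1, e2]
  rw [e3] at hζ
  linear_combination (-1) * hζ

/-- The two sides differ by (θ - 1/2) times the squared mass norm of the increment; this is where θ
≥ 1/2 is used. -/
theorem half_massSq_sub_le {θ : ℝ} (hθ : θ ∈ Icc (1 / 2 : ℝ) 1) (w w' : ℕ → ℝ) :
    (G.massSq w' - G.massSq w) / 2 ≤
      ∑ i ∈ Finset.Icc 1 G.N, G.len i * (w' i - w i) * (θ * w' i + (1 - θ) * w i) := by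
  rw [SpaceMesh.massSq, SpaceMesh.massSq, ← Finset.sum_sub_distrib, Finset.sum_div]
  refine Finset.sum_le_sum fun i hi => ?_
  have hl := G.len_pos (i := i) (by have := Finset.mem_Icc.1 hi; omega)
  have : 0 ≤ G.len i * ((θ - 1 / 2) * (w' i - w i) ^ 2) :=
    mul_nonneg hl.le (mul_nonneg (by linarith [hθ.1]) (sq_nonneg _))
  linarith

theorem massSq_combo_le {θ : ℝ} (hθ : θ ∈ Icc (1 / 2 : ℝ) 1) (w w' : ℕ → ℝ) :
    G.massSq (fun i => θ * w' i + (1 - θ) * w i) ≤ G.massSq w' + G.massSq w := by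
  rw [SpaceMesh.massSq, SpaceMesh.massSq, SpaceMesh.massSq, ← Finset.sum_add_distrib]
  refine Finset.sum_le_sum fun i hi => ?_
  have hl := G.len_pos (i := i) (by have := Finset.mem_Icc.1 hi; omega)
  rw [← mul_add]
  refine mul_le_mul_of_nonneg_left ?_ hl.le
  have h0 : 0 ≤ θ := by linarith [hθ.1]
  have h1 : 0 ≤ 1 - θ := by linarith [hθ.2]
  have k1 := mul_nonneg (mul_nonneg h0 h1) (sq_nonneg (w' i - w i))
  have k2 := mul_nonneg h1 (sq_nonneg (w' i))
  have k3 := mul_nonneg h0 (sq_nonneg (w i))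
  linarith

end ErrorEquation

/-- Bounds and Lipschitz constants of the coefficients, with the lower bound that makes the form
coercive. -/
structure CoefBounds (T : ℝ) (r σ : ℝ → ℝ) (A al Λ : ℝ) : Prop where
  le_a : ∀ t ∈ Icc 0 T, al ≤ coefA σ t
  abs_a : ∀ t ∈ Icc 0 T, |coefA σ t| ≤ A
  abs_b : ∀ t ∈ Icc 0 T, |coefB r σ t| ≤ A
  abs_c : ∀ t ∈ Icc 0 T, |coefC T r σ t| ≤ A
  lip_nonneg : 0 ≤ Λ
  lip_a : ∀ t ∈ Icc 0 T, ∀ s ∈ Icc 0 T, |coefA σ t - coefA σ s| ≤ Λ * |t - s|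
  lip_b : ∀ t ∈ Icc 0 T, ∀ s ∈ Icc 0 T, |coefB r σ t - coefB r σ s| ≤ Λ * |t - s|
  lip_c : ∀ t ∈ Icc 0 T, ∀ s ∈ Icc 0 T, |coefC T r σ t - coefC T r σ s| ≤ Λ * |t - s|
  a_le : ∀ t ∈ Icc 0 T, coefA σ t ≤ coefC T r σ t - coefB r σ t / 2

section Step

variable {X T : ℝ} {r σ : ℝ → ℝ} {f u du df p : ℝ → ℝ → ℝ} {k₁ k₂ : ℝ → ℝ} {K : ℝ}

theorem RegularData.memVh_sub (D : RegularData X T r σ f u du df p k₁ k₂ K) (G : SpaceMesh X)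
    {t : ℝ} (ht : t ∈ Icc 0 T) {ζ : ℕ → ℝ} (hζ : G.MemVh ζ) :
    G.MemVh fun i => u t (G.node i) - ζ i := by
  refine ⟨?_, ?_⟩
  · simp only
    rw [G.node_zero, hζ.1, (D.snap t ht).u_eq 0 ⟨le_rfl, G.X_pos.le⟩,
      intervalIntegral.integral_same, sub_zero]
  · simp only
    rw [G.node_last, hζ.2, (D.snap t ht).u_last, sub_zero]

/-- The factor e - s is the one gained when the energy inequality is multiplied by the time step;
the right sides then add up to one integral over (0, T). -/
theorem RegularData.mul_integral_sq_le (D : RegularData X T r σ f u du df p k₁ k₂ K) {s e : ℝ}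
    (hs : s ∈ Icc 0 T) (he : e ∈ Icc 0 T) (hse : s < e) :
    (e - s) * ∫ x in 0..X, ((du e x - du s x) / (e - s)) ^ 2 ≤ ∫ t in s..e, k₁ t := by
  have hk : 0 < e - s := sub_pos.2 hse
  have h := D.du_diff s hs e he hse.le
  have e1 : ∫ x in 0..X, ((du e x - du s x) / (e - s)) ^ 2 =
      (∫ x in 0..X, (du e x - du s x) ^ 2) / (e - s) ^ 2 := by
    rw [← intervalIntegral.integral_div]
    simp only [div_pow]
  rw [e1, mul_div_assoc', div_le_iff₀ (by positivity), sq, ← mul_assoc, mul_comm _ (e - s)]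
  have := mul_le_mul_of_nonneg_left h hk.le
  linarith

theorem RegularData.snap_quotient (D : RegularData X T r σ f u du df p k₁ k₂ K) {s e : ℝ}
    (hs : s ∈ Icc 0 T) (he : e ∈ Icc 0 T) :
    MemLp (fun x => (du e x - du s x) / (e - s)) 2 (dom X) ∧
      ∀ x ∈ Icc 0 X, (u e x - u s x) / (e - s) = ∫ y in 0..x, (du e y - du s y) / (e - s) := by
  have me := (D.snap e he).mem_du
  have ms := (D.snap s hs).mem_du
  refine ⟨?_, fun x hx => ?_⟩
  · simp only [div_eq_mul_inv]
    exact (me.sub ms).mul_const _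
  · have m0 : (0 : ℝ) ∈ Icc 0 X := ⟨le_rfl, hx.1.trans hx.2⟩
    rw [intervalIntegral.integral_div, intervalIntegral.integral_sub
      (MemLp.intervalIntegrable_dom me m0 hx) (MemLp.intervalIntegrable_dom ms m0 hx),
      ← (D.snap e he).u_eq x hx, ← (D.snap s hs).u_eq x hx]

/-- The error equation is tested with the θ-average of the errors at both ends. Coercivity absorbs
the energy part of the residual, and the κ-term stays as the growth factor on both sides. -/
theorem exists_massSq_step_le {c A al : ℝ} (X : ℝ) (hc : 0 < c) (hal : 0 < al) :
    ∃ C, 0 < C ∧ ∀ (T Λ K θ κ s e d : ℝ) (r σ : ℝ → ℝ) (f u du df p : ℝ → ℝ → ℝ)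
      (k₁ k₂ : ℝ → ℝ) (G : SpaceMesh X) (meth : Method) (fv : FaceValue) (ζ ζ' : ℕ → ℝ),
      CoefBounds T r σ A al Λ → RegularData X T r σ f u du df p k₁ k₂ K →
      θ ∈ Icc (1 / 2 : ℝ) 1 → G.QuasiUniform c → 0 ≤ κ →
      (fv = .reversed → ∀ t ∈ Icc 0 T, 3 / 8 * (coefB r σ t ^ 2 / coefA σ t) ≤ κ) →
      s ∈ Icc 0 T → e ∈ Icc 0 T → s < e → e - s ≤ d → G.MemVh ζ → G.MemVh ζ' →
      (∀ v, G.MemVh v →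
        (∑ i ∈ Finset.Icc 1 G.N, G.len i * ((ζ' i - ζ i) / (e - s)) * v i) +
          discForm G T meth fv r σ (θ * e + (1 - θ) * s) (fun i => θ * ζ' i + (1 - θ) * ζ i) v =
        ∑ i ∈ Finset.Icc 1 G.N, G.len i * (θ * f e (G.x i) + (1 - θ) * f s (G.x i)) * v i) →
      (1 - 8 * (1 + c) * κ * (e - s)) * G.massSq (fun i => u e (G.node i) - ζ' i) ≤
        (1 + 8 * (1 + c) * κ * (e - s)) * G.massSq (fun i => u s (G.node i) - ζ i) +
          C * (G.h + d) ^ 2 * (2 * (1 + Λ) ^ 2 * K * (e - s) + (∫ t in s..e, k₁ t) +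
            ∫ t in s..e, k₂ t) := by
  obtain ⟨C₀, hC₀, hres⟩ := exists_schemeResidual_le (c := c) (A := A) (al := al) X hc hal
  -- The Young parameter is al/2, exactly the coercivity constant of the energy part; the leading 2
  -- clears the 1/2 in `half_massSq_sub_le`.
  refine ⟨2 * (C₀ / (al / 2)), by positivity, ?_⟩
  intro T Λ K θ κ s e d r σ f u du df p k₁ k₂ G meth fv ζ ζ' hB D hθ hG hκ hfv hs he hse hd hζ hζ'
    hsch
  have hk : 0 < e - s := sub_pos.2 hse
  have hh := G.h_pos
  have hX := G.X_pos
  have hd0 : 0 < d := hk.trans_le hd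
  have hΛ := hB.lip_nonneg
  have h0 : 0 ≤ θ := by linarith [hθ.1]
  have h1 : 0 ≤ 1 - θ := by linarith [hθ.2]
  set w := fun i => u s (G.node i) - ζ i with hw
  set w' := fun i => u e (G.node i) - ζ' i with hw'
  have mw : G.MemVh w := D.memVh_sub G hs hζ
  have mw' : G.MemVh w' := D.memVh_sub G he hζ'
  set v := fun i => θ * w' i + (1 - θ) * w i with hvdef
  have mv : G.MemVh v := by
    refine ⟨?_, ?_⟩
    · simp only [hvdef]; rw [mw.1, mw'.1]; ring
    · simp only [hvdef]; rw [mw.2, mw'.2]; ring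
  set τ := θ * e + (1 - θ) * s with hτ
  have hτs : s ≤ τ := by linarith [mul_nonneg h0 hk.le]
  have hτe : τ ≤ e := by linarith [mul_nonneg h1 hk.le]
  have mτ : τ ∈ Icc 0 T := ⟨hs.1.trans hτs, hτe.trans he.2⟩
  have heq := error_equation G (u := u) (hsch v mv)
  change (∑ i ∈ Finset.Icc 1 G.N, G.len i * ((w' i - w i) / (e - s)) * v i) +
    discForm G T meth fv r σ τ v v = _ at heq
  obtain ⟨mdq, hdq⟩ := D.snap_quotient hs he
  set Q := (G.h + Λ * d) ^ 2 * (2 * K) +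
    G.h ^ 2 * (∫ x in 0..X, ((du e x - du s x) / (e - s)) ^ 2) + (e - s) * ∫ t in s..e, k₂ t with hQ
  have hR : ∀ z ∈ Icc s e, schemeResidual G T meth fv r σ τ (u z) (f z)
      (fun x => (u e x - u s x) / (e - s)) v ≤
      al / 2 * (G.massSq v + G.energySq v) + C₀ / (al / 2) * Q := by
    intro z hz
    have mz : z ∈ Icc 0 T := ⟨hs.1.trans hz.1, hz.2.trans he.2⟩
    have hτz : |τ - z| ≤ d := by
      rw [abs_le]; constructor <;> linarith [hz.1, hz.2]
    have hle := mul_le_mul_of_nonneg_left hτz hΛ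
    refine (hres G T τ _ _ _ (Λ * d) (al / 2) meth fv r σ _ _ _ _ _ _ _ v hG (D.snap z mz) mdq hdq
      (hB.le_a z mz) (hB.abs_a z mz) (hB.abs_b z mz) (hB.abs_c z mz) (hB.abs_a τ mτ)
      (hB.abs_b τ mτ) ((hB.lip_a τ mτ z mz).trans hle) ((hB.lip_b τ mτ z mz).trans hle)
      ((hB.lip_c τ mτ z mz).trans hle) (by positivity) mv).trans ?_
    refine add_le_add le_rfl (mul_le_mul_of_nonneg_left ?_ (by positivity))
    rw [hQ]
    have k1 := mul_le_mul_of_nonneg_left (add_le_add (D.du_le z mz) (D.df_le z mz))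
      (sq_nonneg (G.h + Λ * d))
    have k2 := D.p_diff s hs e he hse z hz
    linarith
  have hRe := mul_le_mul_of_nonneg_left (hR e ⟨hse.le, le_rfl⟩) h0
  have hRs := mul_le_mul_of_nonneg_left (hR s ⟨le_rfl, hse.le⟩) h1
  have hcoer := le_discForm G hc hG T meth fv (hal.trans_le (hB.le_a τ mτ)) hκ
    (fun h => hfv h τ mτ) mv
  have n1 := G.massSq_nonneg v
  have n2 := G.energySq_nonneg v
  have hcoer' : al / 2 * G.energySq v + (al - 4 * (1 + c) * κ) * G.massSq v ≤
      discForm G T meth fv r σ τ v v := by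
    have k1 := mul_le_mul_of_nonneg_right (hB.le_a τ mτ) n2
    have k2 := mul_le_mul_of_nonneg_right ((hB.le_a τ mτ).trans (hB.a_le τ mτ)) n1
    linarith
  have hsum : (∑ i ∈ Finset.Icc 1 G.N, G.len i * ((w' i - w i) / (e - s)) * v i) =
      (∑ i ∈ Finset.Icc 1 G.N, G.len i * (w' i - w i) * v i) / (e - s) := by
    rw [Finset.sum_div]
    exact Finset.sum_congr rfl fun i _ => by ring
  have hhalf := half_massSq_sub_le G hθ w w'
  change _ ≤ ∑ i ∈ Finset.Icc 1 G.N, G.len i * (w' i - w i) * v i at hhalf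
  have hcombo : G.massSq v ≤ G.massSq w' + G.massSq w := massSq_combo_le G hθ w w'
  set P := ∑ i ∈ Finset.Icc 1 G.N, G.len i * (w' i - w i) * v i
  have hP : P / (e - s) ≤ 4 * (1 + c) * κ * G.massSq v + C₀ / (al / 2) * Q := by
    have n3 : 0 ≤ al / 2 * G.massSq v := by positivity
    rw [hsum] at heq
    linarith
  rw [div_le_iff₀ hk] at hP
  have hkQ : (e - s) * Q ≤ (G.h + d) ^ 2 * (2 * (1 + Λ) ^ 2 * K * (e - s) + (∫ t in s..e, k₁ t) +
      ∫ t in s..e, k₂ t) := by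
    have i1 : 0 ≤ ∫ t in s..e, k₁ t :=
      intervalIntegral.integral_nonneg hse.le fun t _ => D.k₁_nonneg t
    have i2 : 0 ≤ ∫ t in s..e, k₂ t :=
      intervalIntegral.integral_nonneg hse.le fun t _ => D.k₂_nonneg t
    have hK : 0 ≤ K := (intervalIntegral.integral_nonneg hX.le fun _ _ => sq_nonneg _).trans
      (D.du_le s hs)
    have q1 : (G.h + Λ * d) ^ 2 ≤ (G.h + d) ^ 2 * (1 + Λ) ^ 2 := by
      rw [← mul_pow]
      refine pow_le_pow_left₀ (by positivity) ?_ 2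
      linarith [mul_nonneg hh.le hΛ]
    have q2 : G.h ^ 2 ≤ (G.h + d) ^ 2 := pow_le_pow_left₀ hh.le (by linarith) 2
    -- One factor comes from multiplying by the time step, the other from the bound on ∂ₜu minus the
    -- difference quotient.
    have q3 : (e - s) * (e - s) ≤ (G.h + d) ^ 2 := by
      rw [sq]; exact mul_le_mul (by linarith) (by linarith) hk.le (by linarith)
    have j1 := mul_le_mul_of_nonneg_right q1 (by positivity : 0 ≤ 2 * K * (e - s))
    have j2 := mul_le_mul_of_nonneg_left (D.mul_integral_sq_le hs he hse) (sq_nonneg G.h)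
    have j3 := mul_le_mul_of_nonneg_right q2 i1
    have j4 := mul_le_mul_of_nonneg_right q3 i2
    rw [hQ]
    linarith
  have hCkQ := mul_le_mul_of_nonneg_left hkQ (by positivity : 0 ≤ C₀ / (al / 2))
  have hκk : 0 ≤ 8 * (1 + c) * κ * (e - s) := by positivity
  have hfin := mul_le_mul_of_nonneg_left hcombo hκk
  linarith

end Step

/-! ### The global error estimate -/

theorem discrete_gronwall {n : ℕ} {S x g : ℕ → ℝ} (hx : ∀ m < n, 0 ≤ x m ∧ x m ≤ 1 / 2)
    (hS : ∀ m ≤ n, 0 ≤ S m) (hg : ∀ m < n, 0 ≤ g m)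
    (h : ∀ m < n, (1 - x m) * S (m + 1) ≤ (1 + x m) * S m + g m) {m : ℕ} (hm : m ≤ n) :
    S m ≤ Real.exp (4 * ∑ j ∈ Finset.range m, x j) *
      (S 0 + 2 * ∑ j ∈ Finset.range m, g j) := by
  induction m with
  | zero => simp
  | succ m ih =>
    have ih := ih (by omega)
    obtain ⟨x0, x1⟩ := hx m (by omega)
    have g0 := hg m (by omega)
    have s0 := hS m (by omega)
    -- For 0 ≤ x ≤ 1/2 one has 1 + x ≤ (1 - x)(1 + 4x) and 1 ≤ 2(1 - x), so the recursion can be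
    -- divided by 1 - x.
    have hstep : S (m + 1) ≤ (1 + 4 * x m) * S m + 2 * g m := by
      have k1 : (1 - x m) * S (m + 1) ≤ (1 - x m) * ((1 + 4 * x m) * S m + 2 * g m) := by
        refine (h m (by omega)).trans ?_
        have k2 : 0 ≤ x m * (1 - 2 * x m) * S m :=
          mul_nonneg (mul_nonneg x0 (by linarith)) s0
        have k3 : 0 ≤ (1 - 2 * x m) * g m := mul_nonneg (by linarith) g0
        linarith
      exact le_of_mul_le_mul_left k1 (by linarith)
    rw [Finset.sum_range_succ, Finset.sum_range_succ, mul_add 4, Real.exp_add]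
    have hE : 1 ≤ Real.exp (4 * ∑ j ∈ Finset.range m, x j) :=
      Real.one_le_exp (mul_nonneg (by norm_num) (Finset.sum_nonneg fun j hj =>
        (hx j (by have := Finset.mem_range.1 hj; omega)).1))
    have hE1 : 1 + 4 * x m ≤ Real.exp (4 * x m) := by
      linarith [Real.add_one_le_exp (4 * x m)]
    set E := Real.exp (4 * ∑ j ∈ Finset.range m, x j)
    set E₁ := Real.exp (4 * x m)
    have p1 : (1 + 4 * x m) * S m ≤ E₁ * (E * (S 0 + 2 * ∑ j ∈ Finset.range m, g j)) :=
      mul_le_mul hE1 ih s0 (by positivity)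
    have p2 : 1 * (2 * g m) ≤ (E * E₁) * (2 * g m) :=
      mul_le_mul_of_nonneg_right (one_le_mul_of_one_le_of_one_le hE (by linarith)) (by linarith)
    linarith

namespace TimeMesh

variable {T : ℝ} (S : TimeMesh T)

theorem t_mono {m n : ℕ} (hmn : m ≤ n) (hn : n ≤ S.M) : S.t m ≤ S.t n := by
  induction n, hmn using Nat.le_induction with
  | base => exact le_rfl
  | succ n hmn ih => exact (ih (by omega)).trans (S.t_lt n (by omega)).le

theorem t_mem {m : ℕ} (hm : m ≤ S.M) : S.t m ∈ Icc 0 T :=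
  ⟨S.t_zero ▸ S.t_mono (Nat.zero_le m) hm, (S.t_mono hm le_rfl).trans S.t_last.le⟩

theorem sub_le_dt {m : ℕ} (hm : m < S.M) : S.t (m + 1) - S.t m ≤ S.dt :=
  Finset.le_sup' (fun m => S.t (m + 1) - S.t m) (Finset.mem_range.2 hm)

theorem dt_pos : 0 < S.dt :=
  (sub_pos.2 (S.t_lt 0 S.M_pos)).trans_le (S.sub_le_dt S.M_pos)

theorem sum_integral_le {k : ℝ → ℝ} (hk : ∀ t, 0 ≤ k t) (hi : IntegrableOn k (Ioo 0 T)) {m : ℕ}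
    (hm : m ≤ S.M) : ∑ j ∈ Finset.range m, ∫ t in S.t j..S.t (j + 1), k t ≤ ∫ t in 0..T, k t := by
  have hT : 0 ≤ T := (S.t_mem hm).1.trans (S.t_mem hm).2
  rw [intervalIntegral.sum_integral_adjacent_intervals fun j hj =>
    intervalIntegrable_of_Ioo hi (S.t_mem (by omega)) (S.t_mem (by omega)), S.t_zero]
  exact intervalIntegral.integral_mono_interval le_rfl (S.t_mem hm).1 (S.t_mem hm).2
    (Eventually.of_forall hk)
    (intervalIntegrable_of_Ioo hi ⟨le_rfl, hT⟩ ⟨hT, le_rfl⟩)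

end TimeMesh

section Global

variable {X T : ℝ} {r σ : ℝ → ℝ} {f u du df p : ℝ → ℝ → ℝ} {k₁ k₂ : ℝ → ℝ} {K : ℝ}

/-- This is the price of the comparison points. It is paid twice: for the initial values and when
returning to u(x_i) at the end. -/
theorem RegularData.massSq_node_sub_le (D : RegularData X T r σ f u du df p k₁ k₂ K)
    (G : SpaceMesh X) {t : ℝ} (ht : t ∈ Icc 0 T) :
    G.massSq (fun i => u t (G.node i) - u t (G.x i)) ≤ 168 * G.h ^ 2 * K := by
  have S := D.snap t ht
  refine le_trans (Finset.sum_le_sum fun i hi => ?_) ((G.sum_len_mul_osc_sq_le S.mem_du).trans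
    (mul_le_mul_of_nonneg_left (D.du_le t ht) (by positivity)))
  obtain ⟨h1, hiN⟩ := Finset.mem_Icc.1 hi
  refine mul_le_mul_of_nonneg_left ?_ (G.len_pos (by omega)).le
  beta_reduce
  rw [← sq_abs, S.u_eq _ (G.node_mem (by omega)), S.u_eq _ (G.x_mem (by omega))]
  exact pow_le_pow_left₀ (abs_nonneg _) (G.abs_sub_le_osc_add S.mem_du h1 hiN
    (G.node_mem_hull h1 hiN) (G.x_mem_hull h1 hiN)) 2

theorem exists_error_estimate {c A al θ κ₀ Λ : ℝ} (hX : 0 < X) (hT : 0 < T) (hc : 0 < c)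
    (hal : 0 < al) (hB : CoefBounds T r σ A al Λ) (D : RegularData X T r σ f u du df p k₁ k₂ K)
    (hθ : θ ∈ Icc (1 / 2 : ℝ) 1) (hκ₀ : 0 ≤ κ₀)
    (hκ : ∀ t ∈ Icc 0 T, 3 / 8 * (coefB r σ t ^ 2 / coefA σ t) ≤ κ₀) {u₀ : ℝ → ℝ}
    (hu₀ : ∀ x ∈ Icc 0 X, u 0 x = u₀ x) :
    ∃ C : ℝ, 0 < C ∧ ∀ (G : SpaceMesh X) (S : TimeMesh T) (meth : Method) (fv : FaceValue)
      (ζ : ℕ → ℕ → ℝ), G.QuasiUniform c →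
      (fv = .reversed → 8 * (1 + c) * κ₀ * S.dt ≤ 1 / 2) →
      IsDiscreteSolution G S meth fv θ r σ f u₀ ζ → ∀ m ≤ S.M,
        G.norm0 (fun i => u (S.t m) (G.x i) - ζ m i) ≤ C * (G.h + S.dt) := by
  obtain ⟨C₀, hC₀, hstep⟩ := exists_massSq_step_le (c := c) (A := A) (al := al) X hc hal
  have hK : 0 ≤ K := (intervalIntegral.integral_nonneg hX.le fun _ _ => sq_nonneg _).trans
    (D.du_le 0 ⟨le_rfl, hT.le⟩)
  set I₁ := ∫ t in 0..T, k₁ t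
  set I₂ := ∫ t in 0..T, k₂ t
  have hI₁ : 0 ≤ I₁ := intervalIntegral.integral_nonneg hT.le fun t _ => D.k₁_nonneg t
  have hI₂ : 0 ≤ I₂ := intervalIntegral.integral_nonneg hT.le fun t _ => D.k₂_nonneg t
  set B := 168 * K + 2 * (C₀ * (2 * (1 + Λ) ^ 2 * K * T + I₁ + I₂)) with hBdef
  have hB0 : 0 ≤ B := by positivity
  set E := Real.exp (4 * (8 * (1 + c) * κ₀ * T)) with hE
  refine ⟨√(2 * (E * B) + 2 * (168 * K)) + 1, by positivity, ?_⟩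
  rintro G S meth fv ζ hG hdt ⟨hV, h0, hsch⟩ m hm
  have hh := G.h_pos
  have hd := S.dt_pos
  -- The upwind scheme loses nothing, so κ = 0 and no restriction on the time step arises.
  obtain ⟨κ, hκ0, hκle, hfv, hκdt⟩ : ∃ κ, 0 ≤ κ ∧ κ ≤ κ₀ ∧
      (fv = .reversed → ∀ t ∈ Icc 0 T, 3 / 8 * (coefB r σ t ^ 2 / coefA σ t) ≤ κ) ∧
      8 * (1 + c) * κ * S.dt ≤ 1 / 2 := by
    cases fv with
    | upwind => exact ⟨0, le_rfl, hκ₀, by simp, by simp⟩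
    | reversed => exact ⟨κ₀, hκ₀, le_rfl, fun _ => hκ, hdt rfl⟩
  set w := fun n => G.massSq fun i => u (S.t n) (G.node i) - ζ n i with hw
  set H := (G.h + S.dt) ^ 2 with hH
  have hhH : G.h ^ 2 ≤ H := pow_le_pow_left₀ hh.le (by linarith) 2
  set g := fun j => C₀ * H * (2 * (1 + Λ) ^ 2 * K * (S.t (j + 1) - S.t j) +
    (∫ t in S.t j..S.t (j + 1), k₁ t) + ∫ t in S.t j..S.t (j + 1), k₂ t) with hg
  have hgr := discrete_gronwall (n := S.M) (S := w) (g := g)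
    (x := fun j => 8 * (1 + c) * κ * (S.t (j + 1) - S.t j))
    (fun j hj => by
      have h1 := S.t_lt j hj
      have h2 := S.sub_le_dt hj
      exact ⟨mul_nonneg (by positivity) (by linarith),
        (mul_le_mul_of_nonneg_left h2 (by positivity)).trans hκdt⟩)
    (fun j _ => G.massSq_nonneg _)
    (fun j hj => by
      have h1 := S.t_lt j hj
      have i1 : 0 ≤ ∫ t in S.t j..S.t (j + 1), k₁ t :=
        intervalIntegral.integral_nonneg h1.le fun t _ => D.k₁_nonneg t
      have i2 : 0 ≤ ∫ t in S.t j..S.t (j + 1), k₂ t :=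
        intervalIntegral.integral_nonneg h1.le fun t _ => D.k₂_nonneg t
      have i3 : 0 ≤ S.t (j + 1) - S.t j := by linarith
      simp only [hg]
      positivity)
    (fun j hj => hstep T Λ K θ κ (S.t j) (S.t (j + 1)) S.dt r σ f u du df p k₁ k₂ G meth fv
      (ζ j) (ζ (j + 1)) hB D hθ hG hκ0 hfv (S.t_mem (by omega)) (S.t_mem (by omega)) (S.t_lt j hj)
      (S.sub_le_dt hj) (hV j (by omega)) (hV (j + 1) (by omega)) (hsch j hj)) hm
  have hsumt : ∑ j ∈ Finset.range m, (S.t (j + 1) - S.t j) ≤ T := by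
    rw [Finset.sum_range_sub, S.t_zero, sub_zero]; exact (S.t_mem hm).2
  -- The initial error is not zero: the scheme starts from u₀(x_i), while the comparison takes u at
  -- the nodes.
  have hw0 : w 0 ≤ H * (168 * K) := by
    have k1 := D.massSq_node_sub_le G (t := 0) ⟨le_rfl, hT.le⟩
    have k2 : w 0 = G.massSq (fun i => u 0 (G.node i) - u 0 (G.x i)) := by
      refine Finset.sum_congr rfl fun i hi => ?_
      simp only
      rw [S.t_zero, h0 i hi, hu₀ _ (G.x_mem (by have := Finset.mem_Icc.1 hi; omega))]
    have k3 := mul_le_mul_of_nonneg_right hhH (by positivity : 0 ≤ 168 * K)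
    linarith
  have hsumg : ∑ j ∈ Finset.range m, g j ≤ C₀ * H * (2 * (1 + Λ) ^ 2 * K * T + I₁ + I₂) := by
    simp only [hg]
    rw [← Finset.mul_sum, Finset.sum_add_distrib, Finset.sum_add_distrib, ← Finset.mul_sum]
    refine mul_le_mul_of_nonneg_left (add_le_add (add_le_add ?_ ?_) ?_) (by positivity)
    · exact mul_le_mul_of_nonneg_left hsumt (by positivity)
    · exact S.sum_integral_le D.k₁_nonneg D.k₁_int hm
    · exact S.sum_integral_le D.k₂_nonneg D.k₂_int hm
  have hexp : Real.exp (4 * ∑ j ∈ Finset.range m, 8 * (1 + c) * κ * (S.t (j + 1) - S.t j)) ≤ E := by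
    rw [← Finset.mul_sum, hE]
    refine Real.exp_le_exp.2 (mul_le_mul_of_nonneg_left ?_ (by norm_num))
    calc 8 * (1 + c) * κ * ∑ j ∈ Finset.range m, (S.t (j + 1) - S.t j)
        ≤ 8 * (1 + c) * κ * T := mul_le_mul_of_nonneg_left hsumt (by positivity)
      _ ≤ 8 * (1 + c) * κ₀ * T := mul_le_mul_of_nonneg_right
          (mul_le_mul_of_nonneg_left hκle (by positivity)) hT.le
  have hwm : w m ≤ E * (B * H) := by
    refine hgr.trans (mul_le_mul hexp ?_ ?_ (Real.exp_pos _).le)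
    · rw [hBdef]; linarith
    · refine add_nonneg (G.massSq_nonneg _) (mul_nonneg (by norm_num) (Finset.sum_nonneg ?_))
      intro j hj
      have h1 := S.t_lt j (by have := Finset.mem_range.1 hj; omega)
      have i1 : 0 ≤ ∫ t in S.t j..S.t (j + 1), k₁ t :=
        intervalIntegral.integral_nonneg h1.le fun t _ => D.k₁_nonneg t
      have i2 : 0 ≤ ∫ t in S.t j..S.t (j + 1), k₂ t :=
        intervalIntegral.integral_nonneg h1.le fun t _ => D.k₂_nonneg t
      have i3 : 0 ≤ S.t (j + 1) - S.t j := by linarith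
      simp only [hg]
      positivity
  have hfinal : G.massSq (fun i => u (S.t m) (G.x i) - ζ m i) ≤
      (2 * (E * B) + 2 * (168 * K)) * H := by
    have k1 := D.massSq_node_sub_le G (S.t_mem hm)
    have k2 : G.massSq (fun i => u (S.t m) (G.x i) - ζ m i) ≤ 2 * w m +
        2 * G.massSq (fun i => u (S.t m) (G.node i) - u (S.t m) (G.x i)) := by
      simp only [hw, SpaceMesh.massSq]
      rw [Finset.mul_sum, Finset.mul_sum, ← Finset.sum_add_distrib]
      refine Finset.sum_le_sum fun i hi => ?_
      have hl := G.len_pos (i := i) (by have := Finset.mem_Icc.1 hi; omega)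
      have := mul_nonneg hl.le (sq_nonneg ((u (S.t m) (G.node i) - ζ m i) +
        (u (S.t m) (G.node i) - u (S.t m) (G.x i))))
      linarith
    have k3 := mul_le_mul_of_nonneg_right hhH (by positivity : 0 ≤ 168 * K)
    linarith
  have hs : 0 < G.h + S.dt := by linarith
  calc G.norm0 (fun i => u (S.t m) (G.x i) - ζ m i)
      ≤ √((2 * (E * B) + 2 * (168 * K)) * H) := Real.sqrt_le_sqrt hfinal
    _ = √(2 * (E * B) + 2 * (168 * K)) * (G.h + S.dt) := by
        rw [Real.sqrt_mul (by positivity), hH, Real.sqrt_sq hs.le]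
    _ ≤ (√(2 * (E * B) + 2 * (168 * K)) + 1) * (G.h + S.dt) := by
        rw [add_mul]; linarith

end Global

/-! ### Bounds for the coefficients -/

theorem exists_coefBounds {T : ℝ} {r σ : ℝ → ℝ} {rbar σlow σbar : ℝ} (hT : 0 < T)
    (hσlow : 0 < σlow) (hr : ∀ t ∈ Icc 0 T, 0 ≤ r t ∧ r t ≤ rbar)
    (hσ : ∀ t ∈ Icc 0 T, σlow ≤ σ t ∧ σ t ≤ σbar)
    (hrLip : ∃ K, LipschitzOnWith K r (Icc 0 T)) (hσLip : ∃ K, LipschitzOnWith K σ (Icc 0 T)) :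
    ∃ A Λ, CoefBounds T r σ A (σlow ^ 2 / 2) Λ := by
  obtain ⟨Kr, hKr⟩ := hrLip
  obtain ⟨Ks, hKs⟩ := hσLip
  have m0 : (0 : ℝ) ∈ Icc 0 T := ⟨le_rfl, hT.le⟩
  have hr0 : 0 ≤ rbar := (hr 0 m0).1.trans (hr 0 m0).2
  have hsb : 0 < σbar := hσlow.trans_le ((hσ 0 m0).1.trans (hσ 0 m0).2)
  have hs2 : ∀ t ∈ Icc 0 T, σlow ^ 2 ≤ σ t ^ 2 ∧ σ t ^ 2 ≤ σbar ^ 2 := fun t ht =>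
    ⟨pow_le_pow_left₀ hσlow.le (hσ t ht).1 2,
      pow_le_pow_left₀ (hσlow.le.trans (hσ t ht).1) (hσ t ht).2 2⟩
  have hβ1 : ∀ t ∈ Icc 0 T, σ t ^ 2 ≤ beta T σ := fun t ht =>
    le_csSup ⟨σbar ^ 2, by rintro _ ⟨s, hs, rfl⟩; exact (hs2 s hs).2⟩ ⟨t, ht, rfl⟩
  have hβ2 : beta T σ ≤ σbar ^ 2 := by
    refine csSup_le ⟨_, ⟨0, m0, rfl⟩⟩ ?_
    rintro _ ⟨s, hs, rfl⟩
    exact (hs2 s hs).2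
  have lr : ∀ t ∈ Icc 0 T, ∀ s ∈ Icc 0 T, |r t - r s| ≤ Kr * |t - s| := fun t ht s hs => by
    simpa [Real.dist_eq] using hKr.dist_le_mul t ht s hs
  have ls : ∀ t ∈ Icc 0 T, ∀ s ∈ Icc 0 T,
      |σ t ^ 2 - σ s ^ 2| ≤ 2 * σbar * Ks * |t - s| := fun t ht s hs => by
    have h1 : |σ t - σ s| ≤ Ks * |t - s| := by
      simpa [Real.dist_eq] using hKs.dist_le_mul t ht s hs
    have h2 : |σ t + σ s| ≤ 2 * σbar := by
      rw [abs_of_nonneg (by linarith [(hσ t ht).1, (hσ s hs).1])]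
      linarith [(hσ t ht).2, (hσ s hs).2]
    calc |σ t ^ 2 - σ s ^ 2| = |σ t + σ s| * |σ t - σ s| := by rw [← abs_mul]; congr 1; ring
      _ ≤ 2 * σbar * (Ks * |t - s|) := mul_le_mul h2 h1 (abs_nonneg _) (by positivity)
      _ = _ := by ring
  have n1 : ∀ x : ℝ, 0 ≤ (Kr : ℝ) * |x| := fun x => by positivity
  have n2 : ∀ x : ℝ, 0 ≤ 2 * σbar * Ks * |x| := fun x => by positivity
  refine ⟨2 * rbar + σbar ^ 2, 2 * Kr + 2 * σbar * Ks, ?_, ?_, ?_, ?_, by positivity, ?_, ?_, ?_,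
    ?_⟩
  · intro t ht; rw [coefA]; linarith [(hs2 t ht).1]
  · intro t ht
    rw [coefA, abs_of_nonneg (by positivity)]
    linarith [(hs2 t ht).2, sq_nonneg (σ t)]
  · intro t ht
    rw [coefB, abs_le]
    constructor <;> linarith [(hs2 t ht).2, sq_nonneg (σ t), (hr t ht).1, (hr t ht).2,
      sq_nonneg σbar]
  · intro t ht
    rw [coefC, abs_le]
    constructor <;> linarith [hβ1 t ht, sq_nonneg (σ t), (hr t ht).1, (hr t ht).2]
  · intro t ht s hs
    have h1 := abs_le.1 (ls t ht s hs)
    rw [coefA, coefA, abs_le]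
    constructor <;> linarith [h1.1, h1.2, n1 (t - s), n2 (t - s)]
  · intro t ht s hs
    have h1 := abs_le.1 (ls t ht s hs)
    have h2 := abs_le.1 (lr t ht s hs)
    rw [coefB, coefB, abs_le]
    constructor <;> linarith [h1.1, h1.2, h2.1, h2.2, n1 (t - s)]
  · intro t ht s hs
    have h1 := abs_le.1 (ls t ht s hs)
    have h2 := abs_le.1 (lr t ht s hs)
    rw [coefC, coefC, abs_le]
    constructor <;> linarith [h1.1, h1.2, h2.1, h2.2, n1 (t - s)]
  -- Here c₀ - b/2 = 3r/2 + β - σ²/2, and β ≥ σ² together with r ≥ 0 leaves at least σ²/2 = a.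
  · intro t ht
    rw [coefA, coefB, coefC]
    linarith [hβ1 t ht, (hr t ht).1]

end BlackScholes

end

/-! ### Conclusion: choice of δ and assembly -/

theorem mainTheorem1 (X T : ℝ) (hX : 0 < X) (hT : 0 < T)
    (r σ : ℝ → ℝ) (rbar σlow σbar : ℝ) (hσlow : 0 < σlow)
    (hr : ∀ t ∈ Icc 0 T, 0 ≤ r t ∧ r t ≤ rbar)
    (hσ : ∀ t ∈ Icc 0 T, σlow ≤ σ t ∧ σ t ≤ σbar)
    (hrLip : ∃ K, LipschitzOnWith K r (Icc 0 T))
    (hσLip : ∃ K, LipschitzOnWith K σ (Icc 0 T))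
    (θ : ℝ) (hθ : θ ∈ Icc (1 / 2 : ℝ) 1) (c : ℝ) (hc : 0 < c) :
    ∃ δ : ℝ, 0 < δ ∧
      ∀ (f u : ℝ → ℝ → ℝ) (u₀ : ℝ → ℝ),
        ContinuousOn (Function.uncurry f) (Icc 0 T ×ˢ Icc 0 X) →
        BlackScholes.MemCH1 X T f →
        ContinuousOn (Function.uncurry u) (Icc 0 T ×ˢ Icc 0 X) →
        BlackScholes.IsWeakSolution X T r σ f u₀ u →
        BlackScholes.MemH1H1 X T u →
        BlackScholes.MemH2L2 X T u →
        BlackScholes.FluxRegular X T r σ u →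
        ∃ C : ℝ, 0 < C ∧
          ∀ (G : BlackScholes.SpaceMesh X) (S : BlackScholes.TimeMesh T)
            (meth : BlackScholes.Method) (fv : BlackScholes.FaceValue) (ζ : ℕ → ℕ → ℝ),
            G.QuasiUniform c →
            (fv = BlackScholes.FaceValue.reversed → S.dt ≤ δ) →
            BlackScholes.IsDiscreteSolution G S meth fv θ r σ f u₀ ζ →
            ∀ m ≤ S.M,
              G.norm0 (fun i => u (S.t m) (G.x i) - ζ m i) ≤ C * (G.h + S.dt) := by
  obtain ⟨A, Λ, hB⟩ := BlackScholes.exists_coefBounds hT hσlow hr hσ hrLip hσLip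
  have hal : 0 < σlow ^ 2 / 2 := by positivity
  obtain ⟨Kr, hKr⟩ := hrLip
  obtain ⟨Ks, hKs⟩ := hσLip
  set κ := 3 / 8 * (A ^ 2 / (σlow ^ 2 / 2)) with hκdef
  have hκ0 : 0 ≤ κ := by positivity
  have hκ : ∀ t ∈ Icc 0 T,
      3 / 8 * (BlackScholes.coefB r σ t ^ 2 / BlackScholes.coefA σ t) ≤ κ := fun t ht =>
    mul_le_mul_of_nonneg_left (div_le_div₀ (sq_nonneg A)
      (sq_le_sq' (abs_le.1 (hB.abs_b t ht)).1 (abs_le.1 (hB.abs_b t ht)).2) hal (hB.le_a t ht))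
      (by norm_num)
  -- This δ gives 8(1 + c)κΔt ≤ 1/2, the smallness needed for the Gronwall step; the added 1 keeps
  -- the denominator positive without a lower bound on κ.
  refine ⟨1 / (2 * (8 * (1 + c) * κ + 1)), by positivity, ?_⟩
  intro f u u₀ hfc hf huc hsol h1 h2 hF
  obtain ⟨du, df, p, k₁, k₂, K, D⟩ := BlackScholes.exists_regularData hX hT hKr.continuousOn
    hKs.continuousOn (fun t ht => hal.trans_le (hB.le_a t ht)) hfc hf huc hsol h1 h2 hF
  obtain ⟨C, hC, hest⟩ := BlackScholes.exists_error_estimate hX hT hc hal hB D hθ hκ0 hκ hsol.2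
  refine ⟨C, hC, fun G S meth fv ζ hG hdt => hest G S meth fv ζ hG fun h => ?_⟩
  have hd := hdt h
  have hS := S.dt_pos
  rw [le_div_iff₀ (by positivity)] at hd
  linarith
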